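/- **Setting.** Fix $d$ and $T>0$; all space integrals are over $\mathbb R^d$. Semigroups act on bounded Borel functions with the sup norm; $f$ belongs to the domain of the infinitesimal generator if the quotients $(P_tf-f)/t$ converge uniformly as $t\downarrow0$. Let $(P_t)_{t\ge0}$ be a semigroup of integral operators $P_tf(x)=\int f(y)P_t(x,dy)$, with $P_t(x,\cdot)$ finite measures and generator $L$, such that $C_c^\infty\subset\mathrm{Dom}(L)$ and, for $f\in C_c^\infty$, $(t,x)\mapsto P_tf(x)$ is measurable and $\|P_tf\|_\infty\le\|f\|_\infty$ for $t\in[0,T]$. For each $z\in\mathbb R^d$ let $(P^z_t)_{t\ge 0}$ be a semigroup with generator $L^z$, $C_c^\infty\subset \mathrm{Dom}(L^z)$, given for $t>0$ by a transition probability density $p^z_t(x,y)$ (satisfying the Chapman–Kolmogorov equation at all points), measurable in $(z,t,x,y)$ and, for each $z$, continuous in $(t,x,y)\in(0,T]\times\mathbb R^d\times\mathbb R^d$. Put $\phi^z_t(x)=p^z_t(x,z)$ and assume $Lf(z)=L^zf(z)$ for all $z$ and all $f\in C_c^\infty\cup\{\phi^w_t: w\in\mathbb R^d,\ t\in(0,T]\}$.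 **Backward hypotheses.** (A) $\int p^y_t(x,y)\,dy$ and $\int p_t^y(x,y)\,dx$ are bounded uniformly in $t\in(0,T]$ and in $x$, resp. $y$; for $g,h\in C_c^\infty$ and all $z,w$, $\int g(x)p^z_{T+\varepsilon}(x,w)\,dx\to\int g(x)p^z_T(x,w)\,dx$ and $\int h(z')\phi^{z'}_\varepsilon(w)\,dz'\to h(w)$ as $\varepsilon\downarrow0$; and $\phi_t^z\in\mathrm{Dom}(L)\cap\bigcap_y\mathrm{Dom}(L^y)$ for $t\in(0,T]$ and all $z$. (B) There is a continuous $\hat\theta:(0,T]\times\mathbb R^d\times\mathbb R^d\to\mathbb R$ with $(L^{y_1}-L^y)\phi^y_t(y_1)=\hat\theta_t(y_1,y)\phi^y_t(y_1)$, and this function of $y_1$ is $P_s(x,dy_1)$-integrable for all $s\in[0,T]$, $x,y\in\mathbb R^d$, $t\in(0,T]$. Put $\hat a_t(x,y)=\hat\theta_t(y,x)\,\phi^x_t(y)$ and $G_t(x,y)=\phi_t^x(y)=p^x_t(y,x)$. (C) There are $\rho\in[0,1)$, a constant $C$ and measurable $\gamma,\beta\ge0$ with $|\hat a_t(x,y)|\le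 Ct^{-\rho}\gamma_t(x,y)$ on $(0,T]\times\mathbb R^d\times\mathbb R^d$; $\sup_{t,x}\int\gamma_t(x,y)\,dy<\infty$ and $\sup_{t,y}\int\gamma_t(x,y)\,dx<\infty$ ($t\in(0,T]$); $$\int\! dy_1\cdots\!\int\! dy_n\prod_{i=0}^n\gamma_{\delta_i}(y_i,y_{i+1})\le C^{n+1}\beta_{\delta_0+\dots+\delta_n}(y_0,y_{n+1})$$ for all $n\ge0$, all $y_0,y_{n+1}$ and all $\delta_i>0$ with $\sum\delta_i\le T$; $\int_0^t\!\int\beta_{t-s}(x,y)\,dy\,ds$ is bounded in $(t,x)\in[0,T]\times\mathbb R^d$; $\int_0^t\!\int|G_s(z,y)|\beta_{t-s}(x,z)\,dz\,ds<\infty$ for all $t\in(0,T]$, $x,y$; and for some $\zeta>1$ with $\zeta\rho<1$, $\sup_{t\in(0,T],y}\int_{|x|\le R}\gamma_t(x,y)^\zeta\,dx<\infty$ for every $R>0$. (D) The *uniform integrability hypothesis* holds for $(\gamma,G)$. For a (possibly vector valued) function $G$ this means: there are $r>0$, $\zeta>1$ with $\zeta\rho<1$, $\eta\in[0,1)$ and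 $\xi\ge0$, bounded on compact subsets of $(0,T]$, such that, for all $z_0,z_*\in\mathbb R^d$, * for every $R>0$ there is $C_R$ with $$\int\limits_{|y_1|+\dots+|y_{n-1}|\le R}\ \prod_{i=0}^{n-2}\gamma_{\delta_i}(y_i,y_{i+1})^\zeta\,|G_{\delta_{n-1}}(y_{n-1},y_n)|^\zeta\,dy_1\cdots dy_{n-1}\le C_R^n\,\xi\Big(\sum_{i=0}^{n-1}\delta_i\Big)\,\delta_{n-1}^{-\eta};$$ * there is $C$ such that for every $\varepsilon>0$ there is $R_\varepsilon>0$ with $$\int\limits_{|y_1|+\dots+|y_{n-1}|>R_\varepsilon}\ \prod_{i=0}^{n-2}\gamma_{\delta_i}(y_i,y_{i+1})\,|G_{\delta_{n-1}}(y_{n-1},y_n)|\,dy_1\cdots dy_{n-1}\le C^n\varepsilon\,\xi\Big(\sum_{i=0}^{n-1}\delta_i\Big)\,\delta_{n-1}^{-\eta},$$ both for all $n\ge2$, all $\delta_i>0$ with $\sum\delta_i\le T$, and all $|y_0-z_0|<r$, $|y_n-z_*|<r$. **Density.** Let $\hat A_1(t;x,y)=\hat a_t(x,y)$, $\hat A_{n+1}(t;x,y)=\int_0^t\!\int\hat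 A_n(t-s;x,z)\,\hat a_s(z,y)\,dz\,ds$ and $$p_t(x,y)=p^y_t(x,y)+\sum_{n\ge1}\int_0^t\!\!\int\hat A_n(t-s;y,z)\,p^z_s(x,z)\,dz\,ds .$$ **Backward scheme.** Let $\tau_0=0$ and let $\tau_1<\tau_2<\cdots$ be the jump times of a Poisson process $J$ of parameter $1$. Put $C_s(y)=\int\phi^y_s(w)\,dw$. A backward scheme started at $y$ is a sequence of random variables $X_{\tau_0}=y,X_{\tau_1},X_{\tau_2},\dots$ such that, given all jump times and $X_{\tau_0},\dots,X_{\tau_j}$, on $\{\tau_{j+1}\le T\}$ the law of $X_{\tau_{j+1}}$ is $C_s(X_{\tau_j})^{-1}\phi_s^{X_{\tau_j}}(w)\,dw$ with $s=\tau_{j+1}-\tau_j$. Put $$\hat\Gamma_t(y)=\prod_{j=0}^{J_t-1}C_{\tau_{j+1}-\tau_j}(X_{\tau_j})\,\hat\theta_{\tau_{j+1}-\tau_j}(X_{\tau_{j+1}},X_{\tau_j})$$ (equal to $1$ if $J_t=0$), and $\tau^{(t)}=\tau_{J_t}$. **Theorem.** Assume (A)–(D). (i) Assume that $(t,x,y)\mapsto(p^y_t(x,y),\hat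 a_t(x,y))$ is continuous on $(0,T]\times\mathbb R^d\times\mathbb R^d$. Then the series defining $p_t(x,y)$ converges for all $t\in(0,T]$ and all $x,y$; $P_tf(x)=\int f(y)p_t(x,y)\,dy$ for all $f\in C_c^\infty$, $t\in(0,T]$ and $x\in\mathbb R^d$; and $(t,x,y)\mapsto p_t(x,y)$ is continuous on $(0,T]\times\mathbb R^d\times\mathbb R^d$. Moreover, for every backward scheme started at $y$ and all $t\in(0,T]$, $x\in\mathbb R^d$ (in particular $t=T$), the expectation exists and $$p_t(x,y)=e^{t}\,\mathbb E\Big[p^{X_{\tau^{(t)}}}_{t-\tau^{(t)}}\big(x,X_{\tau^{(t)}}\big)\,\hat\Gamma_t(y)\Big].$$ (ii) If in addition $x\mapsto p_t^y(x,y)$ is differentiable for all $t\in(0,T]$, $y\in\mathbb R^d$, and the uniform integrability hypothesis holds for $\gamma$ and $(t,z,x)\mapsto\nabla_xp^z_t(x,z)$ in place of $G$, then $x\mapsto p_t(x,y)$ is differentiable for all $t\in(0,T]$, $y\in\mathbb R^d$, and, for every backward scheme started at $y$, the expectation exists and $$\nabla_xp_t(x,y)=e^{t}\,\mathbb E\Big[\nabla_xp^{X_{\tau^{(t)}}}_{t-\tau^{(t)}}\big(x,X_{\tau^{(t)}}\big)\,\hat\Gamma_t(y)\Big].$$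 -/

import Mathlib

open MeasureTheory ProbabilityTheory Filter Topology
open scoped NNReal ENNReal

namespace Parametrix

/-- The state space `ℝ^d` with its Euclidean norm and Lebesgue measure. -/
abbrev Sp (d : ℕ) : Type := EuclideanSpace ℝ (Fin d)

noncomputable section

/-! ### Semigroups and generators -/

/-- Test functions: `C_c^∞(ℝ^d)`. -/
def IsTest {d : ℕ} (f : Sp d → ℝ) : Prop :=
  ContDiff ℝ ((⊤ : ℕ∞) : WithTop ℕ∞) f ∧ HasCompactSupport f

/-- Bounded Borel functions. -/
def BddMeas {d : ℕ} (f : Sp d → ℝ) : Prop :=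
  Measurable f ∧ ∃ C : ℝ, ∀ x, |f x| ≤ C

/-- The infinitesimal generator of a family of operators `(Q_t)_{t > 0}`:
the limit of `(Q_t f - f) / t` as `t ↓ 0`. -/
def generator {d : ℕ} (Q : ℝ → (Sp d → ℝ) → Sp d → ℝ) (f : Sp d → ℝ) (x : Sp d) : ℝ :=
  limUnder (𝓝[>] (0 : ℝ)) (fun t => (Q t f x - f x) / t)

/-- The domain of the generator, in the space of bounded Borel functions with the sup norm:
the difference quotients converge uniformly. -/
def InDomain {d : ℕ} (Q : ℝ → (Sp d → ℝ) → Sp d → ℝ) (f : Sp d → ℝ) : Prop :=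
  BddMeas f ∧
    TendstoUniformly (fun (t : ℝ) x => (Q t f x - f x) / t) (generator Q f) (𝓝[>] (0 : ℝ))

/-- `P_t f(x) = ∫ f(y) P_t(x, dy)`. -/
def kernelOp {d : ℕ} (P : ℝ → Kernel (Sp d) (Sp d)) (t : ℝ) (f : Sp d → ℝ) (x : Sp d) : ℝ :=
  ∫ y, f y ∂(P t x)

/-- `Q_t f(x) = ∫ f(y) q_t(x, y) dy`. -/
def densityOp {d : ℕ} (q : ℝ → Sp d → Sp d → ℝ) (t : ℝ) (f : Sp d → ℝ) (x : Sp d) : ℝ :=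
  ∫ y, f y * q t x y

/-- `(P_t)_{t ≥ 0}` is a semigroup of integral operators whose generator has `C_c^∞` in its
domain; `(t, x) ↦ P_t f(x)` is measurable, and `‖P_t f‖ ≤ ‖f‖` on `[0, T]`, for `f ∈ C_c^∞`. -/
structure IsMainSemigroup {d : ℕ} (T : ℝ) (P : ℝ → Kernel (Sp d) (Sp d)) : Prop where
  finite : ∀ t, 0 ≤ t → ∀ x, P t x Set.univ < ∞
  zero : P 0 = Kernel.id
  add : ∀ s t, 0 ≤ s → 0 ≤ t → P (s + t) = P t ∘ₖ P s
  test_dom : ∀ f, IsTest f → InDomain (kernelOp P) f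
  meas : ∀ f, IsTest f → Measurable (fun q : ℝ≥0 × Sp d => kernelOp P (q.1 : ℝ) f q.2)
  contraction : ∀ f, IsTest f → ∀ C : ℝ, (∀ y, |f y| ≤ C) →
    ∀ t ∈ Set.Icc 0 T, ∀ x, |kernelOp P t f x| ≤ C

/-- For each `z`, `p z t x y = p^z_t(x, y)` is the transition probability density of a semigroup
`(P^z_t)_{t ≥ 0}` (for `t > 0`, `P^z_t = densityOp (p z) t`), jointly measurable, continuous in
`(t, x, y) ∈ (0, T] × ℝ^d × ℝ^d`, and `C_c^∞` lies in the domain of the generator `L^z`. -/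
structure IsFrozenFamily {d : ℕ} (T : ℝ) (p : Sp d → ℝ → Sp d → Sp d → ℝ) : Prop where
  meas : Measurable (fun q : Sp d × ℝ × Sp d × Sp d => p q.1 q.2.1 q.2.2.1 q.2.2.2)
  cont : ∀ z, ContinuousOn (fun q : ℝ × Sp d × Sp d => p z q.1 q.2.1 q.2.2)
    (Set.Ioc 0 T ×ˢ Set.univ)
  nonneg : ∀ z t x y, 0 < t → 0 ≤ p z t x y
  mass_one : ∀ z t x, 0 < t → ∫⁻ y, ENNReal.ofReal (p z t x y) = 1
  chapman : ∀ z s t x y, 0 < s → 0 < t →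
    ∫⁻ w, ENNReal.ofReal (p z s x w) * ENNReal.ofReal (p z t w y)
      = ENNReal.ofReal (p z (s + t) x y)
  test_dom : ∀ z f, IsTest f → InDomain (densityOp (p z)) f

/-- `φ_t^z(x) = p_t^z(x, z)`. -/
def phi {d : ℕ} (p : Sp d → ℝ → Sp d → Sp d → ℝ) (t : ℝ) (z x : Sp d) : ℝ := p z t x z

/-- `L f(z) = L^z f(z)` for test functions and for the functions `φ_t^w`. -/
structure GeneratorsAgree {d : ℕ} (T : ℝ) (P : ℝ → Kernel (Sp d) (Sp d))
    (p : Sp d → ℝ → Sp d → Sp d → ℝ) : Prop where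
  test : ∀ f, IsTest f → ∀ z, generator (kernelOp P) f z = generator (densityOp (p z)) f z
  frozen : ∀ t ∈ Set.Ioc 0 T, ∀ w z,
    generator (kernelOp P) (phi p t w) z = generator (densityOp (p z)) (phi p t w) z

/-! ### Hypotheses of the backward method -/

/-- Regularity of the frozen densities, as functions with the arrival point frozen. -/
structure BackwardRegularity {d : ℕ} (T : ℝ) (P : ℝ → Kernel (Sp d) (Sp d))
    (p : Sp d → ℝ → Sp d → Sp d → ℝ) : Prop where
  bdd_integral : ∃ C : ℝ≥0, ∀ t ∈ Set.Ioc 0 T,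
    (∀ x, ∫⁻ y, ENNReal.ofReal (p y t x y) ≤ C) ∧ (∀ y, ∫⁻ x, ENNReal.ofReal (p y t x y) ≤ C)
  adjoint_cont : ∀ g, IsTest g → ∀ z w,
    Tendsto (fun ε => ∫ x, g x * p z (T + ε) x w) (𝓝[>] 0) (𝓝 (∫ x, g x * p z T x w))
  approx_id : ∀ h, IsTest h → ∀ w,
    Tendsto (fun ε => ∫ z, h z * phi p ε z w) (𝓝[>] 0) (𝓝 (h w))
  phi_dom : ∀ t ∈ Set.Ioc 0 T, ∀ z, InDomain (kernelOp P) (phi p t z)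
  phi_dom_frozen : ∀ t ∈ Set.Ioc 0 T, ∀ z y, InDomain (densityOp (p y)) (phi p t z)

/-- `θ` is a continuous function with `(L^{y₁} - L^y) φ_t^y (y₁) = θ_t(y₁, y) φ_t^y(y₁)`, and the
right-hand side is integrable in `y₁` for each `P_s(x, dy₁)`. -/
structure IsBackwardWeight {d : ℕ} (T : ℝ) (P : ℝ → Kernel (Sp d) (Sp d))
    (p : Sp d → ℝ → Sp d → Sp d → ℝ) (θ : ℝ → Sp d → Sp d → ℝ) : Prop where
  cont : ContinuousOn (fun q : ℝ × Sp d × Sp d => θ q.1 q.2.1 q.2.2) (Set.Ioc 0 T ×ˢ Set.univ)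
  eq : ∀ t ∈ Set.Ioc 0 T, ∀ y y₁,
    generator (densityOp (p y₁)) (phi p t y) y₁ - generator (densityOp (p y)) (phi p t y) y₁
      = θ t y₁ y * phi p t y y₁
  integrable : ∀ s ∈ Set.Icc 0 T, ∀ x, ∀ t ∈ Set.Ioc 0 T, ∀ y,
    Integrable (fun y₁ => θ t y₁ y * phi p t y y₁) (P s x)

/-- `â_t(x, y) = θ_t(y, x) φ_t^x(y)`. -/
def aHat {d : ℕ} (p : Sp d → ℝ → Sp d → Sp d → ℝ) (θ : ℝ → Sp d → Sp d → ℝ)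
    (t : ℝ) (x y : Sp d) : ℝ := θ t y x * phi p t x y

/-- For a chain of points `y₀, y 0, …, y (n-1), y_end` with time steps `δ 0, …, δ n`: the product
of `γ` over all links but the last, times `G` at the last link. -/
def chainProd {d n : ℕ} (γ G : ℝ → Sp d → Sp d → ℝ≥0∞) (δ : Fin (n + 1) → ℝ)
    (y₀ : Sp d) (y : Fin n → Sp d) (yEnd : Sp d) : ℝ≥0∞ :=
  let z : Fin (n + 1) → Sp d := Fin.cons y₀ y
  (∏ i : Fin n, γ (δ i.castSucc) (z i.castSucc) (z i.succ)) *
    G (δ (Fin.last n)) (z (Fin.last n)) yEnd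

/-- The class `Γ_β` (times restricted to the horizon `T`). -/
def GammaClass {d : ℕ} (T : ℝ) (γ β : ℝ → Sp d → Sp d → ℝ≥0) : Prop :=
  ∃ C : ℝ≥0, ∀ (n : ℕ) (δ : Fin (n + 1) → ℝ), (∀ i, 0 < δ i) → ∑ i, δ i ≤ T →
    ∀ y₀ yEnd : Sp d,
      ∫⁻ y : Fin n → Sp d,
          chainProd (fun t a b => (γ t a b : ℝ≥0∞)) (fun t a b => (γ t a b : ℝ≥0∞)) δ y₀ y yEnd
        ≤ (C : ℝ≥0∞) ^ (n + 1) * (β (∑ i, δ i) y₀ yEnd : ℝ≥0∞)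

/-- The class `𝓜` of functions `G` with `∫_0^t ∫ |G_s(z, y)| β_{t-s}(x, z) dz ds < ∞`. -/
def InClassM {d : ℕ} (T : ℝ) (β : ℝ → Sp d → Sp d → ℝ≥0) (G : ℝ → Sp d → Sp d → ℝ) : Prop :=
  ∀ t ∈ Set.Ioc 0 T, ∀ x y,
    ∫⁻ s in Set.Ioo 0 t, ∫⁻ z, ‖G s z y‖ₑ * (β (t - s) x z : ℝ≥0∞) < ∞

/-- The bounds on `â` by `γ` and `β` that make the Volterra equation solvable, with
`G_t(x, y) = p_t^x(y, x)` in the class `𝓜`. -/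
structure BackwardDomination {d : ℕ} (T : ℝ) (p : Sp d → ℝ → Sp d → Sp d → ℝ)
    (θ : ℝ → Sp d → Sp d → ℝ) (γ β : ℝ → Sp d → Sp d → ℝ≥0) (ρ : ℝ) : Prop where
  meas_gamma : Measurable (fun q : ℝ × Sp d × Sp d => γ q.1 q.2.1 q.2.2)
  meas_beta : Measurable (fun q : ℝ × Sp d × Sp d => β q.1 q.2.1 q.2.2)
  rho_nonneg : 0 ≤ ρ
  rho_lt_one : ρ < 1
  bound : ∃ C : ℝ, ∀ t ∈ Set.Ioc 0 T, ∀ x y, |aHat p θ t x y| ≤ C / t ^ ρ * (γ t x y : ℝ)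
  gamma_right : ∃ C : ℝ≥0, ∀ t ∈ Set.Ioc 0 T, ∀ x, ∫⁻ y, (γ t x y : ℝ≥0∞) ≤ C
  gamma_class : GammaClass T γ β
  beta_bdd : ∃ C : ℝ≥0, ∀ t ∈ Set.Icc 0 T, ∀ x,
    ∫⁻ s in Set.Ioo 0 t, ∫⁻ y, (β (t - s) x y : ℝ≥0∞) ≤ C
  class_M : InClassM T β (fun t x y => phi p t x y)
  gamma_left : ∃ C : ℝ≥0, ∀ t ∈ Set.Ioc 0 T, ∀ y, ∫⁻ x, (γ t x y : ℝ≥0∞) ≤ C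
  gamma_pow : ∃ ζ : ℝ, 1 < ζ ∧ ζ * ρ < 1 ∧ ∀ R > (0 : ℝ), ∃ C : ℝ≥0,
    ∀ t ∈ Set.Ioc 0 T, ∀ y, ∫⁻ x in {x | ‖x‖ ≤ R}, (γ t x y : ℝ≥0∞) ^ ζ ≤ C

/-- The uniform integrability hypothesis for the pair `(γ, G)`: there are `r > 0`,
`ζ ∈ (1, 1/ρ)`, `η ∈ [0, 1)` and `ξ`, bounded on compact subsets of `(0, T]`, such that products
along chains with end points near `z₀`, `z₁` satisfy a bound in `L^ζ` on compact sets, and a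
tightness bound in `L^1`. -/
def UniformIntegrability {d : ℕ} {F : Type*} [NormedAddCommGroup F] (T : ℝ)
    (γ : ℝ → Sp d → Sp d → ℝ≥0) (ρ : ℝ) (G : ℝ → Sp d → Sp d → F) : Prop :=
  ∃ r > (0 : ℝ), ∃ ζ : ℝ, 1 < ζ ∧ ζ * ρ < 1 ∧ ∃ η : ℝ, 0 ≤ η ∧ η < 1 ∧ ∃ ξ : ℝ → ℝ≥0,
    (∀ t₀ > (0 : ℝ), ∃ M : ℝ≥0, ∀ t ∈ Set.Icc t₀ T, ξ t ≤ M) ∧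
    (∀ z₀ z₁ : Sp d, ∀ R > (0 : ℝ), ∃ C : ℝ≥0,
      ∀ (n : ℕ), 1 ≤ n → ∀ δ : Fin (n + 1) → ℝ, (∀ i, 0 < δ i) → ∑ i, δ i ≤ T →
      ∀ y₀ ∈ Metric.ball z₀ r, ∀ y₁ ∈ Metric.ball z₁ r,
        ∫⁻ y in {y : Fin n → Sp d | ∑ i, ‖y i‖ ≤ R},
            chainProd (fun t a b => (γ t a b : ℝ≥0∞) ^ ζ) (fun t a b => ‖G t a b‖ₑ ^ ζ) δ y₀ y y₁
          ≤ (C : ℝ≥0∞) ^ (n + 1) * (ξ (∑ i, δ i) : ℝ≥0∞)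
              * ENNReal.ofReal (δ (Fin.last n) ^ (-η))) ∧
    (∀ z₀ z₁ : Sp d, ∃ C : ℝ≥0, ∀ ε : ℝ≥0, 0 < ε → ∃ R > (0 : ℝ),
      ∀ (n : ℕ), 1 ≤ n → ∀ δ : Fin (n + 1) → ℝ, (∀ i, 0 < δ i) → ∑ i, δ i ≤ T →
      ∀ y₀ ∈ Metric.ball z₀ r, ∀ y₁ ∈ Metric.ball z₁ r,
        ∫⁻ y in {y : Fin n → Sp d | R < ∑ i, ‖y i‖},
            chainProd (fun t a b => (γ t a b : ℝ≥0∞)) (fun t a b => ‖G t a b‖ₑ) δ y₀ y y₁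
          ≤ (C : ℝ≥0∞) ^ (n + 1) * (ε : ℝ≥0∞) * (ξ (∑ i, δ i) : ℝ≥0∞)
              * ENNReal.ofReal (δ (Fin.last n) ^ (-η)))

/-! ### The parametrix series -/

/-- The iterated kernels of `a`: `iterKernel a n t x y = A_{n+1}((t, x), (0, y))`. -/
def iterKernel {d : ℕ} (a : ℝ → Sp d → Sp d → ℝ) : ℕ → ℝ → Sp d → Sp d → ℝ
  | 0 => a
  | n + 1 => fun t x y => ∫ s in (0 : ℝ)..t, ∫ z, iterKernel a n (t - s) x z * a s z y

/-- The `(n+1)`-st term of the backward parametrix series, for departure point `x` and arrival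
point `y`: `∫_0^t ∫ Â_{n+1}((t, y), (s, z)) p_s^z(x, z) dz ds`. -/
def seriesTerm {d : ℕ} (p : Sp d → ℝ → Sp d → Sp d → ℝ) (θ : ℝ → Sp d → Sp d → ℝ)
    (n : ℕ) (t : ℝ) (x y : Sp d) : ℝ :=
  ∫ s in (0 : ℝ)..t, ∫ z, iterKernel (aHat p θ) n (t - s) y z * phi p s z x

/-- `p_t(x, y)`: the frozen density plus the backward parametrix series. -/
def transDensity {d : ℕ} (p : Sp d → ℝ → Sp d → Sp d → ℝ) (θ : ℝ → Sp d → Sp d → ℝ)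
    (t : ℝ) (x y : Sp d) : ℝ :=
  p y t x y + ∑' n, seriesTerm p θ n t x y

/-! ### The probabilistic representation -/

/-- `τ 0 = 0`, and `τ 1, τ 2, …` are the jump times of a Poisson process of parameter one:
the waiting times are independent and exponential of parameter one. -/
structure IsPoissonJumpTimes {Ω : Type*} [MeasurableSpace Ω] (μ : Measure Ω)
    (τ : ℕ → Ω → ℝ) : Prop where
  zero : ∀ ω, τ 0 ω = 0
  meas : ∀ j, Measurable (τ j)
  indep : iIndepFun (fun (j : ℕ) ω => τ (j + 1) ω - τ j ω) μ
  law : ∀ j, μ.map (fun ω => τ (j + 1) ω - τ j ω) = expMeasure 1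

/-- The number of jumps `J_t` up to time `t`. -/
def jumpCount {Ω : Type*} (τ : ℕ → Ω → ℝ) (t : ℝ) (ω : Ω) : ℕ :=
  Set.ncard {j : ℕ | τ (j + 1) ω ≤ t}

/-- The normalizing mass `C_t(y) = ∫ φ_t^y(w) dw`. -/
def phiMass {d : ℕ} (p : Sp d → ℝ → Sp d → Sp d → ℝ) (t : ℝ) (y : Sp d) : ℝ :=
  ∫ w, phi p t y w

/-- The information of all jump times and of the positions `X 0, …, X j`. -/
abbrev history {d : ℕ} {Ω : Type*} (τ : ℕ → Ω → ℝ) (X : ℕ → Ω → Sp d) (j : ℕ) :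
    MeasurableSpace Ω :=
  MeasurableSpace.comap
    (fun ω => ((fun k => τ k ω : ℕ → ℝ), (fun i => X i ω : Fin (j + 1) → Sp d))) inferInstance

/-- `X j` is the position at the jump time `τ j` of the backward Euler scheme started at `y`: given
all jump times and `X 0, …, X j`, the law of `X (j+1)` is `C_s(X j)⁻¹ φ_s^{X j}(w) dw` with
`s = τ (j+1) - τ j`, as long as `τ (j+1) ≤ T`. -/
structure IsBackwardScheme {d : ℕ} {Ω : Type*} [MeasurableSpace Ω] (μ : Measure Ω) (T : ℝ)
    (p : Sp d → ℝ → Sp d → Sp d → ℝ) (y : Sp d) (τ : ℕ → Ω → ℝ) (X : ℕ → Ω → Sp d) : Prop where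
  init : ∀ ω, X 0 ω = y
  meas : ∀ j, Measurable (X j)
  step : ∀ (j : ℕ) (B : Set (Sp d)), MeasurableSet B →
    μ⟦X (j + 1) ⁻¹' B | history τ X j⟧ =ᵐ[μ.restrict {ω | τ (j + 1) ω ≤ T}]
      fun ω => (phiMass p (τ (j + 1) ω - τ j ω) (X j ω))⁻¹ *
        ∫ w in B, phi p (τ (j + 1) ω - τ j ω) (X j ω) w

/-- The weight `Γ̂_t`: the product over `j < J_t` of
`C_s(X j) θ_s(X (j+1), X j)` with `s = τ (j+1) - τ j` (an empty product is one). -/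
def pathWeight {d : ℕ} {Ω : Type*} (p : Sp d → ℝ → Sp d → Sp d → ℝ)
    (θ : ℝ → Sp d → Sp d → ℝ) (τ : ℕ → Ω → ℝ) (X : ℕ → Ω → Sp d) (t : ℝ) (ω : Ω) : ℝ :=
  ∏ j ∈ Finset.range (jumpCount τ t ω),
    (phiMass p (τ (j + 1) ω - τ j ω) (X j ω) *
      θ (τ (j + 1) ω - τ j ω) (X (j + 1) ω) (X j ω))

/-- The time `t - τ_{J_t}` since the last jump before `t`. -/
def lastAge {Ω : Type*} (τ : ℕ → Ω → ℝ) (t : ℝ) (ω : Ω) : ℝ := t - τ (jumpCount τ t ω) ω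

/-- The position `X_{τ_{J_t}}` at the last jump before `t`. -/
def lastPos {d : ℕ} {Ω : Type*} (τ : ℕ → Ω → ℝ) (X : ℕ → Ω → Sp d) (t : ℝ) (ω : Ω) : Sp d :=
  X (jumpCount τ t ω) ω

/-- `∇_x p_t^z(x, z)`. -/
def gradPhi {d : ℕ} (p : Sp d → ℝ → Sp d → Sp d → ℝ) (t : ℝ) (z x : Sp d) : Sp d :=
  gradient (fun x' => phi p t z x') x

end

end Parametrix

/-! Freeze the generator at the arrival point z. Since L f(w) = L^w f(w) on frozen densities, u ↦
P_{τ-u} φ_u^z (x) has right derivative -P_{τ-u}(L - L^z)φ_u^z (x) = -∫ â_u(z,w) P_{τ-u}(x,dw).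
Integrating from ε > 0, where φ is still a function and not a point mass, gives Duhamel's formula
(`kernelOp_phi_sub`). Tested against h ∈ C_c^∞ and with ε ↓ 0, it shows that P_t(x,·) has a density
q_t solving the Volterra equation q_t(z) = φ_t^z(x) + ∫_0^t ∫ â_{t-s}(z,w) P_s(x,dw) ds
(`volterra_isTest`, `kernel_eq_withDensity`). Substituting the equation into itself produces the
parametrix series. The remainder is an iterated kernel convolved with the occupation measure
P_s(x,dw) ds; its L¹ norms in z are summable, so it tends to zero almost everywhere
(`tendsto_occConv_chainInt`, `occDensity_eq_tsum`). Left continuity of both sides then covers t = T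
(`kernelOp_eq_integral_tsum`).

For the estimates, the n-th term is written as a single integral `chainInt` over chains of n points
in time and space. At fixed times, the spatial integrals are bounded by C^n through the uniform
integrability hypothesis. Integrating the singularities t^(-ρ) over increasing times gains a factor
κ^n with κ as small as desired, at the price of a weight e^(lt)
(`lintegral_chainWeight_timePow_le`). Hence the terms decay like 2^(-n), locally uniformly
(`UniformIntegrability.exists_chainBounds`). As ζρ < 1 leaves room for a power ζ > 1, the same bound
holds for ζ-th powers on compact sets. Together with tightness this permits passing to the limit
under the integral without a dominating function (`tendsto_integral_of_tight_of_rpow_bounded`),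
which gives continuity of each term; the geometric bound then handles the sum. Differentiability
follows likewise, with the normalized first-order remainder controlled by averages of the gradient
along segments (`hasGradientAt_integral`).

For the probabilistic formulas, on the event of exactly n jumps before t the jump times have density
e^(-t) on increasing n-tuples. The factors C in the weight cancel the normalization of the steps, so
the positions carry the density ∏ φ, and φ times θ is â again. The expectation over this event is
therefore e^(-t) times the n-th chain integral (`setIntegral_jumpTerm`), and summation over n gives
the representation (`integrable_and_tsum_chainInt_eq`). -/

namespace Parametrix

noncomputable section

section

/-! ### Chains -/

section Chain

variable {V R : Type*} {n : ℕ}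

/-- The points of a chain, including its starting point. -/
def path (v₀ : V) (v : Fin n → V) : Fin (n + 1) → V := Fin.cons v₀ v

/-- The last point of a chain. -/
def pathEnd (v₀ : V) (v : Fin n → V) : V := path v₀ v (Fin.last n)

/-- The product of `ℓ` over the links of a chain. -/
def chainWeight [CommMonoid R] (ℓ : V → V → R) (v₀ : V) (v : Fin n → V) : R :=
  ∏ i : Fin n, ℓ (path v₀ v i.castSucc) (path v₀ v i.succ)

lemma path_snoc_castSucc (v₀ : V) (v : Fin n → V) (w : V) (i : Fin (n + 1)) :
    path v₀ (Fin.snoc v w : Fin (n + 1) → V) i.castSucc = path v₀ v i := by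
  unfold path
  rw [Fin.cons_snoc_eq_snoc_cons, Fin.snoc_castSucc]

lemma pathEnd_snoc (v₀ : V) (v : Fin n → V) (w : V) :
    pathEnd v₀ (Fin.snoc v w : Fin (n + 1) → V) = w := by
  unfold pathEnd path
  rw [Fin.cons_snoc_eq_snoc_cons, Fin.snoc_last]

lemma pathEnd_zero (v₀ : V) (v : Fin 0 → V) : pathEnd v₀ v = v₀ := rfl

lemma path_succ (v₀ : V) (v : Fin n → V) (i : Fin n) : path v₀ v i.succ = v i := by
  simp [path]

/-- Used with the two coordinate projections to separate the times of a chain from its positions. -/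
lemma path_map {W : Type*} (f : V → W) (v₀ : V) (v : Fin n → V) (i : Fin (n + 1)) :
    path (f v₀) (fun j => f (v j)) i = f (path v₀ v i) := by
  unfold path
  refine Fin.cases ?_ (fun j => ?_) i <;> simp

lemma chainWeight_zero [CommMonoid R] (ℓ : V → V → R) (v₀ : V) (v : Fin 0 → V) :
    chainWeight ℓ v₀ v = 1 := by simp [chainWeight]

/-- Chains grow at their far end because the last link carries a kernel of its own: splitting off
the last intermediate point turns what precedes it into an iterated kernel. -/
lemma chainWeight_snoc [CommMonoid R] (ℓ : V → V → R) (v₀ : V) (v : Fin n → V) (w : V) :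
    chainWeight ℓ v₀ (Fin.snoc v w : Fin (n + 1) → V)
      = chainWeight ℓ v₀ v * ℓ (pathEnd v₀ v) w := by
  unfold chainWeight
  rw [Fin.prod_univ_castSucc]
  congr 1
  · refine Finset.prod_congr rfl fun i _ => ?_
    rw [path_snoc_castSucc, Fin.succ_castSucc, path_snoc_castSucc]
  · rw [path_snoc_castSucc, Fin.succ_last]
    congr 1
    exact pathEnd_snoc v₀ v w

lemma chainWeight_mul [CommMonoid R] (ℓ ℓ' : V → V → R) (v₀ : V) (v : Fin n → V) :
    chainWeight (fun a b => ℓ a b * ℓ' a b) v₀ v = chainWeight ℓ v₀ v * chainWeight ℓ' v₀ v :=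
  Finset.prod_mul_distrib

lemma chainWeight_const_mul [CommMonoid R] (c : R) (ℓ : V → V → R) (v₀ : V) (v : Fin n → V) :
    chainWeight (fun a b => c * ℓ a b) v₀ v = c ^ n * chainWeight ℓ v₀ v := by
  rw [chainWeight_mul]; simp [chainWeight]

lemma chainWeight_comp {W : Type*} [CommMonoid R] (f : V → W) (ℓ : W → W → R) (v₀ : V)
    (v : Fin n → V) :
    chainWeight (fun a b => ℓ (f a) (f b)) v₀ v = chainWeight ℓ (f v₀) (fun i => f (v i)) := by
  unfold chainWeight
  simp_rw [path_map]

lemma chainWeight_enorm (ℓ : V → V → ℝ) (v₀ : V) (v : Fin n → V) :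
    ‖chainWeight ℓ v₀ v‖ₑ = chainWeight (fun a b => ‖ℓ a b‖ₑ) v₀ v := by
  unfold chainWeight
  simp only [enorm_eq_nnnorm, nnnorm_prod, ENNReal.ofNNReal_finsetProd]

variable [MeasurableSpace V]

lemma measurable_path (i : Fin (n + 1)) :
    Measurable fun q : V × (Fin n → V) => path q.1 q.2 i := by
  unfold path
  refine Fin.cases ?_ (fun j => ?_) i
  · simpa using measurable_fst
  · simp only [Fin.cons_succ, Fin.snoc_castSucc]
    fun_prop

lemma measurable_pathEnd : Measurable fun q : V × (Fin n → V) => pathEnd q.1 q.2 :=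
  measurable_path _

lemma measurable_chainWeight [CommMonoid R] [MeasurableSpace R] [MeasurableMul₂ R]
    {ℓ : V → V → R} (h : Measurable fun q : V × V => ℓ q.1 q.2) :
    Measurable fun q : V × (Fin n → V) => chainWeight ℓ q.1 q.2 := by
  unfold chainWeight
  refine Finset.measurable_prod _ fun i _ => ?_
  exact h.comp (f := fun q : V × (Fin n → V) => (path q.1 q.2 i.castSucc, path q.1 q.2 i.succ))
    ((measurable_path _).prodMk (measurable_path _))

lemma measurable_snoc :
    Measurable fun q : V × (Fin n → V) => (Fin.snoc q.2 q.1 : Fin (n + 1) → V) := by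
  refine measurable_pi_lambda _ fun i => ?_
  refine Fin.lastCases ?_ (fun j => ?_) i
  · simpa using measurable_fst
  · simp only [Fin.cons_succ, Fin.snoc_castSucc]
    fun_prop

end Chain

/-! ### Integration over one more point of a chain. -/

section Snoc

variable {V : Type*} [MeasureSpace V] [SigmaFinite (volume : Measure V)] {n : ℕ}

/-- Inserting at the last index is `Fin.snoc`, so this is the usual splitting of a product measure.
It turns induction on the length of a chain into Fubini's theorem. -/
lemma measurePreserving_snoc :
    MeasurePreserving (fun q : V × (Fin n → V) => (Fin.snoc q.2 q.1 : Fin (n + 1) → V)) := by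
  have h := (volume_preserving_piFinSuccAbove (fun _ : Fin (n + 1) => V) (Fin.last n)).symm
  convert h using 1
  funext q
  exact (Fin.insertNth_last' q.1 q.2).symm

lemma measurableEmbedding_snoc :
    MeasurableEmbedding (fun q : V × (Fin n → V) => (Fin.snoc q.2 q.1 : Fin (n + 1) → V)) := by
  have h := (MeasurableEquiv.piFinSuccAbove (fun _ : Fin (n + 1) => V)
    (Fin.last n)).symm.measurableEmbedding
  convert h using 1
  funext q
  exact (Fin.insertNth_last' q.1 q.2).symm

lemma lintegral_snoc {F : (Fin (n + 1) → V) → ℝ≥0∞} (hF : Measurable F) :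
    ∫⁻ v, F v = ∫⁻ w : V, ∫⁻ v : Fin n → V, F (Fin.snoc v w) := by
  rw [← measurePreserving_snoc.lintegral_comp hF]
  exact lintegral_prod _ (hF.comp measurable_snoc).aemeasurable

variable {F : Type*} [NormedAddCommGroup F]

lemma integrable_snoc {f : (Fin (n + 1) → V) → F} :
    Integrable f ↔ Integrable fun q : V × (Fin n → V) => f (Fin.snoc q.2 q.1) :=
  (measurePreserving_snoc.integrable_comp_emb measurableEmbedding_snoc).symm

lemma integral_snoc [NormedSpace ℝ F] {f : (Fin (n + 1) → V) → F} (hf : Integrable f) :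
    ∫ v, f v = ∫ w : V, ∫ v : Fin n → V, f (Fin.snoc v w) := by
  rw [← measurePreserving_snoc.integral_comp measurableEmbedding_snoc]
  exact integral_prod _ (integrable_snoc.1 hf)

/-- Lebesgue measure on the one-point space is a Dirac mass, so a chain without intermediate points
contributes its integrand. -/
lemma lintegral_fin_zero (F : (Fin 0 → V) → ℝ≥0∞) : ∫⁻ v, F v = F Fin.elim0 := by
  have : (volume : Measure (Fin 0 → V)) = Measure.dirac Fin.elim0 := by
    rw [volume_pi, Measure.pi_of_empty]
    congr 1
  rw [this, lintegral_dirac]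

lemma integral_fin_zero [NormedSpace ℝ F] [CompleteSpace F] (f : (Fin 0 → V) → F) :
    ∫ v, f v = f Fin.elim0 := by
  have : (volume : Measure (Fin 0 → V)) = Measure.dirac Fin.elim0 := by
    rw [volume_pi, Measure.pi_of_empty]
    congr 1
  rw [this, integral_dirac]

lemma lintegral_fin_prod {A B : Type*} [MeasureSpace A] [MeasureSpace B]
    [SigmaFinite (volume : Measure A)] [SigmaFinite (volume : Measure B)]
    {F : (Fin n → A × B) → ℝ≥0∞} (hF : Measurable F) :
    ∫⁻ v, F v = ∫⁻ s : Fin n → A, ∫⁻ y : Fin n → B, F fun i => (s i, y i) := by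
  have h := (volume_measurePreserving_arrowProdEquivProdArrow A B (Fin n)).symm
  rw [← h.lintegral_comp hF]
  exact lintegral_prod _ (hF.comp (MeasurableEquiv.measurable _)).aemeasurable

end Snoc

/-! ### Powers of time -/

/-- `t ^ (-ρ)` for `t > 0`, extended by zero. -/
def timePow (ρ t : ℝ) : ℝ≥0∞ := if 0 < t then ENNReal.ofReal (t ^ (-ρ)) else 0

lemma measurable_timePow (ρ : ℝ) : Measurable (timePow ρ) := by
  unfold timePow
  exact Measurable.ite measurableSet_Ioi (by fun_prop) measurable_const

lemma timePow_ne_top (ρ t : ℝ) : timePow ρ t ≠ ∞ := by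
  unfold timePow; split_ifs <;> simp

lemma timePow_of_pos {ρ t : ℝ} (h : 0 < t) : timePow ρ t = ENNReal.ofReal (t ^ (-ρ)) := if_pos h

lemma timePow_of_nonpos {ρ t : ℝ} (h : t ≤ 0) : timePow ρ t = 0 := if_neg h.not_gt

/-- Halving the time multiplies the power by 2^ρ ≤ 2. This serves to split a convolution at its
midpoint. -/
lemma timePow_le_two_mul {ρ : ℝ} (h0 : 0 ≤ ρ) (h1 : ρ < 1) {t u : ℝ} (ht : 0 < t)
    (h : t / 2 ≤ u) : timePow ρ u ≤ 2 * timePow ρ t := by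
  have hu : 0 < u := by linarith
  rw [timePow_of_pos ht, timePow_of_pos hu,
    show (2 : ℝ≥0∞) = ENNReal.ofReal 2 by simp, ← ENNReal.ofReal_mul (by norm_num)]
  refine ENNReal.ofReal_le_ofReal ?_
  calc u ^ (-ρ) ≤ (t / 2) ^ (-ρ) :=
        Real.rpow_le_rpow_of_nonpos (by positivity) h (by linarith)
    _ = 2 ^ ρ * t ^ (-ρ) := by
        rw [Real.div_rpow ht.le (by norm_num), Real.rpow_neg (by norm_num : (0:ℝ) ≤ 2)]
        field_simp
    _ ≤ 2 * t ^ (-ρ) := by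
        gcongr
        calc (2:ℝ) ^ ρ ≤ 2 ^ (1:ℝ) := Real.rpow_le_rpow_of_exponent_le (by norm_num) h1.le
          _ = 2 := by simp

/-- For t > 0 the ratio of the two powers is t^(ρ-α) ≤ (1+T)^(ρ-α) ≤ 1+T. The bound brings several
time singularities to one common exponent. -/
lemma timePow_le_timePow {T α ρ : ℝ} (h0 : 0 ≤ α) (h : α ≤ ρ) (h1 : ρ < 1) {t : ℝ}
    (ht : t ≤ T) : timePow α t ≤ ENNReal.ofReal (1 + T) * timePow ρ t := by
  rcases le_or_gt t 0 with h' | h'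
  · rw [timePow_of_nonpos h']; simp
  rw [timePow_of_pos h', timePow_of_pos h', ← ENNReal.ofReal_mul (by linarith)]
  refine ENNReal.ofReal_le_ofReal ?_
  have : t ^ (-α) = t ^ (ρ - α) * t ^ (-ρ) := by
    rw [← Real.rpow_add h']; ring_nf
  rw [this]
  gcongr
  calc t ^ (ρ - α) ≤ (1 + T) ^ (ρ - α) := by gcongr; linarith
    _ ≤ (1 + T) ^ (1:ℝ) := Real.rpow_le_rpow_of_exponent_le (by linarith) (by linarith)
    _ = _ := by simp

lemma timePow_rpow {ρ z : ℝ} (hz : 0 < z) (t : ℝ) : timePow ρ t ^ z = timePow (z * ρ) t := by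
  unfold timePow
  split_ifs with h
  · rw [ENNReal.ofReal_rpow_of_nonneg (by positivity) hz.le, ← Real.rpow_mul h.le]
    ring_nf
  · simp [hz]

/-- The integral is the Laplace transform Γ(1-ρ) l^(ρ-1), which tends to zero as l → ∞ because ρ <
1. -/
lemma lintegral_timePow_exp_le {ρ : ℝ} (h1 : ρ < 1) {κ : ℝ≥0∞} (hκ : 0 < κ) :
    ∃ l : ℝ, 0 ≤ l ∧ ∫⁻ r, timePow ρ r * ENNReal.ofReal (Real.exp (-(l * r))) ≤ κ := by
  have key : ∀ l : ℝ, 0 < l → ∫⁻ r, timePow ρ r * ENNReal.ofReal (Real.exp (-(l * r)))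
      = ENNReal.ofReal ((1 / l) ^ (1 - ρ) * Real.Gamma (1 - ρ)) := by
    intro l hl
    have hint : IntegrableOn (fun t : ℝ => t ^ ((1 - ρ) - 1) * Real.exp (-(l * t)))
        (Set.Ioi 0) := by
      have := integrableOn_rpow_mul_exp_neg_mul_rpow (p := 1) (s := -ρ) (b := l)
        (by linarith) one_pos hl
      refine this.congr_fun (fun t _ => ?_) measurableSet_Ioi
      simp
    rw [← Real.integral_rpow_mul_exp_neg_mul_Ioi (by linarith : 0 < 1 - ρ) hl,
      ofReal_integral_eq_lintegral_ofReal hint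
        ((ae_restrict_iff' measurableSet_Ioi).2 (.of_forall fun t ht => by
          have : (0:ℝ) < t := ht
          positivity)), ← lintegral_indicator measurableSet_Ioi]
    refine lintegral_congr fun r => ?_
    unfold timePow Set.indicator
    simp only [Set.mem_Ioi]
    split_ifs with h
    · rw [← ENNReal.ofReal_mul (by positivity)]
      ring_nf
    · simp
  have hlim : Tendsto (fun l : ℝ => ENNReal.ofReal ((1 / l) ^ (1 - ρ) * Real.Gamma (1 - ρ)))
      atTop (𝓝 0) := by
    rw [← ENNReal.ofReal_zero]
    refine ENNReal.tendsto_ofReal ?_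
    have h2 : Tendsto (fun l : ℝ => (1 / l) ^ (1 - ρ)) atTop (𝓝 0) := by
      have := (tendsto_rpow_neg_atTop (by linarith : 0 < 1 - ρ))
      refine this.congr' ?_
      filter_upwards [eventually_gt_atTop 0] with l hl
      rw [one_div, Real.inv_rpow hl.le, Real.rpow_neg hl.le]
    simpa using h2.mul_const (Real.Gamma (1 - ρ))
  obtain ⟨l, hl, hl'⟩ := ((hlim.eventually (gt_mem_nhds hκ)).and (eventually_gt_atTop 0)).exists
  exact ⟨l, hl'.le, (key l hl').trans_le hl.le⟩

/-- Of u and t - u one is at least t/2, and its power is at most 2 t^(-ρ). What is left, after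
taking out e^(lt), is a Laplace integrand in the other variable: exactly when u ≥ t/2, and because
lu ≤ lt - lu when u < t/2. -/
lemma timePow_convolution_le {ρ : ℝ} (h0 : 0 ≤ ρ) (h1 : ρ < 1) {κ : ℝ≥0∞} (hκ : 0 < κ) :
    ∃ l : ℝ, 0 ≤ l ∧ ∀ t, ∫⁻ u, timePow ρ u * ENNReal.ofReal (Real.exp (l * u)) *
      timePow ρ (t - u) ≤ κ * (ENNReal.ofReal (Real.exp (l * t)) * timePow ρ t) := by
  -- The divisor 4 pays for the factor 2 of the midpoint bound and for the two halves of the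
  -- interval.
  obtain ⟨l, hl, hl'⟩ := lintegral_timePow_exp_le h1 (κ := κ / 4)
    (ENNReal.div_pos hκ.ne' (by simp))
  refine ⟨l, hl, fun t => ?_⟩
  rcases le_or_gt t 0 with ht | ht
  · refine le_trans (le_of_eq ?_) (zero_le)
    rw [lintegral_eq_zero_iff (by
      have := measurable_timePow ρ
      fun_prop)]
    refine .of_forall fun u => ?_
    rcases le_or_gt u 0 with h | h
    · simp [timePow_of_nonpos h]
    · simp [timePow_of_nonpos (show t - u ≤ 0 by linarith)]
  set e : ℝ → ℝ≥0∞ := fun r => timePow ρ r * ENNReal.ofReal (Real.exp (-(l * r))) with he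
  have hem : Measurable e := by
    have := measurable_timePow ρ
    fun_prop
  have hpt : ∀ u, timePow ρ u * ENNReal.ofReal (Real.exp (l * u)) * timePow ρ (t - u)
      ≤ 2 * (ENNReal.ofReal (Real.exp (l * t)) * timePow ρ t) * (e u + e (t - u)) := by
    intro u
    rcases le_or_gt u 0 with h | h
    · simp [timePow_of_nonpos h]
    rcases le_or_gt (t - u) 0 with h' | h'
    · simp [timePow_of_nonpos h']
    have hx : ∀ a b : ℝ, ENNReal.ofReal (Real.exp a) * ENNReal.ofReal (Real.exp b)
        = ENNReal.ofReal (Real.exp (a + b)) := fun a b => by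
      rw [Real.exp_add, ENNReal.ofReal_mul (Real.exp_pos _).le]
    rcases le_or_gt (t / 2) u with hc | hc
    · calc _ ≤ (2 * timePow ρ t) * ENNReal.ofReal (Real.exp (l * u)) * timePow ρ (t - u) := by
            gcongr; exact timePow_le_two_mul h0 h1 ht hc
        _ = 2 * (ENNReal.ofReal (Real.exp (l * t)) * timePow ρ t) * e (t - u) := by
            have := hx (l * t) (-(l * (t - u)))
            rw [show l * t + -(l * (t - u)) = l * u by ring] at this
            rw [← this, he]; ring
        _ ≤ _ := by gcongr; exact le_add_self
    · calc _ ≤ timePow ρ u * ENNReal.ofReal (Real.exp (l * t - l * u)) * (2 * timePow ρ t) := by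
            gcongr
            · nlinarith
            · exact timePow_le_two_mul h0 h1 ht (by linarith)
        _ = 2 * (ENNReal.ofReal (Real.exp (l * t)) * timePow ρ t) * e u := by
            rw [sub_eq_add_neg, ← hx, he]; ring
        _ ≤ _ := by gcongr; exact le_self_add
  calc _ ≤ ∫⁻ u, 2 * (ENNReal.ofReal (Real.exp (l * t)) * timePow ρ t) * (e u + e (t - u)) :=
        lintegral_mono hpt
    _ = 2 * (ENNReal.ofReal (Real.exp (l * t)) * timePow ρ t) * ((∫⁻ u, e u) + ∫⁻ u, e u) := by
        rw [lintegral_const_mul _ (by fun_prop), lintegral_add_left hem,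
          lintegral_sub_left_eq_self]
    _ ≤ 2 * (ENNReal.ofReal (Real.exp (l * t)) * timePow ρ t) * (κ / 4 + κ / 4) := by gcongr
    _ = 2 * (κ / 4 + κ / 4) * (ENNReal.ofReal (Real.exp (l * t)) * timePow ρ t) := by ring
    _ = _ := by
        congr 1
        rw [← two_mul, ← mul_assoc, show (2:ℝ≥0∞) * 2 = 4 by norm_num,
          ENNReal.mul_div_cancel (by simp) (by simp)]

/-- Iterated time integrals of `t ^ (-ρ)` decay faster than any geometric sequence. -/
lemma lintegral_chainWeight_timePow_le {ρ : ℝ} (h0 : 0 ≤ ρ) (h1 : ρ < 1) {κ : ℝ≥0∞}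
    (hκ : 0 < κ) : ∃ l : ℝ, 0 ≤ l ∧ ∀ (n : ℕ) (t : ℝ),
      ∫⁻ s : Fin n → ℝ, chainWeight (fun a b => timePow ρ (b - a)) 0 s *
        timePow ρ (t - pathEnd 0 s)
      ≤ κ ^ n * (ENNReal.ofReal (Real.exp (l * t)) * timePow ρ t) := by
  obtain ⟨l, hl, hl'⟩ := timePow_convolution_le h0 h1 hκ
  refine ⟨l, hl, fun n => ?_⟩
  have hm := measurable_timePow ρ
  have hmL : Measurable fun q : ℝ × ℝ => timePow ρ (q.2 - q.1) := by fun_prop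
  have hmW : ∀ n, Measurable fun s : Fin n → ℝ => chainWeight (fun a b => timePow ρ (b - a)) 0 s :=
    fun n => (measurable_chainWeight (n := n) (ℓ := fun a b => timePow ρ (b - a)) hmL).comp
      (measurable_const.prodMk measurable_id)
  have hmE : ∀ n, Measurable fun s : Fin n → ℝ => pathEnd 0 s :=
    fun n => measurable_pathEnd.comp (measurable_const.prodMk measurable_id)
  induction n with
  | zero =>
    intro t
    rw [lintegral_fin_zero]
    simp only [chainWeight_zero, pathEnd_zero, sub_zero, one_mul, pow_zero]
    rcases le_or_gt t 0 with ht | ht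
    · simp [timePow_of_nonpos ht]
    · refine le_mul_of_one_le_left zero_le ?_
      rw [ENNReal.one_le_ofReal]
      exact Real.one_le_exp (by positivity)
  | succ n ih =>
    intro t
    rw [lintegral_snoc (by have := hmW (n+1); have := hmE (n+1); fun_prop)]
    simp_rw [chainWeight_snoc, pathEnd_snoc]
    calc _ ≤ ∫⁻ u, κ ^ n * (timePow ρ u * ENNReal.ofReal (Real.exp (l * u)) *
          timePow ρ (t - u)) := by
          refine lintegral_mono fun u => ?_
          simp only
          rw [lintegral_mul_const _ (by have := hmW n; have := hmE n; fun_prop)]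
          calc _ ≤ _ := mul_le_mul_left (ih u) _
            _ = _ := by ring
      _ ≤ κ ^ n * (κ * (ENNReal.ofReal (Real.exp (l * t)) * timePow ρ t)) := by
          rw [lintegral_const_mul _ (by fun_prop)]
          gcongr
          exact hl' t
      _ = _ := by ring

end

section

/-! ### A convergence theorem of Vitali type -/

section Vitali

variable {ι α : Type*} {l : Filter ι} [l.IsCountablyGenerated] [MeasurableSpace α] {μ : Measure α}

/-- Truncation at height N: where x ≥ N, the factor (x/N)^(z-1) is at least one. -/
lemma ENNReal_le_min_add_rpow_mul {z : ℝ} (hz : 1 < z) (x N : ℝ≥0∞) (hN : N ≠ 0) (hN' : N ≠ ∞) :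
    x ≤ min x N + x ^ z * (N ^ (z - 1))⁻¹ := by
  rcases le_total x N with h | h
  · rw [min_eq_left h]; exact le_self_add
  refine le_add_left ?_
  have h1 : N ^ (z - 1) ≠ 0 := by simp [hN, hN']
  have h2 : N ^ (z - 1) ≠ ∞ := ENNReal.rpow_ne_top_of_nonneg (by linarith) hN'
  rw [← div_eq_mul_inv, ENNReal.le_div_iff_mul_le (.inl h1) (.inl h2)]
  calc x * N ^ (z - 1) ≤ x * x ^ (z - 1) := by gcongr
    _ = x ^ z := by
      nth_rw 1 [← ENNReal.rpow_one x]
      rw [← ENNReal.rpow_add_of_nonneg _ _ zero_le_one (by linarith)]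
      ring_nf

/-- Three small pieces: the part outside S by tightness, the part truncated at N by dominated
convergence on a set of finite measure, and the part above N because it is at most M N^(1-z).
Boundedness in L^z with z > 1 replaces a dominating function. -/
lemma tendsto_lintegral_zero_of_tight_of_rpow_bounded {g : ι → α → ℝ≥0∞} {z : ℝ} (hz : 1 < z)
    (hg : ∀ᶠ i in l, Measurable (g i))
    (hlim : ∀ᵐ a ∂μ, Tendsto (fun i => g i a) l (𝓝 0))
    (hUI : ∀ ε : ℝ≥0∞, ε ≠ 0 → ∃ S, MeasurableSet S ∧ μ S ≠ ∞ ∧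
      (∀ᶠ i in l, ∫⁻ a in Sᶜ, g i a ∂μ ≤ ε) ∧
      ∃ M : ℝ≥0∞, M ≠ ∞ ∧ ∀ᶠ i in l, ∫⁻ a in S, g i a ^ z ∂μ ≤ M) :
    Tendsto (fun i => ∫⁻ a, g i a ∂μ) l (𝓝 0) := by
  rw [ENNReal.tendsto_nhds_zero]
  intro ε hε
  have hε3 : ε / 3 ≠ 0 := (ENNReal.div_pos hε.ne' (by simp)).ne'
  obtain ⟨S, hS, hμS, htail, M, hM, hpow⟩ := hUI (ε / 3) hε3
  -- The height N will satisfy N^(z-1) = c > 3M/ε, so that the part above N contributes at most ε/3.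
  obtain ⟨c, hc⟩ := ENNReal.exists_nat_gt (ENNReal.div_ne_top hM hε3)
  have hc0 : (c : ℝ≥0∞) ≠ 0 := (zero_le.trans_lt hc).ne'
  have hct : (c : ℝ≥0∞) ≠ ∞ := ENNReal.natCast_ne_top c
  set N : ℝ≥0∞ := (c : ℝ≥0∞) ^ (1 / (z - 1)) with hN
  have hz1 : 0 < z - 1 := by linarith
  have hN0 : N ≠ 0 := by simp [hN, hc0, hct]
  have hNt : N ≠ ∞ := ENNReal.rpow_ne_top_of_nonneg (by positivity) hct
  have hNc : N ^ (z - 1) = c := by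
    rw [hN, ← ENNReal.rpow_mul, one_div_mul_cancel hz1.ne', ENNReal.rpow_one]
  have hmin : Tendsto (fun i => ∫⁻ a in S, min (g i a) N ∂μ) l (𝓝 0) := by
    have := tendsto_lintegral_filter_of_dominated_convergence (μ := μ.restrict S) (l := l)
      (F := fun i a => min (g i a) N) (f := fun _ => 0) (fun _ => N)
      (by filter_upwards [hg] with i hi using hi.min measurable_const)
      (.of_forall fun i => .of_forall fun a => min_le_right _ _)
      (by simp [lintegral_const, ENNReal.mul_eq_top, hNt, hμS])
      (by
        refine ae_restrict_of_ae ?_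
        filter_upwards [hlim] with a ha
        simpa using ha.min (tendsto_const_nhds (x := N)))
    simpa using this
  have hev := (ENNReal.tendsto_nhds_zero.1 hmin) (ε / 3) (pos_iff_ne_zero.2 hε3)
  filter_upwards [hg, htail, hpow, hev] with i h1 h2 h3 h4
  have hM3 : M * (c : ℝ≥0∞)⁻¹ ≤ ε / 3 := by
    rw [← div_eq_mul_inv, ENNReal.div_le_iff hc0 hct]
    have := (ENNReal.div_le_iff_le_mul (.inl hε3) (.inr hc0)).1 hc.le
    rwa [mul_comm]
  calc ∫⁻ a, g i a ∂μ = ∫⁻ a in S, g i a ∂μ + ∫⁻ a in Sᶜ, g i a ∂μ :=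
        (lintegral_add_compl _ hS).symm
    _ ≤ (∫⁻ a in S, (min (g i a) N + g i a ^ z * (N ^ (z - 1))⁻¹) ∂μ) + ε / 3 := by
        gcongr
        exact ENNReal_le_min_add_rpow_mul hz _ _ hN0 hNt
    _ = (∫⁻ a in S, min (g i a) N ∂μ) + (∫⁻ a in S, g i a ^ z ∂μ) * (c : ℝ≥0∞)⁻¹ + ε / 3 := by
        rw [lintegral_add_left (h1.min measurable_const),
          lintegral_mul_const _ (h1.pow_const z), hNc]
    _ ≤ ε / 3 + M * (c : ℝ≥0∞)⁻¹ + ε / 3 := by gcongr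
    _ ≤ ε / 3 + ε / 3 + ε / 3 := by gcongr
    _ = ε := ENNReal.add_thirds ε

/-- The differences f i - f₀ tend to zero in L¹: their tails add up, and (a+b)^z ≤ 2^(z-1)(a^z +
b^z) bounds their z-th powers. -/
lemma tendsto_integral_of_tight_of_rpow_bounded {F : Type*} [NormedAddCommGroup F]
    [NormedSpace ℝ F] [MeasurableSpace F] [BorelSpace F] [SecondCountableTopology F]
    {f : ι → α → F} {f₀ : α → F} {z : ℝ} (hz : 1 < z)
    (hf : ∀ᶠ i in l, Integrable (f i) μ) (hfm : ∀ᶠ i in l, Measurable (f i))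
    (hf₀ : Integrable f₀ μ) (hfm₀ : Measurable f₀)
    (hlim : ∀ᵐ a ∂μ, Tendsto (fun i => f i a) l (𝓝 (f₀ a)))
    (hUI : ∀ ε : ℝ≥0∞, ε ≠ 0 → ∃ S, MeasurableSet S ∧ μ S ≠ ∞ ∧
      (∀ᶠ i in l, ∫⁻ a in Sᶜ, ‖f i a‖ₑ ∂μ ≤ ε) ∧ ∫⁻ a in Sᶜ, ‖f₀ a‖ₑ ∂μ ≤ ε ∧
      ∃ M : ℝ≥0∞, M ≠ ∞ ∧ (∀ᶠ i in l, ∫⁻ a in S, ‖f i a‖ₑ ^ z ∂μ ≤ M) ∧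
        ∫⁻ a in S, ‖f₀ a‖ₑ ^ z ∂μ ≤ M) :
    Tendsto (fun i => ∫ a, f i a ∂μ) l (𝓝 (∫ a, f₀ a ∂μ)) := by
  refine tendsto_integral_of_L1 f₀ hf₀.aestronglyMeasurable hf ?_
  refine tendsto_lintegral_zero_of_tight_of_rpow_bounded hz ?_ ?_ ?_
  · filter_upwards [hfm] with i hi using (hi.sub hfm₀).enorm
  · filter_upwards [hlim] with a ha
    have : Tendsto (fun i => f i a - f₀ a) l (𝓝 0) := by simpa using ha.sub_const (f₀ a)
    simpa using this.enorm
  · intro ε hε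
    obtain ⟨S, hS, hμS, h1, h2, M, hM, h3, h4⟩ := hUI (ε / 2) (ENNReal.half_pos hε).ne'
    refine ⟨S, hS, hμS, ?_, 2 ^ (z - 1) * (M + M), ?_, ?_⟩
    · filter_upwards [hfm, h1] with i hi h1
      calc _ ≤ ∫⁻ a in Sᶜ, (‖f i a‖ₑ + ‖f₀ a‖ₑ) ∂μ := lintegral_mono fun a => enorm_sub_le
        _ = (∫⁻ a in Sᶜ, ‖f i a‖ₑ ∂μ) + ∫⁻ a in Sᶜ, ‖f₀ a‖ₑ ∂μ := lintegral_add_left hi.enorm _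
        _ ≤ ε / 2 + ε / 2 := by gcongr
        _ = ε := ENNReal.add_halves ε
    · exact ENNReal.mul_ne_top (ENNReal.rpow_ne_top_of_nonneg (by linarith) (by simp))
        (ENNReal.add_ne_top.2 ⟨hM, hM⟩)
    · filter_upwards [hfm, h3] with i hi h3
      calc _ ≤ ∫⁻ a in S, 2 ^ (z - 1) * (‖f i a‖ₑ ^ z + ‖f₀ a‖ₑ ^ z) ∂μ := by
            refine lintegral_mono fun a => ?_
            refine (ENNReal.rpow_le_rpow enorm_sub_le (by linarith)).trans ?_
            exact ENNReal.rpow_add_le_mul_rpow_add_rpow _ _ hz.le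
        _ = 2 ^ (z - 1) * ((∫⁻ a in S, ‖f i a‖ₑ ^ z ∂μ) + ∫⁻ a in S, ‖f₀ a‖ₑ ^ z ∂μ) := by
            rw [lintegral_const_mul _ (by have := hi.enorm; have := hfm₀.enorm; fun_prop),
              lintegral_add_left (hi.enorm.pow_const z)]
        _ ≤ _ := by gcongr

end Vitali

end

section

/-! ### Chains in time and space -/

section Gaps

variable {n : ℕ}

/-- The successive gaps of the times `0, s 0, …, s (n-1), t`. -/
def gaps (s : Fin n → ℝ) (t : ℝ) (i : Fin (n + 1)) : ℝ :=
  (Fin.snoc s t : Fin (n + 1) → ℝ) i - path 0 s i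

lemma gaps_castSucc (s : Fin n → ℝ) (t : ℝ) (i : Fin n) :
    gaps s t i.castSucc = path 0 s i.succ - path 0 s i.castSucc := by
  simp [gaps, path_succ]

lemma gaps_last (s : Fin n → ℝ) (t : ℝ) : gaps s t (Fin.last n) = t - pathEnd 0 s := by
  simp [gaps, pathEnd]

lemma sum_gaps (s : Fin n → ℝ) (t : ℝ) : ∑ i, gaps s t i = t := by
  simp only [gaps, Finset.sum_sub_distrib]
  rw [Fin.sum_univ_castSucc, Fin.sum_univ_succ (f := path 0 s)]
  simp [path]

end Gaps

variable {d : ℕ} {F : Type*} [NormedAddCommGroup F] [NormedSpace ℝ F]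

/-- A time-dependent kernel as a function of two points in time and space. -/
def link {R : Type*} (a : ℝ → Sp d → Sp d → R) (u v : ℝ × Sp d) : R := a (v.1 - u.1) u.2 v.2

/-- The integrand of the chain expansion: `a` along a chain of points in time and space started
at `(0, x)`, times `G` along the last link, which ends at `(t, y)`. -/
def chainTerm (a : ℝ → Sp d → Sp d → ℝ) (G : ℝ → Sp d → Sp d → F) (n : ℕ) (t : ℝ) (x y : Sp d)
    (v : Fin n → ℝ × Sp d) : F :=
  chainWeight (link a) (0, x) v •
    G (t - (pathEnd (0, x) v).1) (pathEnd (0, x) v).2 y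

/-- Translation between the hypotheses, which are stated for time steps, and the chain terms, which
are stated for times. -/
lemma chainProd_gaps {n : ℕ} (γ G : ℝ → Sp d → Sp d → ℝ≥0∞) (s : Fin n → ℝ) (t : ℝ) (x : Sp d)
    (z : Fin n → Sp d) (y : Sp d) :
    chainProd γ G (gaps s t) x z y
      = chainWeight (link γ) (0, x) (fun i => (s i, z i)) *
        G (t - (pathEnd (0, x) fun i => (s i, z i)).1)
          (pathEnd (0, x) fun i => (s i, z i)).2 y := by
  have h1 : ∀ i, path 0 s i = (path (0, x) (fun j => (s j, z j)) i).1 := fun i => by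
    rw [← path_map Prod.fst]
  have h2 : ∀ i, path x z i = (path (0, x) (fun j => (s j, z j)) i).2 := fun i => by
    rw [← path_map Prod.snd]
  unfold chainProd
  simp only [gaps_castSucc, gaps_last]
  unfold chainWeight link pathEnd
  simp only [← h1, ← h2]
  rfl

lemma chainProd_rpow {n : ℕ} (γ G : ℝ → Sp d → Sp d → ℝ≥0∞) {p : ℝ} (hp : 0 ≤ p)
    (δ : Fin (n + 1) → ℝ) (x : Sp d) (z : Fin n → Sp d) (y : Sp d) :
    chainProd γ G δ x z y ^ p
      = chainProd (fun t a b => γ t a b ^ p) (fun t a b => G t a b ^ p) δ x z y := by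
  unfold chainProd
  simp only
  rw [ENNReal.mul_rpow_of_nonneg _ _ hp, ENNReal.prod_rpow_of_nonneg hp]

lemma enorm_chainTerm_rpow (a : ℝ → Sp d → Sp d → ℝ) (G : ℝ → Sp d → Sp d → F) {n : ℕ} (t : ℝ)
    {p : ℝ} (hp : 0 ≤ p) (x y : Sp d) (s : Fin n → ℝ) (z : Fin n → Sp d) :
    ‖chainTerm a G n t x y fun i => (s i, z i)‖ₑ ^ p
      = chainProd (fun t x y => ‖a t x y‖ₑ ^ p) (fun t x y => ‖G t x y‖ₑ ^ p) (gaps s t) x z y := by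
  rw [← chainProd_rpow _ _ hp, chainProd_gaps]
  unfold chainTerm
  rw [enorm_smul, chainWeight_enorm]
  rfl

/-- The singular time factors do not depend on the positions and so leave the spatial integral. -/
lemma chainProd_mul_left_timePow {n : ℕ} (γ G : ℝ → Sp d → Sp d → ℝ≥0∞) (A : ℝ≥0∞) (ρ : ℝ)
    (s : Fin n → ℝ) (t : ℝ) (x : Sp d) (z : Fin n → Sp d) (y : Sp d) :
    chainProd (fun t x y => A * timePow ρ t * γ t x y) G (gaps s t) x z y
      = A ^ n * chainWeight (fun a b => timePow ρ (b - a)) 0 s *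
        chainProd γ G (gaps s t) x z y := by
  rw [chainProd_gaps, chainProd_gaps, ← mul_assoc]
  congr 1
  have : link (fun t (x y : Sp d) => A * timePow ρ t * γ t x y)
      = fun u v : ℝ × Sp d => A * (timePow ρ (v.1 - u.1) * link γ u v) := by
    funext u v; simp [link, mul_assoc]
  rw [this, chainWeight_const_mul, chainWeight_mul,
    chainWeight_comp Prod.fst (fun a b => timePow ρ (b - a)), ← mul_assoc]

lemma chainProd_mono {n : ℕ} {γ γ' G : ℝ → Sp d → Sp d → ℝ≥0∞} (h : ∀ t x y, γ t x y ≤ γ' t x y)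
    (δ : Fin (n + 1) → ℝ) (x : Sp d) (z : Fin n → Sp d) (y : Sp d) :
    chainProd γ G δ x z y ≤ chainProd γ' G δ x z y := by
  unfold chainProd
  simp only
  gcongr
  exact h _ _ _

section Measurability

variable [MeasurableSpace F] [BorelSpace F] [SecondCountableTopology F]

lemma measurable_link {R : Type*} [MeasurableSpace R] {a : ℝ → Sp d → Sp d → R}
    (ha : Measurable fun q : ℝ × Sp d × Sp d => a q.1 q.2.1 q.2.2) :
    Measurable fun q : (ℝ × Sp d) × (ℝ × Sp d) => link a q.1 q.2 :=
  ha.comp (f := fun q : (ℝ × Sp d) × (ℝ × Sp d) => (q.2.1 - q.1.1, q.1.2, q.2.2)) (by fun_prop)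

lemma measurable_chainTerm {a : ℝ → Sp d → Sp d → ℝ} {G : ℝ → Sp d → Sp d → F}
    (ha : Measurable fun q : ℝ × Sp d × Sp d => a q.1 q.2.1 q.2.2)
    (hG : Measurable fun q : ℝ × Sp d × Sp d => G q.1 q.2.1 q.2.2) (n : ℕ) :
    Measurable fun q : (ℝ × Sp d × Sp d) × (Fin n → ℝ × Sp d) =>
      chainTerm a G n q.1.1 q.1.2.1 q.1.2.2 q.2 := by
  have h0 : Measurable fun q : (ℝ × Sp d × Sp d) × (Fin n → ℝ × Sp d) =>
      (((0 : ℝ), q.1.2.1), q.2) := by fun_prop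
  have hE := measurable_pathEnd.comp h0
  have hW := (measurable_chainWeight (n := n) (measurable_link ha)).comp h0
  refine Measurable.smul hW ?_
  exact hG.comp (f := fun q : (ℝ × Sp d × Sp d) × (Fin n → ℝ × Sp d) =>
    (q.1.1 - (pathEnd ((0 : ℝ), q.1.2.1) q.2).1, (pathEnd ((0 : ℝ), q.1.2.1) q.2).2, q.1.2.2))
    ((measurable_fst.fst.sub hE.fst).prodMk (hE.snd.prodMk measurable_fst.snd.snd))

lemma measurable_chainTerm_apply {a : ℝ → Sp d → Sp d → ℝ} {G : ℝ → Sp d → Sp d → F}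
    (ha : Measurable fun q : ℝ × Sp d × Sp d => a q.1 q.2.1 q.2.2)
    (hG : Measurable fun q : ℝ × Sp d × Sp d => G q.1 q.2.1 q.2.2) (n : ℕ) (t : ℝ) (x y : Sp d) :
    Measurable (chainTerm a G n t x y) :=
  (measurable_chainTerm ha hG n).comp (f := fun v : Fin n → ℝ × Sp d => ((t, x, y), v))
    (by fun_prop)

/-- Extension by zero to nonpositive times makes chains vanish unless their times increase. Time
integrals may therefore run over all of ℝ, with no explicit simplex. -/
lemma chainProd_eq_zero_of_gap {n : ℕ} {γ G : ℝ → Sp d → Sp d → ℝ≥0∞}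
    (hγ : ∀ t ≤ 0, ∀ x y, γ t x y = 0) (hG : ∀ t ≤ 0, ∀ x y, G t x y = 0)
    {δ : Fin (n + 1) → ℝ} (h : ¬ ∀ i, 0 < δ i) (x : Sp d) (z : Fin n → Sp d) (y : Sp d) :
    chainProd γ G δ x z y = 0 := by
  push Not at h
  obtain ⟨i, hi⟩ := h
  unfold chainProd
  simp only
  revert hi
  refine Fin.lastCases (fun hi => ?_) (fun j hi => ?_) i
  · rw [hG _ hi, mul_zero]
  · rw [Finset.prod_eq_zero (Finset.mem_univ j) (hγ _ hi _ _), zero_mul]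

/-- A bound on the spatial integrals of chains at fixed times gives a bound on the integral over
times and positions. -/
lemma lintegral_enorm_chainTerm_rpow_le {a : ℝ → Sp d → Sp d → ℝ} {G : ℝ → Sp d → Sp d → F}
    (ha : Measurable fun q : ℝ × Sp d × Sp d => a q.1 q.2.1 q.2.2)
    (hG : Measurable fun q : ℝ × Sp d × Sp d => G q.1 q.2.1 q.2.2)
    (hG0 : ∀ t ≤ 0, ∀ x y, G t x y = 0)
    {γ : ℝ → Sp d → Sp d → ℝ≥0∞} {p ρ : ℝ} (hp : 0 < p) {A κ : ℝ≥0∞} {l : ℝ} (hA : A ≠ ∞)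
    (hab : ∀ t x y, ‖a t x y‖ₑ ^ p ≤ A * timePow ρ t * γ t x y)
    {n : ℕ} {t : ℝ} {x y : Sp d} {Y : Set (Fin n → Sp d)} (hY : MeasurableSet Y) {B : ℝ≥0∞}
    (hB : ∀ δ : Fin (n + 1) → ℝ, (∀ i, 0 < δ i) → ∑ i, δ i = t →
      ∫⁻ z in Y, chainProd γ (fun t x y => ‖G t x y‖ₑ ^ p) δ x z y
        ≤ B * timePow ρ (δ (Fin.last n)))
    (hl : ∫⁻ s : Fin n → ℝ, chainWeight (fun a b => timePow ρ (b - a)) 0 s *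
        timePow ρ (t - pathEnd 0 s) ≤ κ ^ n * (ENNReal.ofReal (Real.exp (l * t)) * timePow ρ t)) :
    ∫⁻ v in {v : Fin n → ℝ × Sp d | (fun i => (v i).2) ∈ Y}, ‖chainTerm a G n t x y v‖ₑ ^ p
      ≤ B * (A * κ) ^ n * (ENNReal.ofReal (Real.exp (l * t)) * timePow ρ t) := by
  have hYm : MeasurableSet {v : Fin n → ℝ × Sp d | (fun i => (v i).2) ∈ Y} :=
    hY.preimage (f := fun (v : Fin n → ℝ × Sp d) i => (v i).2) (by fun_prop)
  have hm := (measurable_chainTerm_apply ha hG n t x y).enorm.pow_const p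
  rw [← lintegral_indicator hYm, lintegral_fin_prod (hm.indicator hYm)]
  have hw : ∀ s : Fin n → ℝ, chainWeight (fun a b => timePow ρ (b - a)) 0 s ≠ ∞ := fun s =>
    ENNReal.prod_ne_top fun i _ => timePow_ne_top _ _
  have key : ∀ s : Fin n → ℝ,
      ∫⁻ z : Fin n → Sp d, {v : Fin n → ℝ × Sp d | (fun i => (v i).2) ∈ Y}.indicator
        (fun v => ‖chainTerm a G n t x y v‖ₑ ^ p) (fun i => (s i, z i))
      ≤ (A ^ n * B) * (chainWeight (fun a b => timePow ρ (b - a)) 0 s *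
          timePow ρ (t - pathEnd 0 s)) := by
    intro s
    have e1 : ∫⁻ z : Fin n → Sp d, {v : Fin n → ℝ × Sp d | (fun i => (v i).2) ∈ Y}.indicator
        (fun v => ‖chainTerm a G n t x y v‖ₑ ^ p) (fun i => (s i, z i))
        = ∫⁻ z in Y, ‖chainTerm a G n t x y fun i => (s i, z i)‖ₑ ^ p := by
      rw [← lintegral_indicator hY]
      rfl
    rw [e1]
    simp_rw [enorm_chainTerm_rpow a G t hp.le]
    by_cases hpos : ∀ i, 0 < gaps s t i
    · calc _ ≤ ∫⁻ z in Y, (A ^ n * chainWeight (fun a b => timePow ρ (b - a)) 0 s) *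
            chainProd γ (fun t x y => ‖G t x y‖ₑ ^ p) (gaps s t) x z y := by
            refine lintegral_mono fun z => ?_
            rw [← chainProd_mul_left_timePow]
            exact chainProd_mono hab _ _ _ _
        _ = (A ^ n * chainWeight (fun a b => timePow ρ (b - a)) 0 s) *
            ∫⁻ z in Y, chainProd γ (fun t x y => ‖G t x y‖ₑ ^ p) (gaps s t) x z y :=
            lintegral_const_mul' _ _ (ENNReal.mul_ne_top (ENNReal.pow_ne_top hA) (hw s))
        _ ≤ (A ^ n * chainWeight (fun a b => timePow ρ (b - a)) 0 s) *
            (B * timePow ρ (gaps s t (Fin.last n))) := by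
            gcongr
            exact hB _ hpos (sum_gaps s t)
        _ = _ := by rw [gaps_last]; ring
    · have : ∀ z, chainProd (fun t x y => ‖a t x y‖ₑ ^ p) (fun t x y => ‖G t x y‖ₑ ^ p)
          (gaps s t) x z y = 0 := fun z =>
        chainProd_eq_zero_of_gap
          (fun t ht x y => le_antisymm ((hab t x y).trans (by simp [timePow_of_nonpos ht]))
            zero_le)
          (fun t ht x y => by simp [hG0 t ht, hp]) hpos _ _ _
      simp [this]
  calc _ ≤ ∫⁻ s : Fin n → ℝ, (A ^ n * B) * (chainWeight (fun a b => timePow ρ (b - a)) 0 s *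
          timePow ρ (t - pathEnd 0 s)) := lintegral_mono key
    _ = (A ^ n * B) * ∫⁻ s : Fin n → ℝ, chainWeight (fun a b => timePow ρ (b - a)) 0 s *
          timePow ρ (t - pathEnd 0 s) := by
        refine lintegral_const_mul _ ?_
        have h1 := measurable_timePow ρ
        have h2 : Measurable fun q : ℝ × ℝ => timePow ρ (q.2 - q.1) := by fun_prop
        refine ((measurable_chainWeight (n := n) (ℓ := fun a b => timePow ρ (b - a)) h2).comp
          (measurable_const.prodMk measurable_id)).mul (h1.comp (measurable_const.sub ?_))
        exact measurable_pathEnd.comp (measurable_const.prodMk measurable_id)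
    _ ≤ (A ^ n * B) * (κ ^ n * (ENNReal.ofReal (Real.exp (l * t)) * timePow ρ t)) := by gcongr
    _ = _ := by ring

end Measurability

end

section

/-! ### Consequences of uniform integrability -/

variable {d : ℕ} {F : Type*} [NormedAddCommGroup F]

/-- Restriction of a time-dependent kernel to times in `(0, T]`. -/
def trunc (T : ℝ) (f : ℝ → Sp d → Sp d → F) (t : ℝ) (x y : Sp d) : F :=
  open Classical in if t ∈ Set.Ioc 0 T then f t x y else 0

lemma trunc_of_mem {T t : ℝ} (h : t ∈ Set.Ioc 0 T) (f : ℝ → Sp d → Sp d → F) (x y : Sp d) :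
    trunc T f t x y = f t x y := if_pos h

lemma trunc_of_notMem {T t : ℝ} (h : t ∉ Set.Ioc 0 T) (f : ℝ → Sp d → Sp d → F) (x y : Sp d) :
    trunc T f t x y = 0 := if_neg h

lemma trunc_of_nonpos {T t : ℝ} (h : t ≤ 0) (f : ℝ → Sp d → Sp d → F) (x y : Sp d) :
    trunc T f t x y = 0 := trunc_of_notMem (fun h' => h.not_gt h'.1) _ _ _

lemma enorm_trunc_le (T t : ℝ) (f : ℝ → Sp d → Sp d → F) (x y : Sp d) :
    ‖trunc T f t x y‖ₑ ≤ ‖f t x y‖ₑ := by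
  unfold trunc; split_ifs <;> simp

/-- The bounds on the chain expansion that uniform integrability provides. -/
structure ChainBounds [NormedSpace ℝ F] (T r ζ : ℝ) (Ξ : ℝ → ℝ≥0∞) (a : ℝ → Sp d → Sp d → ℝ)
    (G : ℝ → Sp d → Sp d → F) : Prop where
  total : ∀ x₀ y₀ : Sp d, ∃ M : ℝ≥0∞, M ≠ ∞ ∧ ∀ n : ℕ, 1 ≤ n → ∀ t ∈ Set.Ioc 0 T,
    ∀ x ∈ Metric.ball x₀ r, ∀ y ∈ Metric.ball y₀ r,
      ∫⁻ v, ‖chainTerm a G n t x y v‖ₑ ≤ M * 2⁻¹ ^ n * Ξ t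
  inner : ∀ (x₀ y₀ : Sp d) (R : ℝ), 0 < R → ∃ M : ℝ≥0∞, M ≠ ∞ ∧ ∀ n : ℕ, 1 ≤ n →
    ∀ t ∈ Set.Ioc 0 T, ∀ x ∈ Metric.ball x₀ r, ∀ y ∈ Metric.ball y₀ r,
      ∫⁻ v in {v : Fin n → ℝ × Sp d | (fun i => (v i).2) ∈ {z : Fin n → Sp d | ∑ i, ‖z i‖ ≤ R}},
        ‖chainTerm a G n t x y v‖ₑ ^ ζ ≤ M * 2⁻¹ ^ n * Ξ t
  outer : ∀ (x₀ y₀ : Sp d) (ε : ℝ≥0∞), ε ≠ 0 → ∃ R > (0 : ℝ), ∀ n : ℕ, 1 ≤ n →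
    ∀ t ∈ Set.Ioc 0 T, ∀ x ∈ Metric.ball x₀ r, ∀ y ∈ Metric.ball y₀ r,
      ∫⁻ v in {v : Fin n → ℝ × Sp d | (fun i => (v i).2) ∈ {z : Fin n → Sp d | R < ∑ i, ‖z i‖}},
        ‖chainTerm a G n t x y v‖ₑ ≤ ε * Ξ t

lemma ENNReal_le_one_add_rpow {z : ℝ} (hz : 1 ≤ z) (x : ℝ≥0∞) : x ≤ 1 + x ^ z := by
  rcases le_total x 1 with h | h
  · exact h.trans le_self_add
  · refine le_add_left ?_
    nth_rw 1 [← ENNReal.rpow_one x]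
    exact ENNReal.rpow_le_rpow_of_exponent_le h hz

/-- Taking p-th powers turns the exponent ρ into pρ, which is then raised to a common exponent ρ'
still below 1, so that the time integrals converge. -/
lemma enorm_rpow_le_timePow {T ρ ρ' p : ℝ} (h0 : 0 ≤ ρ) (hp : 0 < p) (hρ : p * ρ ≤ ρ')
    (hρ' : ρ' < 1) {a : ℝ → Sp d → Sp d → ℝ} {γ : ℝ → Sp d → Sp d → ℝ≥0} {A : ℝ≥0∞}
    (hab : ∀ t x y, ‖a t x y‖ₑ ≤ A * timePow ρ t * γ t x y)
    (ha0 : ∀ t, t ∉ Set.Ioc 0 T → ∀ x y, a t x y = 0) (t : ℝ) (x y : Sp d) :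
    ‖a t x y‖ₑ ^ p ≤ (A ^ p * ENNReal.ofReal (1 + T)) * timePow ρ' t * (γ t x y : ℝ≥0∞) ^ p := by
  by_cases ht : t ∈ Set.Ioc 0 T
  · calc _ ≤ (A * timePow ρ t * γ t x y) ^ p := ENNReal.rpow_le_rpow (hab _ _ _) hp.le
      _ = A ^ p * timePow (p * ρ) t * (γ t x y : ℝ≥0∞) ^ p := by
          rw [ENNReal.mul_rpow_of_nonneg _ _ hp.le, ENNReal.mul_rpow_of_nonneg _ _ hp.le,
            timePow_rpow hp]
      _ ≤ A ^ p * (ENNReal.ofReal (1 + T) * timePow ρ' t) * (γ t x y : ℝ≥0∞) ^ p := by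
          gcongr
          exact timePow_le_timePow (by positivity) hρ hρ' ht.2
      _ = _ := by ring
  · simp [ha0 t ht, hp]

/-! ### Geometric decay of the chain terms. -/

section

variable [NormedSpace ℝ F] [MeasurableSpace F] [BorelSpace F] [SecondCountableTopology F]

/-- The factors C^n of the fixed-time bound and A^n of the kernel are beaten by the time integrals,
whose factor κ^n is available for every κ > 0. The constant M does not depend on n, the end points,
Y or B. -/
lemma exists_chainTerm_bound {T : ℝ} {a : ℝ → Sp d → Sp d → ℝ} {G : ℝ → Sp d → Sp d → F}
    (ha : Measurable fun q : ℝ × Sp d × Sp d => a q.1 q.2.1 q.2.2)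
    (hG : Measurable fun q : ℝ × Sp d × Sp d => G q.1 q.2.1 q.2.2)
    (hG0 : ∀ t ≤ 0, ∀ x y, G t x y = 0)
    {γ : ℝ → Sp d → Sp d → ℝ≥0∞} {p ρ : ℝ} (hp : 0 < p) (h0 : 0 ≤ ρ) (h1 : ρ < 1)
    {A C : ℝ≥0∞} (hA : A ≠ ∞) (hC : C ≠ ∞)
    (hab : ∀ t x y, ‖a t x y‖ₑ ^ p ≤ A * timePow ρ t * γ t x y) :
    ∃ M : ℝ≥0∞, M ≠ ∞ ∧ ∀ (n : ℕ) (t : ℝ), t ≤ T → ∀ (x y : Sp d) (Y : Set (Fin n → Sp d)),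
      MeasurableSet Y → ∀ B : ℝ≥0∞,
      (∀ δ : Fin (n + 1) → ℝ, (∀ i, 0 < δ i) → ∑ i, δ i = t →
        ∫⁻ z in Y, chainProd γ (fun t x y => ‖G t x y‖ₑ ^ p) δ x z y
          ≤ C ^ (n + 1) * B * timePow ρ (δ (Fin.last n))) →
      ∫⁻ v in {v : Fin n → ℝ × Sp d | (fun i => (v i).2) ∈ Y}, ‖chainTerm a G n t x y v‖ₑ ^ p
        ≤ M * 2⁻¹ ^ n * (B * timePow ρ t) := by
  -- Chosen so that C * A * κ ≤ 1/2; the added ones keep κ finite even if C or A is zero.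
  set κ : ℝ≥0∞ := (2 * (C + 1) * (A + 1))⁻¹ with hκ
  have hfin : 2 * (C + 1) * (A + 1) ≠ ∞ :=
    ENNReal.mul_ne_top (ENNReal.mul_ne_top (by simp) (by simp [hC])) (by simp [hA])
  have hκ0 : 0 < κ := by rw [hκ, ENNReal.inv_pos]; exact hfin
  have hκ2 : C * (A * κ) ≤ 2⁻¹ := by
    have hne : 2 * (C + 1) * (A + 1) ≠ 0 := by simp
    rw [hκ, ← mul_assoc, ← div_eq_mul_inv, ENNReal.div_le_iff hne hfin, mul_assoc, ← mul_assoc,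
      ENNReal.inv_mul_cancel (by simp) (by simp), one_mul]
    gcongr <;> exact le_self_add
  obtain ⟨l, hl, hl'⟩ := lintegral_chainWeight_timePow_le h0 h1 hκ0
  refine ⟨C * ENNReal.ofReal (Real.exp (l * T)), ENNReal.mul_ne_top hC (by simp),
    fun n t ht x y Y hY B hB => ?_⟩
  refine (lintegral_enorm_chainTerm_rpow_le ha hG hG0 hp hA hab hY hB (hl' n t)).trans ?_
  calc C ^ (n + 1) * B * (A * κ) ^ n * (ENNReal.ofReal (Real.exp (l * t)) * timePow ρ t)
      = C * ENNReal.ofReal (Real.exp (l * t)) * (C * (A * κ)) ^ n * (B * timePow ρ t) := by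
        rw [mul_pow C]; ring
    _ ≤ _ := by gcongr

lemma measurableSet_sum_norm_le (n : ℕ) (R : ℝ) :
    MeasurableSet {z : Fin n → Sp d | ∑ i, ‖z i‖ ≤ R} :=
  measurableSet_le (by fun_prop) measurable_const

lemma measurableSet_lt_sum_norm (n : ℕ) (R : ℝ) :
    MeasurableSet {z : Fin n → Sp d | R < ∑ i, ‖z i‖} :=
  measurableSet_lt measurable_const (by fun_prop)

lemma volume_sum_norm_le (n : ℕ) (R : ℝ) :
    volume {z : Fin n → Sp d | ∑ i, ‖z i‖ ≤ R}
      ≤ volume (Metric.closedBall (0 : Sp d) R) ^ n := by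
  calc _ ≤ volume (Set.univ.pi fun _ : Fin n => Metric.closedBall (0 : Sp d) R) := by
        refine measure_mono fun z hz => ?_
        simp only [Set.mem_univ_pi, mem_closedBall_zero_iff]
        exact fun i => (Finset.single_le_sum (f := fun i => ‖z i‖) (fun _ _ => norm_nonneg _)
          (Finset.mem_univ i)).trans hz
    _ = _ := by rw [volume_pi_pi]; simp

lemma chainProd_mono_right {n : ℕ} {γ G G' : ℝ → Sp d → Sp d → ℝ≥0∞}
    (h : ∀ t x y, G t x y ≤ G' t x y)
    (δ : Fin (n + 1) → ℝ) (x : Sp d) (z : Fin n → Sp d) (y : Sp d) :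
    chainProd γ G δ x z y ≤ chainProd γ G' δ x z y := by
  unfold chainProd
  simp only
  gcongr
  exact h _ _ _

/-- Uniform integrability of `(γ, G)` bounds the chain expansion of any kernel dominated by
`t ^ (-ρ) γ`. -/
theorem UniformIntegrability.exists_chainBounds {T : ℝ} {γ : ℝ → Sp d → Sp d → ℝ≥0} {ρ : ℝ}
    {G : ℝ → Sp d → Sp d → F} (hUI : UniformIntegrability T γ ρ G) (h0 : 0 ≤ ρ)
    (hG : Measurable fun q : ℝ × Sp d × Sp d => trunc T G q.1 q.2.1 q.2.2)
    {a : ℝ → Sp d → Sp d → ℝ}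
    (ha : Measurable fun q : ℝ × Sp d × Sp d => a q.1 q.2.1 q.2.2)
    {A : ℝ≥0∞} (hA : A ≠ ∞) (hab : ∀ t x y, ‖a t x y‖ₑ ≤ A * timePow ρ t * γ t x y)
    (ha0 : ∀ t, t ∉ Set.Ioc 0 T → ∀ x y, a t x y = 0) :
    ∃ r > (0 : ℝ), ∃ ζ > (1 : ℝ), ∃ Ξ : ℝ → ℝ≥0∞,
      (∀ t₀ > (0 : ℝ), ∃ M : ℝ≥0∞, M ≠ ∞ ∧ ∀ t ∈ Set.Icc t₀ T, Ξ t ≤ M) ∧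
      ChainBounds T r ζ Ξ a (trunc T G) := by
  obtain ⟨r, hr, ζ, hζ, hζρ, η, hη0, hη1, ξ, hξ, hin, hout⟩ := hUI
  -- A single exponent below 1 dominates the singularities of a, of its ζ-th power and of the last
  -- gap.
  set ρ' := max (ζ * ρ) η with hρ'
  have hρ1 : ρ' < 1 := max_lt hζρ hη1
  have hρ0 : 0 ≤ ρ' := hη0.trans (le_max_right _ _)
  have hζ0 : 0 < ζ := by linarith
  have hρρ : (1 : ℝ) * ρ ≤ ρ' := le_trans (by nlinarith) (le_max_left _ _)
  have hG0 : ∀ t ≤ 0, ∀ x y, trunc T G t x y = 0 := fun t ht x y => trunc_of_nonpos ht _ _ _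
  have habζ := enorm_rpow_le_timePow (T := T) h0 hζ0 (le_max_left (ζ * ρ) η) hρ1 hab ha0
  have hab1 := enorm_rpow_le_timePow (T := T) h0 one_pos hρρ hρ1 hab ha0
  simp only [ENNReal.rpow_one] at hab1
  set A₁ := A * ENNReal.ofReal (1 + T) with hA₁d
  have hA₁ : A₁ ≠ ∞ := ENNReal.mul_ne_top hA (by simp)
  have hAζ : A ^ ζ * ENNReal.ofReal (1 + T) ≠ ∞ :=
    ENNReal.mul_ne_top (ENNReal.rpow_ne_top_of_nonneg hζ0.le hA) (by simp)
  have hTtop : ENNReal.ofReal (1 + T) ≠ ∞ := by simp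
  -- the fixed time bounds, with the power of the last gap in the common form
  have hpow : ∀ {n : ℕ} {t : ℝ}, t ≤ T → ∀ δ : Fin (n + 1) → ℝ, (∀ i, 0 < δ i) → ∑ i, δ i = t →
      δ (Fin.last n) ≤ T := fun ht δ hδ hs =>
    (Finset.single_le_sum (fun i _ => (hδ i).le) (Finset.mem_univ _)).trans (hs.trans_le ht)
  have hin' : ∀ z₀ z₁ : Sp d, ∀ R > (0 : ℝ), ∃ C : ℝ≥0, ∀ (n : ℕ), 1 ≤ n → ∀ t ≤ T,
      ∀ y₀ ∈ Metric.ball z₀ r, ∀ y₁ ∈ Metric.ball z₁ r,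
      ∀ δ : Fin (n + 1) → ℝ, (∀ i, 0 < δ i) → ∑ i, δ i = t →
        ∫⁻ y in {y : Fin n → Sp d | ∑ i, ‖y i‖ ≤ R},
          chainProd (fun t a b => (γ t a b : ℝ≥0∞) ^ ζ) (fun t a b => ‖trunc T G t a b‖ₑ ^ ζ)
            δ y₀ y y₁
        ≤ (C : ℝ≥0∞) ^ (n + 1) * (ENNReal.ofReal (1 + T) * ξ t)
          * timePow ρ' (δ (Fin.last n)) := by
    intro z₀ z₁ R hR
    obtain ⟨C, hC⟩ := hin z₀ z₁ R hR
    refine ⟨C, fun n hn t ht y₀ hy₀ y₁ hy₁ δ hδ hs => ?_⟩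
    have := hC n hn δ hδ (hs.trans_le ht) y₀ hy₀ y₁ hy₁
    calc _ ≤ _ := lintegral_mono fun y => chainProd_mono_right
          (fun t x y => ENNReal.rpow_le_rpow (enorm_trunc_le T t G x y) hζ0.le) _ _ _ _
      _ ≤ _ := this
      _ ≤ (C : ℝ≥0∞) ^ (n + 1) * ξ t * (ENNReal.ofReal (1 + T) * timePow ρ' (δ (Fin.last n))) := by
          rw [hs, ← timePow_of_pos (hδ _)]
          gcongr
          exact timePow_le_timePow hη0 (le_max_right _ _) hρ1 (hpow ht δ hδ hs)
      _ = _ := by ring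
  have hout' : ∀ z₀ z₁ : Sp d, ∃ C : ℝ≥0, ∀ ε : ℝ≥0, 0 < ε → ∃ R > (0 : ℝ), ∀ (n : ℕ), 1 ≤ n →
      ∀ t ≤ T, ∀ y₀ ∈ Metric.ball z₀ r, ∀ y₁ ∈ Metric.ball z₁ r,
      ∀ δ : Fin (n + 1) → ℝ, (∀ i, 0 < δ i) → ∑ i, δ i = t →
        ∫⁻ y in {y : Fin n → Sp d | R < ∑ i, ‖y i‖},
          chainProd (fun t a b => (γ t a b : ℝ≥0∞)) (fun t a b => ‖trunc T G t a b‖ₑ) δ y₀ y y₁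
        ≤ (C : ℝ≥0∞) ^ (n + 1) * (ε * (ENNReal.ofReal (1 + T) * ξ t))
          * timePow ρ' (δ (Fin.last n)) := by
    intro z₀ z₁
    obtain ⟨C, hC⟩ := hout z₀ z₁
    refine ⟨C, fun ε hε => ?_⟩
    obtain ⟨R, hR, hRb⟩ := hC ε hε
    refine ⟨R, hR, fun n hn t ht y₀ hy₀ y₁ hy₁ δ hδ hs => ?_⟩
    have := hRb n hn δ hδ (hs.trans_le ht) y₀ hy₀ y₁ hy₁
    calc _ ≤ _ := lintegral_mono fun y => chainProd_mono_right
          (fun t x y => enorm_trunc_le T t G x y) _ _ _ _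
      _ ≤ _ := this
      _ ≤ (C : ℝ≥0∞) ^ (n + 1) * ε * ξ t *
            (ENNReal.ofReal (1 + T) * timePow ρ' (δ (Fin.last n))) := by
          rw [hs, ← timePow_of_pos (hδ _)]
          gcongr
          exact timePow_le_timePow hη0 (le_max_right _ _) hρ1 (hpow ht δ hδ hs)
      _ = _ := by ring
  -- The summand 1 beside ξ makes room for the volume term in the total bound.
  refine ⟨r, hr, ζ, hζ, fun t => ENNReal.ofReal (1 + T) * (1 + ξ t) * timePow ρ' t, ?_, ?_, ?_, ?_⟩
  · intro t₀ ht₀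
    obtain ⟨M, hM⟩ := hξ t₀ ht₀
    refine ⟨ENNReal.ofReal (1 + T) * (1 + M) * ENNReal.ofReal (t₀ ^ (-ρ')),
      by finiteness, fun t ht => ?_⟩
    beta_reduce
    rw [timePow_of_pos (ht₀.trans_le ht.1)]
    refine mul_le_mul' (by gcongr; exact hM t ht)
      (ENNReal.ofReal_le_ofReal (Real.rpow_le_rpow_of_nonpos ht₀ ht.1 (by linarith)))
  · intro x₀ y₀
    -- For the total mass, the tail is taken with ε = 1. On the remaining compact set only an L^ζ
    -- bound is known; x ≤ 1 + x^ζ turns it into an L¹ bound at the price of the volume, which is at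
    -- most D^n.
    obtain ⟨C₁, hC₁⟩ := hout' x₀ y₀
    obtain ⟨R, hR, hRb⟩ := hC₁ 1 one_pos
    obtain ⟨C₂, hC₂⟩ := hin' x₀ y₀ R hR
    set D := volume (Metric.closedBall (0 : Sp d) R) with hD
    have hDt : D ≠ ∞ := measure_closedBall_lt_top.ne
    -- The factor 3 absorbs the sum of the volume, inner and tail terms.
    set C : ℝ≥0∞ := 3 * (C₁ + C₂ + D + 1) with hCd
    have hCt : C ≠ ∞ := by finiteness
    obtain ⟨M, hM, hMb⟩ := exists_chainTerm_bound (T := T) ha hG hG0 one_pos hρ0 hρ1 hA₁ hCt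
      (fun t x y => by simpa only [ENNReal.rpow_one] using hab1 t x y)
    refine ⟨M, hM, fun n hn t ht x hx y hy => ?_⟩
    have := hMb n t ht.2 x y Set.univ MeasurableSet.univ (ENNReal.ofReal (1 + T) * (1 + ξ t))
      (fun δ hδ hs => ?_)
    · simpa only [Set.mem_univ, Set.ofPred_true, Measure.restrict_univ, ENNReal.rpow_one] using this
    simp only [ENNReal.rpow_one, Measure.restrict_univ]
    -- The volume term carries no power of the last gap; this inequality supplies one.
    have hone : 1 ≤ ENNReal.ofReal (1 + T) * timePow ρ' (δ (Fin.last n)) := by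
      refine le_trans ?_ (timePow_le_timePow le_rfl hρ0 hρ1 (hpow ht.2 δ hδ hs))
      rw [timePow_of_pos (hδ _)]; simp
    have hb : ∀ c : ℝ≥0∞, c ≤ C₁ + C₂ + D + 1 → 3 * c ^ (n + 1) ≤ C ^ (n + 1) := fun c hc => by
      rw [hCd, mul_pow]
      gcongr
      exact le_self_pow (by norm_num) (by omega)
    have hcompl : {z : Fin n → Sp d | ∑ i, ‖z i‖ ≤ R}ᶜ = {z : Fin n → Sp d | R < ∑ i, ‖z i‖} := by
      ext z; simp
    rw [← lintegral_add_compl _ (measurableSet_sum_norm_le n R), hcompl]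
    set w := timePow ρ' (δ (Fin.last n))
    have e1 : ∫⁻ z in {z : Fin n → Sp d | ∑ i, ‖z i‖ ≤ R},
        chainProd (fun t a b => (γ t a b : ℝ≥0∞)) (fun t a b => ‖trunc T G t a b‖ₑ) δ x z y
        ≤ D ^ n + (C₂ : ℝ≥0∞) ^ (n + 1) * (ENNReal.ofReal (1 + T) * ξ t) * w := by
      calc _ ≤ ∫⁻ z in {z : Fin n → Sp d | ∑ i, ‖z i‖ ≤ R}, (1 +
            chainProd (fun t a b => (γ t a b : ℝ≥0∞) ^ ζ) (fun t a b => ‖trunc T G t a b‖ₑ ^ ζ)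
              δ x z y) := by
            refine lintegral_mono fun z => ?_
            rw [← chainProd_rpow _ _ hζ0.le]
            exact ENNReal_le_one_add_rpow hζ.le _
        _ ≤ _ := by
            rw [lintegral_add_left measurable_const]
            gcongr
            · simpa using volume_sum_norm_le n R
            · exact hC₂ n hn t ht.2 x hx y hy δ hδ hs
    have e2 := hRb n hn t ht.2 x hx y hy δ hδ hs
    simp only [ENNReal.coe_one, one_mul] at e2
    have hDn : D ^ n ≤ (C₁ + C₂ + D + 1) ^ (n + 1) := by
      calc D ^ n ≤ (C₁ + C₂ + D + 1) ^ n := by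
            gcongr
            exact le_trans le_add_self le_self_add
        _ ≤ _ := pow_le_pow_right₀ le_add_self (by omega)
    set E : ℝ≥0∞ := (C₁ + C₂ + D + 1) ^ (n + 1) with hE
    have k1 : (C₁ : ℝ≥0∞) ^ (n + 1) ≤ E := by
      rw [hE]; gcongr
      exact le_trans (le_trans le_self_add le_self_add) le_self_add
    have k2 : (C₂ : ℝ≥0∞) ^ (n + 1) ≤ E := by
      rw [hE]; gcongr
      exact le_trans (le_trans le_add_self le_self_add) le_self_add
    calc _ ≤ (D ^ n + (C₂ : ℝ≥0∞) ^ (n + 1) * (ENNReal.ofReal (1 + T) * ξ t) * w) + _ :=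
          add_le_add e1 e2
      _ ≤ (E * (ENNReal.ofReal (1 + T) * w) + E * (ENNReal.ofReal (1 + T) * ξ t) * w) +
            E * (ENNReal.ofReal (1 + T) * ξ t) * w := by
          gcongr
          exact hDn.trans (le_mul_of_one_le_right zero_le hone)
      _ = E * (ENNReal.ofReal (1 + T) * (1 + 2 * ξ t) * w) := by ring
      _ ≤ E * (ENNReal.ofReal (1 + T) * (3 + 3 * ξ t) * w) := by gcongr <;> norm_num
      _ = (3 * E) * (ENNReal.ofReal (1 + T) * (1 + ξ t)) * w := by ring
      _ ≤ _ := by gcongr; exact hb _ le_rfl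
  · intro x₀ y₀ R hR
    obtain ⟨C, hC⟩ := hin' x₀ y₀ R hR
    obtain ⟨M, hM, hMb⟩ := exists_chainTerm_bound (T := T) ha hG hG0 hζ0 hρ0 hρ1 hAζ
      (ENNReal.coe_ne_top (r := C)) habζ
    refine ⟨M, hM, fun n hn t ht x hx y hy => ?_⟩
    refine (hMb n t ht.2 x y _ (measurableSet_sum_norm_le n R) (ENNReal.ofReal (1 + T) * ξ t)
      (hC n hn t ht.2 x hx y hy)).trans ?_
    gcongr
    exact le_add_self
  · intro x₀ y₀ ε hε
    obtain ⟨C, hC⟩ := hout' x₀ y₀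
    obtain ⟨M, hM, hMb⟩ := exists_chainTerm_bound (T := T) ha hG hG0 one_pos hρ0 hρ1 hA₁
      (ENNReal.coe_ne_top (r := C)) (fun t x y => by simpa only [ENNReal.rpow_one] using hab1 t x y)
    -- The tightness level is divided in advance by the constant that the time integration produces.
    obtain ⟨ε', hε', hε'M⟩ : ∃ ε' : ℝ≥0, 0 < ε' ∧ M * ε' ≤ ε := by
      have : 0 < min (ε / (M + 1)) 1 := by
        refine lt_min (ENNReal.div_pos hε (by finiteness)) one_pos
      obtain ⟨ε', h1, h2⟩ := ENNReal.lt_iff_exists_nnreal_btwn.1 this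
      refine ⟨ε', by exact_mod_cast h1, ?_⟩
      have h3 : (ε' : ℝ≥0∞) ≤ ε / (M + 1) := h2.le.trans (min_le_left _ _)
      rw [ENNReal.le_div_iff_mul_le (.inl (by simp)) (.inl (by finiteness))] at h3
      refine le_trans ?_ h3
      rw [mul_comm]
      gcongr
      exact le_self_add
    obtain ⟨R, hR, hRb⟩ := hC ε' hε'
    refine ⟨R, hR, fun n hn t ht x hx y hy => ?_⟩
    have := hMb n t ht.2 x y _ (measurableSet_lt_sum_norm n R) (ε' * (ENNReal.ofReal (1 + T) * ξ t))
      (fun δ hδ hs => by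
        simpa only [ENNReal.rpow_one] using hRb n hn t ht.2 x hx y hy δ hδ hs)
    simp only [ENNReal.rpow_one] at this
    refine this.trans ?_
    calc _ ≤ M * 1 * (ε' * (ENNReal.ofReal (1 + T) * ξ t) * timePow ρ' t) := by
          gcongr
          exact pow_le_one' (by simp) n
      _ = (M * ε') * (ENNReal.ofReal (1 + T) * ξ t * timePow ρ' t) := by ring
      _ ≤ _ := by
          gcongr
          exact le_add_self

end

end

section

/-! ### Chain integrals -/

variable {d : ℕ} {F : Type*} [NormedAddCommGroup F] [NormedSpace ℝ F]

/-- A measurable kernel supported on times in `(0, T]` and dominated by `t ^ (-ρ) γ`. -/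
structure DominatedKernel (T ρ : ℝ) (γ : ℝ → Sp d → Sp d → ℝ≥0) (A : ℝ≥0∞)
    (a : ℝ → Sp d → Sp d → ℝ) : Prop where
  meas : Measurable fun q : ℝ × Sp d × Sp d => a q.1 q.2.1 q.2.2
  zero : ∀ t, t ∉ Set.Ioc 0 T → ∀ x y, a t x y = 0
  bound : ∀ t x y, ‖a t x y‖ₑ ≤ A * timePow ρ t * γ t x y
  ne_top : A ≠ ∞
  rho_nonneg : 0 ≤ ρ
  rho_lt_one : ρ < 1

lemma DominatedKernel.zero_of_nonpos {T ρ : ℝ} {γ : ℝ → Sp d → Sp d → ℝ≥0} {A : ℝ≥0∞}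
    {a : ℝ → Sp d → Sp d → ℝ} (h : DominatedKernel T ρ γ A a) :
    ∀ t ≤ 0, ∀ x y, a t x y = 0 := fun t ht => h.zero t fun h' => ht.not_gt h'.1

/-- The integral of the chain expansion over the intermediate times and positions. -/
def chainInt (a : ℝ → Sp d → Sp d → ℝ) (G : ℝ → Sp d → Sp d → F) (n : ℕ) (t : ℝ) (x y : Sp d) :
    F := ∫ v, chainTerm a G n t x y v

lemma chainTerm_zero (a : ℝ → Sp d → Sp d → ℝ) (G : ℝ → Sp d → Sp d → F) (t : ℝ) (x y : Sp d)
    (v : Fin 0 → ℝ × Sp d) : chainTerm a G 0 t x y v = G t x y := by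
  simp [chainTerm, chainWeight_zero, pathEnd_zero]

lemma chainInt_zero [CompleteSpace F] (a : ℝ → Sp d → Sp d → ℝ) (G : ℝ → Sp d → Sp d → F) (t : ℝ)
    (x y : Sp d) : chainInt a G 0 t x y = G t x y := by
  unfold chainInt
  simp_rw [chainTerm_zero]
  exact integral_fin_zero _

lemma chainTerm_snoc (a : ℝ → Sp d → Sp d → ℝ) (G : ℝ → Sp d → Sp d → F) (n : ℕ) (t : ℝ)
    (x y : Sp d) (v : Fin n → ℝ × Sp d) (w : ℝ × Sp d) :
    chainTerm a G (n + 1) t x y (Fin.snoc v w)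
      = chainTerm a a n w.1 x w.2 v • G (t - w.1) w.2 y := by
  unfold chainTerm
  rw [chainWeight_snoc, pathEnd_snoc]
  rfl

lemma times_mem_of_gaps_pos {n : ℕ} {s : Fin n → ℝ} {t : ℝ} (h : ∀ i, 0 < gaps s t i) (i : Fin n) :
    s i ∈ Set.Ioo 0 t := by
  have hmono : StrictMono (path 0 s) := by
    rw [Fin.strictMono_iff_lt_succ]
    intro i
    have := h i.castSucc
    rw [gaps_castSucc] at this
    linarith
  have hlast := h (Fin.last n)
  rw [gaps_last] at hlast
  rw [← path_succ 0 s i]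
  refine ⟨?_, ?_⟩
  · have := hmono (Fin.succ_pos i)
    simpa [path] using this
  · have := hmono.monotone (Fin.le_last i.succ)
    unfold pathEnd at hlast
    linarith

lemma chainTerm_eq_zero_of_gap {a : ℝ → Sp d → Sp d → ℝ} {G : ℝ → Sp d → Sp d → F}
    (ha : ∀ t ≤ 0, ∀ x y, a t x y = 0) (hG : ∀ t ≤ 0, ∀ x y, G t x y = 0) {n : ℕ} {t : ℝ}
    {x y : Sp d} {v : Fin n → ℝ × Sp d} (h : ¬ ∀ i, 0 < gaps (fun i => (v i).1) t i) :
    chainTerm a G n t x y v = 0 := by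
  have := enorm_chainTerm_rpow a G t zero_le_one x y (fun i => (v i).1) (fun i => (v i).2)
  simp only [ENNReal.rpow_one] at this
  rw [chainProd_eq_zero_of_gap (fun t ht x y => by simp [ha t ht])
    (fun t ht x y => by simp [hG t ht]) h] at this
  simpa using this

lemma chainTerm_eq_zero_of_time {a : ℝ → Sp d → Sp d → ℝ} {G : ℝ → Sp d → Sp d → F}
    (ha : ∀ t ≤ 0, ∀ x y, a t x y = 0) (hG : ∀ t ≤ 0, ∀ x y, G t x y = 0) {n : ℕ} {t : ℝ}
    {x y : Sp d} {v : Fin n → ℝ × Sp d} {i : Fin n} (h : (v i).1 ∉ Set.Ioo 0 t) :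
    chainTerm a G n t x y v = 0 :=
  chainTerm_eq_zero_of_gap ha hG fun h' => h (times_mem_of_gaps_pos h' i)

lemma chainTerm_eq_zero_of_nonpos {a : ℝ → Sp d → Sp d → ℝ} {G : ℝ → Sp d → Sp d → F}
    (ha : ∀ t ≤ 0, ∀ x y, a t x y = 0) (hG : ∀ t ≤ 0, ∀ x y, G t x y = 0) {n : ℕ} {t : ℝ}
    (ht : t ≤ 0) (x y : Sp d) (v : Fin n → ℝ × Sp d) :
    chainTerm a G n t x y v = 0 := by
  refine chainTerm_eq_zero_of_gap ha hG fun h' => ?_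
  have := Finset.sum_pos (fun i _ => h' i) ⟨Fin.last n, Finset.mem_univ _⟩
  rw [sum_gaps] at this
  linarith

lemma chainInt_of_nonpos {a : ℝ → Sp d → Sp d → ℝ} {G : ℝ → Sp d → Sp d → F}
    (ha : ∀ t ≤ 0, ∀ x y, a t x y = 0) (hG : ∀ t ≤ 0, ∀ x y, G t x y = 0) (n : ℕ) {t : ℝ}
    (ht : t ≤ 0) (x y : Sp d) : chainInt a G n t x y = 0 := by
  unfold chainInt
  simp [chainTerm_eq_zero_of_nonpos ha hG ht]

/-! ### Measurability and the recursion for chain integrals. -/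

section Measurability

variable [MeasurableSpace F] [BorelSpace F] [SecondCountableTopology F]

lemma measurable_chainInt {a : ℝ → Sp d → Sp d → ℝ} {G : ℝ → Sp d → Sp d → F}
    (ha : Measurable fun q : ℝ × Sp d × Sp d => a q.1 q.2.1 q.2.2)
    (hG : Measurable fun q : ℝ × Sp d × Sp d => G q.1 q.2.1 q.2.2) (n : ℕ) :
    Measurable fun q : ℝ × Sp d × Sp d => chainInt a G n q.1 q.2.1 q.2.2 :=
  (StronglyMeasurable.integral_prod_right
    (measurable_chainTerm ha hG n).stronglyMeasurable).measurable

/-- The first n points integrate to an expansion with a itself on the last link. This is why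
`chainInt a a n` plays the role of the iterated kernel Â_{n+1}. -/
lemma chainInt_succ [CompleteSpace F] {a : ℝ → Sp d → Sp d → ℝ} {G : ℝ → Sp d → Sp d → F} {n : ℕ}
    {t : ℝ} {x y : Sp d} (h : Integrable (chainTerm a G (n + 1) t x y)) :
    chainInt a G (n + 1) t x y = ∫ w : ℝ × Sp d, chainInt a a n w.1 x w.2 • G (t - w.1) w.2 y := by
  unfold chainInt
  rw [integral_snoc h]
  simp_rw [chainTerm_snoc, integral_smul_const]

lemma integrable_chainInt_smul [CompleteSpace F] {a : ℝ → Sp d → Sp d → ℝ}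
    {G : ℝ → Sp d → Sp d → F} {n : ℕ}
    {t : ℝ} {x y : Sp d} (h : Integrable (chainTerm a G (n + 1) t x y)) :
    Integrable fun w : ℝ × Sp d => chainInt a a n w.1 x w.2 • G (t - w.1) w.2 y := by
  have := (integrable_snoc.1 h).integral_prod_left
  unfold chainInt
  simp_rw [chainTerm_snoc, integral_smul_const] at this
  exact this

end Measurability

/-- Chains of γ with fixed end points are bounded by β, which is finite at every point. So the
iterated kernels converge absolutely everywhere, and not only almost everywhere. No decay in n is
needed, hence κ = 1. -/
lemma GammaClass.integrable_chainTerm {T ρ : ℝ} {γ β : ℝ → Sp d → Sp d → ℝ≥0} {A : ℝ≥0∞}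
    {a : ℝ → Sp d → Sp d → ℝ} (hγ : GammaClass T γ β) (h : DominatedKernel T ρ γ A a) (n : ℕ)
    {t : ℝ} (ht : t ≤ T) (x y : Sp d) : Integrable (chainTerm a a n t x y) := by
  refine ⟨(measurable_chainTerm_apply h.meas h.meas n t x y).aestronglyMeasurable, ?_⟩
  obtain ⟨C, hC⟩ := hγ
  obtain ⟨l, hl, hl'⟩ := lintegral_chainWeight_timePow_le h.rho_nonneg h.rho_lt_one
    (κ := 1) one_pos
  have key := lintegral_enorm_chainTerm_rpow_le h.meas h.meas h.zero_of_nonpos (p := 1) one_pos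
    (γ := fun t x y => (γ t x y : ℝ≥0∞)) h.ne_top
    (fun t x y => by simpa only [ENNReal.rpow_one] using h.bound t x y) (n := n) (t := t)
    (x := x) (y := y)
    MeasurableSet.univ (B := A * ((C : ℝ≥0∞) ^ (n + 1) * β t x y)) (fun δ hδ hs => ?_) (hl' n t)
  · simp only [Set.mem_univ, Set.ofPred_true, Measure.restrict_univ, ENNReal.rpow_one] at key
    have hA := h.ne_top
    have := timePow_ne_top ρ t
    exact key.trans_lt (by finiteness)
  simp only [ENNReal.rpow_one, Measure.restrict_univ]
  calc _ ≤ ∫⁻ z : Fin n → Sp d, (A * timePow ρ (δ (Fin.last n))) *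
        chainProd (fun t a b => (γ t a b : ℝ≥0∞)) (fun t a b => (γ t a b : ℝ≥0∞)) δ x z y := by
        refine lintegral_mono fun z => ?_
        unfold chainProd
        simp only
        rw [← mul_assoc, mul_comm (A * _), mul_assoc]
        gcongr
        exact h.bound _ _ _
    _ = (A * timePow ρ (δ (Fin.last n))) * ∫⁻ z : Fin n → Sp d,
        chainProd (fun t a b => (γ t a b : ℝ≥0∞)) (fun t a b => (γ t a b : ℝ≥0∞)) δ x z y :=
        lintegral_const_mul' _ _ (ENNReal.mul_ne_top h.ne_top (timePow_ne_top _ _))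
    _ ≤ (A * timePow ρ (δ (Fin.last n))) * ((C : ℝ≥0∞) ^ (n + 1) * β t x y) := by
        gcongr
        have := hC n δ hδ (hs.trans_le ht) x y
        rwa [hs] at this
    _ = _ := by ring

/-- A convolution in time and space as an integral over `ℝ × ℝ^d`. -/
lemma intervalIntegral_chainInt {T ρ : ℝ} {γ : ℝ → Sp d → Sp d → ℝ≥0} {A : ℝ≥0∞}
    {a : ℝ → Sp d → Sp d → ℝ} (h : DominatedKernel T ρ γ A a) {n : ℕ} {t : ℝ}
    (ht : t ∈ Set.Ioc 0 T) {x y : Sp d} {K g : ℝ → Sp d → Sp d → ℝ}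
    (hK : ∀ u ∈ Set.Ioc 0 T, ∀ x y, K u x y = chainInt a a n u x y)
    (hint : Integrable (chainTerm a (trunc T g) (n + 1) t x y)) :
    ∫ s in (0 : ℝ)..t, ∫ z, K (t - s) x z * g s z y = chainInt a (trunc T g) (n + 1) t x y := by
  -- Time reversal: s is the duration of the last link, whereas a chain records the time t - s of
  -- its last point.
  have e1 : ∫ s in (0 : ℝ)..t, ∫ z, K (t - s) x z * g s z y
      = ∫ u in (0 : ℝ)..t, ∫ z, K u x z * g (t - u) z y := by
    have := intervalIntegral.integral_comp_sub_left (a := 0) (b := t)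
      (fun u => ∫ z, K u x z * g (t - u) z y) t
    simpa using this
  rw [e1, chainInt_succ hint, intervalIntegral.integral_of_le ht.1.le,
    ← integral_Ioc_eq_integral_Ioo.symm]
  rw [show (volume : Measure (ℝ × Sp d)) = (volume : Measure ℝ).prod volume from rfl,
    integral_prod _ (integrable_chainInt_smul hint), ← integral_indicator measurableSet_Ioo]
  congr 1
  funext u
  unfold Set.indicator
  split_ifs with hu
  · beta_reduce
    congr 1
    funext z
    rw [hK u ⟨hu.1, hu.2.le.trans ht.2⟩, trunc_of_mem]
    · rfl
    · exact ⟨by linarith [hu.2], by linarith [hu.1, ht.2]⟩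
  · simp only [Set.mem_Ioo, not_and_or, not_lt] at hu
    rcases hu with hu | hu
    · simp [chainInt_of_nonpos h.zero_of_nonpos h.zero_of_nonpos n hu]
    · simp [trunc_of_nonpos (show t - u ≤ 0 by linarith)]

/-- Each convolution appends one point to the chain; the class Γ_β supplies the absolute convergence
that Fubini's theorem needs. -/
lemma iterKernel_eq_chainInt {T ρ : ℝ} {γ β : ℝ → Sp d → Sp d → ℝ≥0} {A : ℝ≥0∞}
    {a : ℝ → Sp d → Sp d → ℝ} (hγ : GammaClass T γ β) (h : DominatedKernel T ρ γ A (trunc T a))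
    (n : ℕ) {t : ℝ} (ht : t ∈ Set.Ioc 0 T) (x y : Sp d) :
    iterKernel a n t x y = chainInt (trunc T a) (trunc T a) n t x y := by
  induction n generalizing t x y with
  | zero => rw [chainInt_zero, trunc_of_mem ht]; rfl
  | succ n ih =>
    exact intervalIntegral_chainInt h ht (fun u hu x y => ih hu x y)
      (hγ.integrable_chainTerm h (n + 1) ht.2 x y)

lemma seriesTerm_eq_chainInt {T ρ : ℝ} {γ β : ℝ → Sp d → Sp d → ℝ≥0} {A : ℝ≥0∞}
    {p : Sp d → ℝ → Sp d → Sp d → ℝ} {θ : ℝ → Sp d → Sp d → ℝ}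
    (hγ : GammaClass T γ β) (h : DominatedKernel T ρ γ A (trunc T (aHat p θ)))
    {n : ℕ} {t : ℝ} (ht : t ∈ Set.Ioc 0 T) {x y : Sp d}
    (hint : Integrable (chainTerm (trunc T (aHat p θ)) (trunc T (phi p)) (n + 1) t y x)) :
    seriesTerm p θ n t x y = chainInt (trunc T (aHat p θ)) (trunc T (phi p)) (n + 1) t y x :=
  intervalIntegral_chainInt h ht (fun u hu x y => iterKernel_eq_chainInt hγ h n hu x y) hint

/-! ### Summability of the chain integrals. -/

section Bounds

variable [MeasurableSpace F] [BorelSpace F] [SecondCountableTopology F] {T r ζ : ℝ} {Ξ : ℝ → ℝ≥0∞}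
  {a : ℝ → Sp d → Sp d → ℝ} {G : ℝ → Sp d → Sp d → F}

lemma ChainBounds.integrable (hb : ChainBounds T r ζ Ξ a G) (hr : 0 < r)
    (hΞ : ∀ t₀ > (0 : ℝ), ∃ M : ℝ≥0∞, M ≠ ∞ ∧ ∀ t ∈ Set.Icc t₀ T, Ξ t ≤ M)
    (ha : Measurable fun q : ℝ × Sp d × Sp d => a q.1 q.2.1 q.2.2)
    (hG : Measurable fun q : ℝ × Sp d × Sp d => G q.1 q.2.1 q.2.2) (n : ℕ) {t : ℝ}
    (ht : t ∈ Set.Ioc 0 T) (x y : Sp d) : Integrable (chainTerm a G n t x y) := by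
  refine ⟨(measurable_chainTerm_apply ha hG n t x y).aestronglyMeasurable, ?_⟩
  rcases Nat.eq_zero_or_pos n with rfl | hn
  · unfold HasFiniteIntegral
    rw [lintegral_fin_zero]
    exact enorm_lt_top
  obtain ⟨M, hM, hMb⟩ := hb.total x y
  obtain ⟨N, hN, hNb⟩ := hΞ t ht.1
  refine (hMb n hn t ht x (Metric.mem_ball_self hr) y (Metric.mem_ball_self hr)).trans_lt ?_
  have := ne_top_of_le_ne_top hN (hNb t ⟨le_rfl, ht.2⟩)
  finiteness

/-- A uniform geometric bound on the chain integrals near a point. -/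
lemma ChainBounds.exists_geometric (hb : ChainBounds T r ζ Ξ a G)
    (hΞ : ∀ t₀ > (0 : ℝ), ∃ M : ℝ≥0∞, M ≠ ∞ ∧ ∀ t ∈ Set.Icc t₀ T, Ξ t ≤ M)
    {t₀ : ℝ} (ht₀ : 0 < t₀) (x₀ y₀ : Sp d) :
    ∃ M : ℝ≥0, ∀ n : ℕ, 1 ≤ n → ∀ t ∈ Set.Icc t₀ T, ∀ x ∈ Metric.ball x₀ r,
      ∀ y ∈ Metric.ball y₀ r, ∫⁻ v, ‖chainTerm a G n t x y v‖ₑ ≤ ((M * 2⁻¹ ^ n : ℝ≥0) : ℝ≥0∞) := by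
  obtain ⟨M, hM, hMb⟩ := hb.total x₀ y₀
  obtain ⟨N, hN, hNb⟩ := hΞ t₀ ht₀
  refine ⟨(M * N).toNNReal, fun n hn t ht x hx y hy => ?_⟩
  refine (hMb n hn t ⟨ht₀.trans_le ht.1, ht.2⟩ x hx y hy).trans ?_
  rw [ENNReal.coe_mul, ENNReal.coe_toNNReal (by finiteness), ENNReal.coe_pow,
    ENNReal.coe_inv (by norm_num)]
  calc _ ≤ M * 2⁻¹ ^ n * N := by gcongr; exact hNb t ht
    _ = M * N * 2⁻¹ ^ n := by ring
    _ = _ := by simp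

lemma norm_chainInt_le {n : ℕ} {t : ℝ} {x y : Sp d} {b : ℝ≥0}
    (h : ∫⁻ v, ‖chainTerm a G n t x y v‖ₑ ≤ b) : ‖chainInt a G n t x y‖ ≤ b := by
  have := (enorm_integral_le_lintegral_enorm (chainTerm a G n t x y)).trans h
  rw [enorm_eq_nnnorm, ENNReal.coe_le_coe] at this
  exact this

lemma summable_mul_two_inv_pow (M : ℝ≥0) : Summable fun n : ℕ => ((M * 2⁻¹ ^ n : ℝ≥0) : ℝ) := by
  push_cast
  refine Summable.mul_left _ (summable_geometric_of_lt_one (by norm_num) (by norm_num))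

lemma ChainBounds.summable [CompleteSpace F] (hb : ChainBounds T r ζ Ξ a G) (hr : 0 < r)
    (hΞ : ∀ t₀ > (0 : ℝ), ∃ M : ℝ≥0∞, M ≠ ∞ ∧ ∀ t ∈ Set.Icc t₀ T, Ξ t ≤ M)
    {t : ℝ} (ht : t ∈ Set.Ioc 0 T) (x y : Sp d) :
    Summable fun n => chainInt a G n t x y := by
  obtain ⟨M, hM⟩ := hb.exists_geometric hΞ ht.1 x y
  rw [← summable_nat_add_iff 1]
  refine Summable.of_norm_bounded ((summable_nat_add_iff 1).2 (summable_mul_two_inv_pow M))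
    fun n => ?_
  exact norm_chainInt_le (hM (n + 1) (by omega) t ⟨le_rfl, ht.2⟩ x (Metric.mem_ball_self hr) y
    (Metric.mem_ball_self hr))

end Bounds

end

section

/-! ### Continuity of the chain integrals -/

variable {d : ℕ} {F : Type*} [NormedAddCommGroup F] [NormedSpace ℝ F]

lemma volume_fst_eq_null (t : ℝ) : (volume : Measure (ℝ × Sp d)) {w | w.1 = t} = 0 := by
  have : {w : ℝ × Sp d | w.1 = t} = {t} ×ˢ Set.univ := by ext w; simp
  rw [this, Measure.volume_eq_prod, Measure.prod_prod]
  simp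

/-- Hyperplanes are null sets. The exception matters because continuity of a chain term in t can
fail where the last intermediate time equals t. -/
lemma ae_fst_ne (n : ℕ) (i : Fin n) (t : ℝ) : ∀ᵐ v : Fin n → ℝ × Sp d, (v i).1 ≠ t := by
  have := Measure.pi_eval_preimage_null (fun _ : Fin n => (volume : Measure (ℝ × Sp d)))
    (i := i) (volume_fst_eq_null (d := d) t)
  rw [ae_iff, volume_pi]
  convert this using 2
  ext v
  simp

/-- Bounded times and positions. -/
def chainBox (d n : ℕ) (T R : ℝ) : Set (Fin n → ℝ × Sp d) :=
  {v | (∀ i, (v i).1 ∈ Set.Icc 0 T) ∧ ∑ i, ‖(v i).2‖ ≤ R}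

lemma measurableSet_chainBox (n : ℕ) (T R : ℝ) : MeasurableSet (chainBox d n T R) := by
  unfold chainBox
  refine MeasurableSet.inter (s₁ := {v : Fin n → ℝ × Sp d | ∀ i, (v i).1 ∈ Set.Icc 0 T}) ?_ ?_
  · have : {v : Fin n → ℝ × Sp d | ∀ i, (v i).1 ∈ Set.Icc 0 T}
        = ⋂ i, (fun v : Fin n → ℝ × Sp d => (v i).1) ⁻¹' Set.Icc 0 T := by ext v; simp
    rw [this]
    exact MeasurableSet.iInter fun i => (by fun_prop :
      Measurable fun v : Fin n → ℝ × Sp d => (v i).1) measurableSet_Icc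
  · exact measurableSet_le (f := fun v : Fin n → ℝ × Sp d => ∑ i, ‖(v i).2‖) (by fun_prop)
      measurable_const

lemma volume_chainBox_ne_top (n : ℕ) (T R : ℝ) : volume (chainBox d n T R) ≠ ∞ := by
  refine ne_top_of_le_ne_top ?_ (measure_mono (t := Set.univ.pi fun _ : Fin n =>
    Set.Icc 0 T ×ˢ Metric.closedBall (0 : Sp d) R) fun v hv => ?_)
  · rw [volume_pi_pi]
    refine ENNReal.prod_ne_top fun i _ => ?_
    rw [Measure.volume_eq_prod, Measure.prod_prod]
    have : volume (Metric.closedBall (0 : Sp d) R) ≠ ∞ := measure_closedBall_lt_top.ne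
    have h2 : volume (Set.Icc 0 T) ≠ ∞ := by simp
    exact ENNReal.mul_ne_top h2 this
  · simp only [Set.mem_univ_pi, Set.mem_prod, mem_closedBall_zero_iff]
    exact fun i => ⟨hv.1 i, (Finset.single_le_sum (f := fun i => ‖(v i).2‖)
      (fun _ _ => norm_nonneg _) (Finset.mem_univ i)).trans hv.2⟩

section

variable [MeasurableSpace F] [BorelSpace F] [SecondCountableTopology F] {T r ζ : ℝ} {Ξ : ℝ → ℝ≥0∞}
  {a : ℝ → Sp d → Sp d → ℝ} {G : ℝ → Sp d → Sp d → F}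

/-- A chain outside the box has large positions, or else a time outside [0, T], and then its term is
zero. -/
lemma lintegral_compl_chainBox_le (ha : ∀ t ≤ 0, ∀ x y, a t x y = 0)
    (hG : ∀ t ≤ 0, ∀ x y, G t x y = 0) {n : ℕ} {R t : ℝ} (ht : t ≤ T) (x y : Sp d) :
    ∫⁻ v in (chainBox d n T R)ᶜ, ‖chainTerm a G n t x y v‖ₑ
      ≤ ∫⁻ v in {v : Fin n → ℝ × Sp d |
          (fun i => (v i).2) ∈ {z : Fin n → Sp d | R < ∑ i, ‖z i‖}},
        ‖chainTerm a G n t x y v‖ₑ := by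
  have hm : MeasurableSet {v : Fin n → ℝ × Sp d |
      (fun i => (v i).2) ∈ {z : Fin n → Sp d | R < ∑ i, ‖z i‖}} :=
    (measurableSet_lt_sum_norm n R).preimage (f := fun (v : Fin n → ℝ × Sp d) i => (v i).2)
      (by fun_prop)
  rw [← lintegral_indicator (measurableSet_chainBox n T R).compl, ← lintegral_indicator hm]
  refine lintegral_mono fun v => ?_
  by_cases h1 : v ∈ (chainBox d n T R)ᶜ
  · rw [Set.indicator_of_mem h1]
    by_cases h2 : R < ∑ i, ‖(v i).2‖
    · rw [Set.indicator_of_mem (by exact h2)]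
    · have h3 : ¬ ∀ i, (v i).1 ∈ Set.Icc 0 T := fun h3 => h1 ⟨h3, not_lt.1 h2⟩
      push Not at h3
      obtain ⟨i, hi⟩ := h3
      rw [chainTerm_eq_zero_of_time ha hG (i := i)]
      · simp
      · exact fun h => hi ⟨h.1.le, h.2.le.trans ht⟩
  · rw [Set.indicator_of_notMem h1]
    exact zero_le

/-- The tightness and boundedness of chain integrands near a point, as the convergence theorem
needs them. -/
lemma ChainBounds.exists_chainBox (hb : ChainBounds T r ζ Ξ a G)
    (hΞ : ∀ t₀ > (0 : ℝ), ∃ M : ℝ≥0∞, M ≠ ∞ ∧ ∀ t ∈ Set.Icc t₀ T, Ξ t ≤ M)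
    (ha : ∀ t ≤ 0, ∀ x y, a t x y = 0) (hG : ∀ t ≤ 0, ∀ x y, G t x y = 0)
    {n : ℕ} (hn : 1 ≤ n) {t₀ : ℝ} (ht₀ : 0 < t₀) (x₀ y₀ : Sp d) {ε : ℝ≥0∞} (hε : ε ≠ 0) :
    ∃ S, MeasurableSet S ∧ volume S ≠ ∞ ∧ ∃ M : ℝ≥0∞, M ≠ ∞ ∧ ∀ t ∈ Set.Icc t₀ T,
      ∀ x ∈ Metric.ball x₀ r, ∀ y ∈ Metric.ball y₀ r,
        ∫⁻ v in Sᶜ, ‖chainTerm a G n t x y v‖ₑ ≤ ε ∧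
        ∫⁻ v in S, ‖chainTerm a G n t x y v‖ₑ ^ ζ ≤ M := by
  obtain ⟨N, hN, hNb⟩ := hΞ t₀ ht₀
  -- N bounds Ξ on [t₀, T], so that this level leaves a tail of at most ε.
  obtain ⟨R, hR, hRb⟩ := hb.outer x₀ y₀ (ε / (N + 1))
    (ENNReal.div_pos hε (by finiteness)).ne'
  obtain ⟨M, hM, hMb⟩ := hb.inner x₀ y₀ R hR
  refine ⟨chainBox d n T R, measurableSet_chainBox n T R, volume_chainBox_ne_top n T R,
    M * N, by finiteness, fun t ht x hx y hy => ⟨?_, ?_⟩⟩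
  · refine (lintegral_compl_chainBox_le ha hG ht.2 x y).trans
      ((hRb n hn t ⟨ht₀.trans_le ht.1, ht.2⟩ x hx y hy).trans ?_)
    calc _ ≤ ε / (N + 1) * (N + 1) := by
          gcongr
          exact (hNb t ht).trans le_self_add
      _ = ε := ENNReal.div_mul_cancel (by simp) (by finiteness)
  · calc _ ≤ ∫⁻ v in {v : Fin n → ℝ × Sp d |
          (fun i => (v i).2) ∈ {z : Fin n → Sp d | ∑ i, ‖z i‖ ≤ R}},
            ‖chainTerm a G n t x y v‖ₑ ^ ζ := lintegral_mono_set fun v hv => hv.2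
      _ ≤ M * 2⁻¹ ^ n * Ξ t := hMb n hn t ⟨ht₀.trans_le ht.1, ht.2⟩ x hx y hy
      _ ≤ M * 1 * N := by
          gcongr
          · exact pow_le_one' (by simp) n
          · exact hNb t ht
      _ = M * N := by ring

lemma pathEnd_succ {V : Type*} {n : ℕ} (v₀ : V) (v : Fin (n + 1) → V) :
    pathEnd v₀ v = v (Fin.last n) := by
  unfold pathEnd
  rw [← Fin.succ_last, path_succ]

/-- The gaps do not move with x: on each link either a is continuous in space at a fixed gap in (0,
T], or it vanishes identically. -/
lemma continuous_chainWeight (ha0 : ∀ t, t ∉ Set.Ioc 0 T → ∀ x y, a t x y = 0)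
    (hac : ContinuousOn (fun q : ℝ × Sp d × Sp d => a q.1 q.2.1 q.2.2) (Set.Ioc 0 T ×ˢ Set.univ))
    {n : ℕ} (v : Fin n → ℝ × Sp d) :
    Continuous fun x : Sp d => chainWeight (link a) ((0 : ℝ), x) v := by
  unfold chainWeight
  refine continuous_finsetProd _ fun i _ => ?_
  have h1 : ∀ j, ∀ x : Sp d, (path ((0 : ℝ), x) v j).1 = path 0 (fun i => (v i).1) j :=
    fun j x => by
    rw [← path_map Prod.fst]
  have h2 : ∀ j, Continuous fun x : Sp d => (path ((0 : ℝ), x) v j).2 := fun j => by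
    unfold path
    refine Fin.cases ?_ (fun j => ?_) j
    · simpa using continuous_id'
    · simpa using continuous_const
  unfold link
  simp_rw [h1]
  set δ := path 0 (fun i => (v i).1) i.succ - path 0 (fun i => (v i).1) i.castSucc with hδ
  by_cases h : δ ∈ Set.Ioc 0 T
  · refine hac.comp_continuous (f := fun x : Sp d => (δ, (path ((0 : ℝ), x) v i.castSucc).2,
      (path ((0 : ℝ), x) v i.succ).2)) ?_ fun x => ⟨h, Set.mem_univ _⟩
    exact continuous_const.prodMk ((h2 _).prodMk (h2 _))
  · simp_rw [ha0 _ h]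
    exact continuous_const

/-- If the last intermediate time is below t, the last gap stays positive nearby and G is continuous
there. If it is above t, the term vanishes nearby. Equality, where G would be needed at time zero,
is excluded. -/
lemma tendsto_chainTerm (ha0 : ∀ t, t ∉ Set.Ioc 0 T → ∀ x y, a t x y = 0)
    (hac : ContinuousOn (fun q : ℝ × Sp d × Sp d => a q.1 q.2.1 q.2.2) (Set.Ioc 0 T ×ˢ Set.univ))
    (hG0 : ∀ t ≤ 0, ∀ x y, G t x y = 0)
    (hGc : ContinuousOn (fun q : ℝ × Sp d × Sp d => G q.1 q.2.1 q.2.2) (Set.Ioc 0 T ×ˢ Set.univ))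
    {n : ℕ} {q₀ : ℝ × Sp d × Sp d} (hq₀ : q₀ ∈ Set.Ioc 0 T ×ˢ (Set.univ : Set (Sp d × Sp d)))
    {v : Fin (n + 1) → ℝ × Sp d} (hv : (v (Fin.last n)).1 ≠ q₀.1) :
    Tendsto (fun q : ℝ × Sp d × Sp d => chainTerm a G (n + 1) q.1 q.2.1 q.2.2 v)
      (𝓝[Set.Ioc 0 T ×ˢ Set.univ] q₀) (𝓝 (chainTerm a G (n + 1) q₀.1 q₀.2.1 q₀.2.2 v)) := by
  have ha0' : ∀ t ≤ 0, ∀ x y, a t x y = 0 := fun t ht => ha0 t fun h => ht.not_gt h.1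
  have hfst : Tendsto (fun q : ℝ × Sp d × Sp d => q.1) (𝓝[Set.Ioc 0 T ×ˢ Set.univ] q₀) (𝓝 q₀.1) :=
    (continuous_fst.tendsto q₀).mono_left inf_le_left
  have hself : ∀ᶠ q in 𝓝[Set.Ioc 0 T ×ˢ (Set.univ : Set (Sp d × Sp d))] q₀, q.1 ∈ Set.Ioc 0 T :=
    eventually_mem_nhdsWithin.mono fun q hq => hq.1
  rcases lt_or_gt_of_ne hv with hlt | hgt
  -- A nonpositive last time annihilates the term; a positive one keeps the last gap below T, where
  -- G is known to be continuous.
  · by_cases he : (v (Fin.last n)).1 ≤ 0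
    · have hz : ∀ t x y, chainTerm a G (n + 1) t x y v = 0 := fun t x y =>
        chainTerm_eq_zero_of_time ha0' hG0 (i := Fin.last n) fun h => he.not_gt h.1
      simp only [hz]
      exact tendsto_const_nhds
    unfold chainTerm
    simp only [pathEnd_succ]
    refine Tendsto.smul ?_ ?_
    · exact (((continuous_chainWeight ha0 hac v).comp
        (continuous_fst.comp continuous_snd)).tendsto q₀).mono_left inf_le_left
    · have hmem : (q₀.1 - (v (Fin.last n)).1, (v (Fin.last n)).2, q₀.2.2)
          ∈ Set.Ioc 0 T ×ˢ (Set.univ : Set (Sp d × Sp d)) :=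
        ⟨⟨by simpa using hlt, by have := hq₀.1.2; simp only; linarith⟩, Set.mem_univ _⟩
      refine (hGc _ hmem).tendsto.comp (f := fun q : ℝ × Sp d × Sp d =>
        (q.1 - (v (Fin.last n)).1, (v (Fin.last n)).2, q.2.2)) ?_
      refine tendsto_nhdsWithin_iff.2 ⟨?_, ?_⟩
      · exact ((by fun_prop : Continuous fun q : ℝ × Sp d × Sp d =>
          (q.1 - (v (Fin.last n)).1, (v (Fin.last n)).2, q.2.2)).tendsto q₀).mono_left inf_le_left
      · filter_upwards [hself, hfst.eventually (lt_mem_nhds hlt)] with q hq hq'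
        exact ⟨⟨by simpa using hq', by have := hq.2; simp only; linarith⟩, Set.mem_univ _⟩
  · have hz : ∀ t < (v (Fin.last n)).1, ∀ x y, chainTerm a G (n + 1) t x y v = 0 := fun t ht x y =>
      chainTerm_eq_zero_of_time ha0' hG0 (i := Fin.last n) fun h => ht.not_gt h.2
    rw [hz _ hgt]
    refine tendsto_const_nhds.congr' ?_
    filter_upwards [hfst.eventually (gt_mem_nhds hgt)] with q hq
    exact (hz _ hq _ _).symm

lemma eventually_mem_near {q₀ : ℝ × Sp d × Sp d}
    (hq₀ : q₀ ∈ Set.Ioc 0 T ×ˢ (Set.univ : Set (Sp d × Sp d))) (hr : 0 < r) :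
    ∀ᶠ q in 𝓝[Set.Ioc 0 T ×ˢ (Set.univ : Set (Sp d × Sp d))] q₀,
      q.1 ∈ Set.Icc (q₀.1 / 2) T ∧ q.2.1 ∈ Metric.ball q₀.2.1 r ∧ q.2.2 ∈ Metric.ball q₀.2.2 r := by
  have h0 : 0 < q₀.1 := hq₀.1.1
  have h1 : ∀ᶠ q : ℝ × Sp d × Sp d in 𝓝 q₀, q₀.1 / 2 < q.1 :=
    (continuous_fst.tendsto q₀).eventually (lt_mem_nhds (by linarith))
  have h2 : ∀ᶠ q : ℝ × Sp d × Sp d in 𝓝 q₀, q.2.1 ∈ Metric.ball q₀.2.1 r :=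
    ((continuous_fst.comp continuous_snd).tendsto q₀).eventually (Metric.ball_mem_nhds _ hr)
  have h3 : ∀ᶠ q : ℝ × Sp d × Sp d in 𝓝 q₀, q.2.2 ∈ Metric.ball q₀.2.2 r :=
    ((continuous_snd.comp continuous_snd).tendsto q₀).eventually (Metric.ball_mem_nhds _ hr)
  filter_upwards [eventually_mem_nhdsWithin, mem_nhdsWithin_of_mem_nhds h1,
    mem_nhdsWithin_of_mem_nhds h2, mem_nhdsWithin_of_mem_nhds h3] with q ha hb hc hd
  exact ⟨⟨le_of_lt hb, ha.1.2⟩, hc, hd⟩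

/-- The integrands converge for almost every chain, and the bounds on `chainBox` are uniform near
the limit point, so the convergence theorem of Vitali type applies. -/
lemma ChainBounds.continuousOn_chainInt [CompleteSpace F] (hb : ChainBounds T r ζ Ξ a G)
    (hr : 0 < r) (hζ : 1 < ζ)
    (hΞ : ∀ t₀ > (0 : ℝ), ∃ M : ℝ≥0∞, M ≠ ∞ ∧ ∀ t ∈ Set.Icc t₀ T, Ξ t ≤ M)
    (ham : Measurable fun q : ℝ × Sp d × Sp d => a q.1 q.2.1 q.2.2)
    (hGm : Measurable fun q : ℝ × Sp d × Sp d => G q.1 q.2.1 q.2.2)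
    (ha0 : ∀ t, t ∉ Set.Ioc 0 T → ∀ x y, a t x y = 0)
    (hac : ContinuousOn (fun q : ℝ × Sp d × Sp d => a q.1 q.2.1 q.2.2) (Set.Ioc 0 T ×ˢ Set.univ))
    (hG0 : ∀ t ≤ 0, ∀ x y, G t x y = 0)
    (hGc : ContinuousOn (fun q : ℝ × Sp d × Sp d => G q.1 q.2.1 q.2.2) (Set.Ioc 0 T ×ˢ Set.univ))
    (n : ℕ) :
    ContinuousOn (fun q : ℝ × Sp d × Sp d => chainInt a G n q.1 q.2.1 q.2.2)
      (Set.Ioc 0 T ×ˢ Set.univ) := by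
  have ha0' : ∀ t ≤ 0, ∀ x y, a t x y = 0 := fun t ht => ha0 t fun h => ht.not_gt h.1
  cases n with
  | zero => simpa only [chainInt_zero] using hGc
  | succ n =>
    intro q₀ hq₀
    have hnear := eventually_mem_near (d := d) hq₀ hr
    refine tendsto_integral_of_tight_of_rpow_bounded hζ ?_ ?_ ?_ ?_ ?_ ?_
    · filter_upwards [eventually_mem_nhdsWithin] with q hq
      exact hb.integrable hr hΞ ham hGm _ hq.1 _ _
    · exact .of_forall fun q => measurable_chainTerm_apply ham hGm _ _ _ _
    · exact hb.integrable hr hΞ ham hGm _ hq₀.1 _ _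
    · exact measurable_chainTerm_apply ham hGm _ _ _ _
    · filter_upwards [ae_fst_ne (n + 1) (Fin.last n) q₀.1] with v hv
      exact tendsto_chainTerm ha0 hac hG0 hGc hq₀ hv
    · intro ε hε
      obtain ⟨S, hS, hSv, M, hM, hall⟩ := hb.exists_chainBox hΞ ha0' hG0 (n := n + 1) (by omega)
        (half_pos hq₀.1.1) q₀.2.1 q₀.2.2 hε
      have h0 := hall q₀.1 ⟨by linarith [hq₀.1.1], hq₀.1.2⟩ _ (Metric.mem_ball_self hr) _
        (Metric.mem_ball_self hr)
      exact ⟨S, hS, hSv, hnear.mono fun q hq => (hall _ hq.1 _ hq.2.1 _ hq.2.2).1, h0.1, M, hM,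
        hnear.mono fun q hq => (hall _ hq.1 _ hq.2.1 _ hq.2.2).2, h0.2⟩

/-- The terms with n ≥ 1 have a summable bound near each point; the zeroth term has no such bound
and is treated apart. -/
lemma ChainBounds.continuousOn_tsum [CompleteSpace F] (hb : ChainBounds T r ζ Ξ a G)
    (hr : 0 < r) (hζ : 1 < ζ)
    (hΞ : ∀ t₀ > (0 : ℝ), ∃ M : ℝ≥0∞, M ≠ ∞ ∧ ∀ t ∈ Set.Icc t₀ T, Ξ t ≤ M)
    (ham : Measurable fun q : ℝ × Sp d × Sp d => a q.1 q.2.1 q.2.2)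
    (hGm : Measurable fun q : ℝ × Sp d × Sp d => G q.1 q.2.1 q.2.2)
    (ha0 : ∀ t, t ∉ Set.Ioc 0 T → ∀ x y, a t x y = 0)
    (hac : ContinuousOn (fun q : ℝ × Sp d × Sp d => a q.1 q.2.1 q.2.2) (Set.Ioc 0 T ×ˢ Set.univ))
    (hG0 : ∀ t ≤ 0, ∀ x y, G t x y = 0)
    (hGc : ContinuousOn (fun q : ℝ × Sp d × Sp d => G q.1 q.2.1 q.2.2)
      (Set.Ioc 0 T ×ˢ Set.univ)) :
    ContinuousOn (fun q : ℝ × Sp d × Sp d => ∑' n, chainInt a G n q.1 q.2.1 q.2.2)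
      (Set.Ioc 0 T ×ˢ Set.univ) := by
  have hc := hb.continuousOn_chainInt hr hζ hΞ ham hGm ha0 hac hG0 hGc
  intro q₀ hq₀
  obtain ⟨M, hM⟩ := hb.exists_geometric hΞ (half_pos hq₀.1.1) q₀.2.1 q₀.2.2
  have hsplit : ∀ q ∈ Set.Ioc 0 T ×ˢ (Set.univ : Set (Sp d × Sp d)),
      ∑' n, chainInt a G n q.1 q.2.1 q.2.2 = chainInt a G 0 q.1 q.2.1 q.2.2 +
        ∑' n, chainInt a G (n + 1) q.1 q.2.1 q.2.2 := fun q hq =>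
    (hb.summable hr hΞ hq.1 _ _).tsum_eq_zero_add
  refine ContinuousWithinAt.congr ?_ hsplit (hsplit _ hq₀)
  refine (hc 0 q₀ hq₀).add ?_
  refine tendsto_tsum_of_dominated_convergence
    ((summable_nat_add_iff 1).2 (summable_mul_two_inv_pow M)) (fun n => hc (n + 1) q₀ hq₀) ?_
  filter_upwards [eventually_mem_near (d := d) hq₀ hr] with q hq n
  exact norm_chainInt_le (hM (n + 1) (by omega) _ hq.1 _ hq.2.1 _ hq.2.2)

end

end

section

/-! ### Test functions and measures -/

section TestFunctions

variable {d : ℕ}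

/-- A smooth step function applied to n g, where g ≥ 0 is smooth and nonzero exactly on U, times
bumps equal to one on growing balls. -/
lemma exists_isTest_tendsto_indicator {U : Set (Sp d)} (hU : IsOpen U) :
    ∃ f : ℕ → Sp d → ℝ, (∀ n, IsTest (f n)) ∧ (∀ n x, 0 ≤ f n x ∧ f n x ≤ 1) ∧
      ∀ x, Tendsto (fun n => f n x) atTop (𝓝 (U.indicator 1 x)) := by
  obtain ⟨g, hgU, hg, hg01⟩ := hU.exists_contDiff_support_eq (n := ⊤)
  have hgr : ∀ x, g x ∈ Set.Icc (0:ℝ) 1 := fun x => hg01 ⟨x, rfl⟩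
  let χ : ∀ n : ℕ, ContDiffBump (0 : Sp d) := fun n => ⟨n + 1, n + 2, by positivity, by linarith⟩
  refine ⟨fun n x => Real.smoothTransition (n * g x) * χ n x, fun n => ⟨?_, ?_⟩, fun n x => ?_,
    fun x => ?_⟩
  · exact (Real.smoothTransition.contDiff.comp (contDiff_const.mul hg)).mul (χ n).contDiff
  · exact (χ n).hasCompactSupport.mul_left
  · have h1 := Real.smoothTransition.nonneg (n * g x)
    have h2 := Real.smoothTransition.le_one (n * g x)
    have h3 := (χ n).nonneg (x := x)
    have h4 := (χ n).le_one (x := x)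
    exact ⟨mul_nonneg h1 h3, mul_le_one₀ h2 h3 h4⟩
  · by_cases hx : x ∈ U
    · have hgx : 0 < g x := lt_of_le_of_ne (hgr x).1 (Ne.symm (by rw [← hgU] at hx; exact hx))
      rw [Set.indicator_of_mem hx]
      refine tendsto_const_nhds.congr' ?_
      obtain ⟨N, hN⟩ := exists_nat_gt (1 / g x)
      obtain ⟨N', hN'⟩ := exists_nat_gt ‖x‖
      filter_upwards [eventually_ge_atTop (max N N')] with n hn
      have hn1 : (N : ℝ) ≤ n := by exact_mod_cast (le_max_left _ _).trans hn
      have hn2 : (N' : ℝ) ≤ n := by exact_mod_cast (le_max_right _ _).trans hn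
      rw [Real.smoothTransition.one_of_one_le, (χ n).one_of_mem_closedBall]
      · simp
      · simp only [mem_closedBall_zero_iff]
        change ‖x‖ ≤ n + 1
        linarith
      · rw [← div_le_iff₀ hgx]; linarith
    · have hgx : g x = 0 := by rw [← hgU] at hx; simpa using hx
      simp [hgx, Set.indicator_of_notMem hx]

lemma IsTest.measurable {f : Sp d → ℝ} (hf : IsTest f) : Measurable f := hf.1.continuous.measurable

lemma IsTest.exists_bound {f : Sp d → ℝ} (hf : IsTest f) : ∃ C : ℝ, ∀ x, |f x| ≤ C := by
  obtain ⟨C, hC⟩ := hf.1.continuous.bounded_above_of_compact_support hf.2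
  exact ⟨C, hC⟩

lemma tendsto_integral_isTest {U : Set (Sp d)} (hU : IsOpen U) {f : ℕ → Sp d → ℝ}
    (hf : ∀ n, IsTest (f n)) (hf01 : ∀ n x, 0 ≤ f n x ∧ f n x ≤ 1)
    (hlim : ∀ x, Tendsto (fun n => f n x) atTop (𝓝 (U.indicator 1 x)))
    (μ : Measure (Sp d)) [IsFiniteMeasure μ] :
    Tendsto (fun n => ∫ x, f n x ∂μ) atTop (𝓝 (μ.real U)) := by
  rw [← integral_indicator_one hU.measurableSet]
  refine tendsto_integral_of_dominated_convergence (fun _ => 1)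
    (fun n => (hf n).measurable.aestronglyMeasurable) (integrable_const _)
    (fun n => .of_forall fun x => ?_) (.of_forall hlim)
  rw [Real.norm_eq_abs, abs_of_nonneg (hf01 n x).1]
  exact (hf01 n x).2

/-- A finite measure is determined by its integrals of test functions. -/
lemma measure_ext_of_isTest {μ ν : Measure (Sp d)} [IsFiniteMeasure μ] [IsFiniteMeasure ν]
    (h : ∀ f : Sp d → ℝ, IsTest f → ∫ x, f x ∂μ = ∫ x, f x ∂ν) : μ = ν := by
  have hopen : ∀ U : Set (Sp d), IsOpen U → μ U = ν U := fun U hU => by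
    obtain ⟨f, hf, hf01, hlim⟩ := exists_isTest_tendsto_indicator hU
    have h1 := tendsto_integral_isTest hU hf hf01 hlim μ
    have h2 := tendsto_integral_isTest hU hf hf01 hlim ν
    simp_rw [h _ (hf _)] at h1
    have := tendsto_nhds_unique h1 h2
    exact (measureReal_eq_measureReal_iff).1 this
  exact ext_of_generate_finite _ BorelSpace.measurable_eq isPiSystem_isOpen hopen
    (hopen _ isOpen_univ)

end TestFunctions

/-! ### The main semigroup -/

section Semigroup

variable {d : ℕ} {T : ℝ} {P : ℝ → Kernel (Sp d) (Sp d)}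

/-- Contraction is assumed for test functions only; test functions with values in [0, 1] that
converge to 1 carry it over to the total mass, and hence to all bounded Borel functions. -/
lemma IsMainSemigroup.measure_univ_le_one (hP : IsMainSemigroup T P) {t : ℝ}
    (ht : t ∈ Set.Icc 0 T) (x : Sp d) : P t x Set.univ ≤ 1 := by
  have : IsFiniteMeasure (P t x) := ⟨hP.finite t ht.1 x⟩
  obtain ⟨f, hf, hf01, hlim⟩ := exists_isTest_tendsto_indicator (d := d) isOpen_univ
  have h1 := tendsto_integral_isTest isOpen_univ hf hf01 hlim (P t x)
  have h2 : (P t x).real Set.univ ≤ 1 := by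
    refine le_of_tendsto h1 (.of_forall fun n => ?_)
    refine (le_abs_self _).trans (hP.contraction (f n) (hf n) 1 (fun y => ?_) t ht x)
    rw [abs_of_nonneg (hf01 n y).1]
    exact (hf01 n y).2
  rw [← ENNReal.ofReal_one, ← ofReal_measureReal]
  exact ENNReal.ofReal_le_ofReal h2

lemma IsMainSemigroup.isFiniteKernel (hP : IsMainSemigroup T P) {t : ℝ} (ht : t ∈ Set.Icc 0 T) :
    IsFiniteKernel (P t) := ⟨1, ENNReal.one_lt_top, hP.measure_univ_le_one ht⟩

lemma BddMeas.integrable {f : Sp d → ℝ} (hf : BddMeas f) (μ : Measure (Sp d)) [IsFiniteMeasure μ] :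
    Integrable f μ := by
  obtain ⟨C, hC⟩ := hf.2
  exact Integrable.of_bound hf.1.aestronglyMeasurable C (.of_forall hC)

lemma IsMainSemigroup.abs_kernelOp_le (hP : IsMainSemigroup T P) {t : ℝ} (ht : t ∈ Set.Icc 0 T)
    {f : Sp d → ℝ} {C : ℝ} (hC0 : 0 ≤ C) (hC : ∀ y, |f y| ≤ C) (x : Sp d) :
    |kernelOp P t f x| ≤ C := by
  have : IsFiniteMeasure (P t x) := ⟨hP.finite t ht.1 x⟩
  have h1 := norm_integral_le_of_norm_le_const (μ := P t x) (f := f) (.of_forall hC)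
  have h2 : (P t x).real Set.univ ≤ 1 := by
    have := ENNReal.toReal_mono ENNReal.one_ne_top (hP.measure_univ_le_one ht x)
    simpa [Measure.real] using this
  calc _ ≤ C * (P t x).real Set.univ := h1
    _ ≤ C * 1 := by gcongr
    _ = C := mul_one C

lemma IsMainSemigroup.bddMeas_kernelOp (hP : IsMainSemigroup T P) {t : ℝ} (ht : t ∈ Set.Icc 0 T)
    {f : Sp d → ℝ} (hf : BddMeas f) : BddMeas (kernelOp P t f) := by
  have := hP.isFiniteKernel ht
  refine ⟨?_, ?_⟩
  · unfold kernelOp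
    exact (hf.1.stronglyMeasurable.integral_kernel).measurable
  · obtain ⟨C, hC⟩ := hf.2
    exact ⟨C, hP.abs_kernelOp_le ht ((abs_nonneg _).trans (hC 0)) hC⟩

lemma IsMainSemigroup.kernelOp_add (hP : IsMainSemigroup T P) {s t : ℝ} (hs : s ∈ Set.Icc 0 T)
    (ht : t ∈ Set.Icc 0 T) {f : Sp d → ℝ} (hf : BddMeas f) (x : Sp d) :
    kernelOp P (s + t) f x = kernelOp P s (kernelOp P t f) x := by
  have := hP.isFiniteKernel hs
  have := hP.isFiniteKernel ht
  unfold kernelOp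
  rw [hP.add s t hs.1 ht.1]
  exact Kernel.integral_comp (hf.integrable _)

lemma IsMainSemigroup.kernelOp_zero (hP : IsMainSemigroup T P) {f : Sp d → ℝ} (hf : Measurable f)
    (x : Sp d) : kernelOp P 0 f x = f x := by
  unfold kernelOp
  rw [hP.zero, Kernel.id_apply, integral_dirac' _ _ hf.stronglyMeasurable]

lemma kernelOp_sub {t : ℝ} {f g : Sp d → ℝ} (hf : BddMeas f) (hg : BddMeas g) {x : Sp d}
    (hP : IsFiniteMeasure (P t x)) :
    kernelOp P t (fun y => f y - g y) x = kernelOp P t f x - kernelOp P t g x :=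
  integral_sub (hf.integrable _) (hg.integrable _)

lemma BddMeas.sub {f g : Sp d → ℝ} (hf : BddMeas f) (hg : BddMeas g) :
    BddMeas fun x => f x - g x := by
  obtain ⟨C, hC⟩ := hf.2
  obtain ⟨D, hD⟩ := hg.2
  exact ⟨hf.1.sub hg.1, C + D, fun x => (abs_sub _ _).trans (add_le_add (hC x) (hD x))⟩

lemma BddMeas.const_mul {f : Sp d → ℝ} (hf : BddMeas f) (c : ℝ) : BddMeas fun x => c * f x := by
  obtain ⟨C, hC⟩ := hf.2
  refine ⟨hf.1.const_mul c, |c| * C, fun x => ?_⟩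
  rw [abs_mul]
  exact mul_le_mul_of_nonneg_left (hC x) (abs_nonneg c)

lemma IsTest.bddMeas {f : Sp d → ℝ} (hf : IsTest f) : BddMeas f := ⟨hf.measurable, hf.exists_bound⟩

/-- Uniform approximation by bounded measurable functions. -/
lemma BddMeas.of_tendstoUniformly {Q : ℝ → Sp d → ℝ} {g : Sp d → ℝ}
    (hQ : ∀ᶠ t in 𝓝[>] (0:ℝ), BddMeas (Q t)) (h : TendstoUniformly Q g (𝓝[>] (0:ℝ))) :
    BddMeas g := by
  refine ⟨?_, ?_⟩
  · obtain ⟨u, hu⟩ := (𝓝[>] (0:ℝ)).exists_seq_tendsto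
    have hu' : ∀ᶠ n in atTop, BddMeas (Q (u n)) := hu.eventually hQ
    obtain ⟨N, hN⟩ := eventually_atTop.1 hu'
    refine measurable_of_tendsto_metrizable (f := fun n => Q (u (n + N)))
      (fun n => (hN _ (by omega)).1) (tendsto_pi_nhds.2 fun x => ?_)
    exact (h.tendsto_at x).comp (hu.comp (tendsto_add_atTop_nat N))
  · obtain ⟨t, ht, ht'⟩ := (hQ.and (Metric.tendstoUniformly_iff.1 h 1 one_pos)).exists
    obtain ⟨C, hC⟩ := ht.2
    refine ⟨C + 1, fun x => ?_⟩
    have h1 := ht' x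
    rw [Real.dist_eq] at h1
    have h2 := hC x
    have h3 := abs_sub_abs_le_abs_sub (g x) (Q t x)
    linarith

/-- Strong continuity of a family of operators at a function. -/
def StrongAt (Q : ℝ → (Sp d → ℝ) → Sp d → ℝ) (f : Sp d → ℝ) : Prop :=
  ∀ ε > (0:ℝ), ∃ δ > (0:ℝ), ∀ h, 0 < h → h < δ → ∀ x, |Q h f x - f x| ≤ ε

lemma eventually_nhdsGT_zero {p : ℝ → Prop} (h : ∀ᶠ t in 𝓝[>] (0:ℝ), p t) :
    ∃ δ > (0:ℝ), ∀ t, 0 < t → t < δ → p t := by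
  obtain ⟨δ, hδ, hd⟩ := Metric.mem_nhdsWithin_iff.1 h
  refine ⟨δ, hδ, fun t h0 h1 => hd ⟨?_, h0⟩⟩
  simp [abs_of_pos h0, h1]

/-- On the domain, Q_h f - f is h times a function bounded uniformly for small h. -/
lemma InDomain.strongAt {Q : ℝ → (Sp d → ℝ) → Sp d → ℝ} {f : Sp d → ℝ}
    (hQ : ∀ᶠ t in 𝓝[>] (0:ℝ), BddMeas (Q t f)) (hf : InDomain Q f) : StrongAt Q f := by
  have hB : BddMeas (generator Q f) := by
    refine BddMeas.of_tendstoUniformly ?_ hf.2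
    filter_upwards [hQ] with t ht
    simpa only [div_eq_inv_mul] using (ht.sub hf.1).const_mul t⁻¹
  obtain ⟨C, hC⟩ := hB.2
  have hC0 : 0 ≤ C := (abs_nonneg _).trans (hC 0)
  intro ε hε
  obtain ⟨δ, hδ, hd⟩ := eventually_nhdsGT_zero (Metric.tendstoUniformly_iff.1 hf.2 1 one_pos)
  refine ⟨min δ (ε / (C + 1)), lt_min hδ (by positivity), fun h h0 h1 x => ?_⟩
  have h2 := hd h h0 (h1.trans_le (min_le_left _ _)) x
  rw [Real.dist_eq] at h2
  have h3 : |(Q h f x - f x) / h| ≤ C + 1 := by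
    have h4 := abs_sub_abs_le_abs_sub ((Q h f x - f x) / h) (generator Q f x)
    rw [abs_sub_comm] at h2
    have := hC x
    linarith
  rw [abs_div, abs_of_pos h0, div_le_iff₀ h0] at h3
  have h5 := h1.le.trans (min_le_right _ _)
  rw [le_div_iff₀ (by positivity)] at h5
  linarith

/-- The transition measures of the main semigroup from `x`, as a kernel in time. -/
def timeKernel (hP : IsMainSemigroup T P) (x : Sp d) : Kernel ℝ (Sp d) where
  toFun s := open Classical in if s ∈ Set.Icc 0 T then P s x else 0
  measurable' := by
    classical
    have : ∀ s : ℝ, IsFiniteMeasure (if s ∈ Set.Icc 0 T then P s x else 0) := fun s => by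
      split_ifs with h
      · exact ⟨hP.finite s h.1 x⟩
      · infer_instance
    -- Measurability in time is given for test functions. It passes to open sets by approximation,
    -- and from this π-system to all Borel sets.
    have hopen : ∀ U : Set (Sp d), IsOpen U →
        Measurable fun s : ℝ => (if s ∈ Set.Icc 0 T then P s x else 0) U := fun U hU => by
      obtain ⟨f, hf, hf01, hlim⟩ := exists_isTest_tendsto_indicator hU
      have hm : ∀ n, Measurable fun s : ℝ =>
          if s ∈ Set.Icc 0 T then ENNReal.ofReal (kernelOp P s (f n) x) else 0 := fun n => by
        have h1 : Measurable fun s : ℝ => kernelOp P (s.toNNReal : ℝ) (f n) x :=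
          (hP.meas (f n) (hf n)).comp
            (f := fun s : ℝ => (s.toNNReal, x)) (by fun_prop)
        have h2 : Measurable fun s : ℝ =>
            if s ∈ Set.Icc 0 T then ENNReal.ofReal (kernelOp P (s.toNNReal : ℝ) (f n) x) else 0 :=
          Measurable.ite measurableSet_Icc h1.ennreal_ofReal measurable_const
        convert h2 using 3 with s h
        rw [Real.coe_toNNReal _ h.1]
      refine measurable_of_tendsto_metrizable hm (tendsto_pi_nhds.2 fun s => ?_)
      split_ifs with h
      · have : IsFiniteMeasure (P s x) := ⟨hP.finite s h.1 x⟩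
        rw [← ofReal_measureReal]
        exact ENNReal.tendsto_ofReal (tendsto_integral_isTest hU hf hf01 hlim (P s x))
      · simp
    exact Measurable.measure_of_isPiSystem BorelSpace.measurable_eq isPiSystem_isOpen hopen
      (hopen _ isOpen_univ)

lemma timeKernel_apply (hP : IsMainSemigroup T P) {s : ℝ} (hs : s ∈ Set.Icc 0 T) (x : Sp d) :
    timeKernel hP x s = P s x := if_pos hs

lemma timeKernel_univ_le (hP : IsMainSemigroup T P) (s : ℝ) (x : Sp d) :
    timeKernel hP x s Set.univ ≤ 1 := by
  by_cases hs : s ∈ Set.Icc 0 T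
  · rw [timeKernel_apply hP hs]; exact hP.measure_univ_le_one hs x
  · change (open Classical in if s ∈ Set.Icc 0 T then P s x else 0) Set.univ ≤ 1
    rw [if_neg hs]; simp

instance (hP : IsMainSemigroup T P) (x : Sp d) : IsFiniteKernel (timeKernel hP x) :=
  ⟨1, ENNReal.one_lt_top, fun s => timeKernel_univ_le hP s x⟩

/-- Comparison of two evolutions: the right derivative of `u ↦ P_{τ-u} φ_u`. -/
lemma IsMainSemigroup.hasDerivWithinAt_kernelOp (hP : IsMainSemigroup T P) {φ : ℝ → Sp d → ℝ}
    {g : Sp d → ℝ} {u τ : ℝ} (hu : 0 < u) (hτ : τ ≤ T) (huτ : u < τ)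
    (hφ : ∀ u ∈ Set.Ioc 0 T, InDomain (kernelOp P) (φ u))
    (hg : TendstoUniformly (fun h y => (φ (u + h) y - φ u y) / h) g (𝓝[>] (0:ℝ))) (x : Sp d) :
    HasDerivWithinAt (fun u => kernelOp P (τ - u) (φ u) x)
      (-(kernelOp P (τ - u) (fun y => generator (kernelOp P) (φ u) y - g y) x)) (Set.Ioi u) u := by
  have hT : 0 < T := by linarith
  have huT : u ∈ Set.Ioc 0 T := ⟨hu, by linarith⟩
  have hφm : ∀ v ∈ Set.Ioc 0 T, BddMeas (φ v) := fun v hv => (hφ v hv).1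
  have hPev : ∀ v ∈ Set.Ioc 0 T, ∀ᶠ t in 𝓝[>] (0:ℝ), BddMeas (kernelOp P t (φ v)) := fun v hv => by
    have : Set.Ioo 0 T ∈ 𝓝[>] (0:ℝ) := Ioo_mem_nhdsGT hT
    filter_upwards [this] with t ht
    exact hP.bddMeas_kernelOp ⟨ht.1.le, ht.2.le⟩ (hφm v hv)
  have hstrong : ∀ v ∈ Set.Ioc 0 T, StrongAt (kernelOp P) (φ v) := fun v hv =>
    (hφ v hv).strongAt (hPev v hv)
  set ψ : Sp d → ℝ := fun y => generator (kernelOp P) (φ u) y - g y with hψ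
  have hψB : BddMeas ψ := by
    refine BddMeas.sub (BddMeas.of_tendstoUniformly ?_ (hφ u huT).2)
      (BddMeas.of_tendstoUniformly ?_ hg)
    · filter_upwards [hPev u huT] with t ht
      simpa only [div_eq_inv_mul] using (ht.sub (hφm u huT)).const_mul t⁻¹
    · filter_upwards [Ioo_mem_nhdsGT (show (0:ℝ) < T - u by linarith)] with t ht
      simpa only [div_eq_inv_mul] using
        ((hφm (u + t) ⟨by linarith [ht.1], by linarith [ht.2]⟩).sub (hφm u huT)).const_mul t⁻¹
  -- Subtracting the two uniform limits: (P_h φ_u - φ_{u+h}) / h tends to ψ uniformly.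
  have hunif : ∀ ε > (0:ℝ), ∃ δ > (0:ℝ), ∀ h, 0 < h → h < δ → ∀ y,
      |(kernelOp P h (φ u) y - φ (u + h) y) / h - ψ y| ≤ ε := by
    intro ε hε
    obtain ⟨δ₁, hδ₁, h1⟩ := eventually_nhdsGT_zero
      (Metric.tendstoUniformly_iff.1 (hφ u huT).2 (ε / 2) (by positivity))
    obtain ⟨δ₂, hδ₂, h2⟩ := eventually_nhdsGT_zero
      (Metric.tendstoUniformly_iff.1 hg (ε / 2) (by positivity))
    refine ⟨min δ₁ δ₂, lt_min hδ₁ hδ₂, fun h h0 hlt y => ?_⟩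
    have e1 := h1 h h0 (hlt.trans_le (min_le_left _ _)) y
    have e2 := h2 h h0 (hlt.trans_le (min_le_right _ _)) y
    rw [Real.dist_eq, abs_lt] at e1 e2
    have e3 : (kernelOp P h (φ u) y - φ (u + h) y) / h
        = (kernelOp P h (φ u) y - φ u y) / h - (φ (u + h) y - φ u y) / h := by ring
    rw [e3, hψ, abs_le]
    constructor <;> simp only <;> linarith [e1.1, e1.2, e2.1, e2.2]
  -- It is not known that ψ lies in the domain. Strong continuity is inherited from a difference
  -- quotient D uniformly close to ψ: φ_u and φ_{u+k} are in the domain, and P_h commutes with P_k.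
  have hψS : StrongAt (kernelOp P) ψ := by
    intro ε hε
    obtain ⟨δ, hδ, hd⟩ := hunif (ε / 4) (by positivity)
    obtain ⟨k, hk0, hkδ, hku⟩ : ∃ k, 0 < k ∧ k < δ ∧ u + k < T := by
      refine ⟨min (δ / 2) ((T - u) / 2), by
        refine lt_min (by positivity) (by linarith), ?_, ?_⟩
      · exact (min_le_left _ _).trans_lt (by linarith)
      · have := min_le_right (δ / 2) ((T - u) / 2)
        linarith
    have hkT : k ∈ Set.Icc 0 T := ⟨hk0.le, by linarith⟩
    have hukT : u + k ∈ Set.Ioc 0 T := ⟨by linarith, hku.le⟩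
    have hD := hd k hk0 hkδ
    set D : Sp d → ℝ := fun y => (kernelOp P k (φ u) y - φ (u + k) y) / k with hDdef
    have hDB : BddMeas D := by
      simpa only [hDdef, div_eq_inv_mul] using
        ((hP.bddMeas_kernelOp hkT (hφm u huT)).sub (hφm _ hukT)).const_mul k⁻¹
    obtain ⟨δ₁, hδ₁, h1⟩ := hstrong u huT (ε / 4 * k) (by positivity)
    obtain ⟨δ₂, hδ₂, h2⟩ := hstrong _ hukT (ε / 4 * k) (by positivity)
    refine ⟨min T (min δ₁ δ₂), lt_min hT (lt_min hδ₁ hδ₂), fun h h0 hlt y => ?_⟩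
    have hhT : h ∈ Set.Icc 0 T := ⟨h0.le, (hlt.trans_le (min_le_left _ _)).le⟩
    have hlt' := hlt.trans_le (min_le_right _ _)
    have hfin : ∀ y, IsFiniteMeasure (P h y) := fun y => ⟨hP.finite h h0.le y⟩
    have hPφ := hP.bddMeas_kernelOp hkT (hφm u huT)
    -- compare `ψ` with the difference quotient `D`
    have e1 : |kernelOp P h ψ y - kernelOp P h D y| ≤ ε / 4 := by
      rw [← kernelOp_sub hψB hDB (hfin y)]
      refine hP.abs_kernelOp_le hhT (by positivity) (fun z => ?_) y
      rw [abs_sub_comm]; exact hD z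
    have e2 : kernelOp P h D y - D y
        = (kernelOp P k (fun z => kernelOp P h (φ u) z - φ u z) y -
            (kernelOp P h (φ (u + k)) y - φ (u + k) y)) / k := by
      have : kernelOp P h D y = (kernelOp P h (kernelOp P k (φ u)) y
          - kernelOp P h (φ (u + k)) y) / k := by
        rw [← kernelOp_sub hPφ (hφm _ hukT) (hfin y)]
        exact integral_div _ _
      rw [this, kernelOp_sub (hP.bddMeas_kernelOp hhT (hφm u huT)) (hφm u huT)
        ⟨hP.finite k hk0.le y⟩, ← hP.kernelOp_add hkT hhT (hφm u huT), add_comm k h,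
        hP.kernelOp_add hhT hkT (hφm u huT), hDdef]
      ring
    have e3 : |kernelOp P h D y - D y| ≤ ε / 2 := by
      rw [e2, abs_div, abs_of_pos hk0, div_le_iff₀ hk0]
      have f1 := hP.abs_kernelOp_le hkT (by positivity)
        (h1 h h0 (hlt'.trans_le (min_le_left _ _))) y
      have f2 := h2 h h0 (hlt'.trans_le (min_le_right _ _)) y
      refine (abs_sub _ _).trans ?_
      linarith
    have e4 := hD y
    have e1' := abs_le.1 e1
    have e3' := abs_le.1 e3
    have e4' := abs_le.1 e4
    rw [abs_le]
    constructor <;> linarith [e1'.1, e1'.2, e3'.1, e3'.2, e4'.1, e4'.2]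
  rw [hasDerivWithinAt_iff_tendsto_slope' (by simp), Metric.tendsto_nhdsWithin_nhds]
  intro ε hε
  obtain ⟨δ₁, hδ₁, h1⟩ := hunif (ε / 4) (by positivity)
  obtain ⟨δ₂, hδ₂, h2⟩ := hψS (ε / 4) (by positivity)
  refine ⟨min (τ - u) (min δ₁ δ₂), lt_min (by linarith) (lt_min hδ₁ hδ₂), fun v hv hvd => ?_⟩
  have hv' : u < v := hv
  obtain ⟨h, rfl⟩ : ∃ h, v = u + h := ⟨v - u, by ring⟩
  have h0 : 0 < h := by linarith
  rw [Real.dist_eq, add_sub_cancel_left, abs_of_pos h0] at hvd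
  have hhτ := hvd.trans_le (min_le_left _ _)
  have hh1 := hvd.trans_le ((min_le_right _ _).trans (min_le_left _ _))
  have hh2 := hvd.trans_le ((min_le_right _ _).trans (min_le_right _ _))
  have hhT : h ∈ Set.Icc 0 T := ⟨h0.le, by linarith⟩
  have hsT : τ - (u + h) ∈ Set.Icc 0 T := ⟨by linarith, by linarith⟩
  have huhT : u + h ∈ Set.Ioc 0 T := ⟨by linarith, by linarith⟩
  have hfin : IsFiniteMeasure (P (τ - (u + h)) x) := ⟨hP.finite _ hsT.1 x⟩
  have hsum : τ - u = (τ - (u + h)) + h := by ring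
  -- The semigroup property takes the contraction P_{τ-u-h} out of the error; under it remains P_h ψ
  -- minus the difference quotient, which is uniformly small.
  have key : slope (fun u => kernelOp P (τ - u) (φ u) x) u (u + h)
      - -(kernelOp P (τ - u) ψ x)
      = kernelOp P (τ - (u + h)) (fun y => kernelOp P h ψ y -
          (kernelOp P h (φ u) y - φ (u + h) y) / h) x := by
    have hB1 : BddMeas fun y => kernelOp P h (φ u) y - φ (u + h) y :=
      (hP.bddMeas_kernelOp hhT (hφm u huT)).sub (hφm _ huhT)
    have hB2 : BddMeas fun y => (kernelOp P h (φ u) y - φ (u + h) y) / h := by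
      simpa only [div_eq_inv_mul] using hB1.const_mul h⁻¹
    rw [kernelOp_sub (hP.bddMeas_kernelOp hhT hψB) hB2 hfin, ← hP.kernelOp_add hsT hhT hψB, ← hsum]
    have : kernelOp P (τ - (u + h)) (fun y => (kernelOp P h (φ u) y - φ (u + h) y) / h) x
        = (kernelOp P (τ - u) (φ u) x - kernelOp P (τ - (u + h)) (φ (u + h)) x) / h := by
      rw [hsum, hP.kernelOp_add hsT hhT (hφm u huT), ← kernelOp_sub
        (hP.bddMeas_kernelOp hhT (hφm u huT)) (hφm _ huhT) hfin]
      exact integral_div _ _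
    rw [this, slope_def_field]
    ring
  rw [Real.dist_eq, key]
  refine (hP.abs_kernelOp_le hsT (C := ε / 2) (by positivity) (fun y => ?_) x).trans_lt
    (by linarith)
  have f1 := abs_le.1 (h1 h h0 hh1 y)
  have f2 := abs_le.1 (h2 h h0 hh2 y)
  rw [abs_le]
  constructor <;> linarith [f1.1, f1.2, f2.1, f2.2]

/-- Strong continuity is quantified at the limit time w only. From the right this is enough; from
the left, φ_u is first replaced by φ_w under the contraction P_h. -/
lemma IsMainSemigroup.continuousOn_kernelOp (hP : IsMainSemigroup T P) {φ : ℝ → Sp d → ℝ}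
    {u₀ τ : ℝ} (hu₀ : 0 < u₀) (hτ : τ ≤ T) (hφ : ∀ u ∈ Set.Ioc 0 T, InDomain (kernelOp P) (φ u))
    (hφc : ∀ ε > (0:ℝ), ∃ δ > (0:ℝ), ∀ u, u₀ ≤ u → ∀ h, 0 < h → h < δ → ∀ y,
      |φ (u + h) y - φ u y| ≤ ε) (x : Sp d) :
    ContinuousOn (fun u => kernelOp P (τ - u) (φ u) x) (Set.Icc u₀ τ) := by
  rcases lt_or_ge τ u₀ with hlt | hle
  · rw [Set.Icc_eq_empty (not_le.2 hlt)]; exact continuousOn_empty _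
  have hT : 0 < T := by linarith
  rw [Metric.continuousOn_iff]
  intro w hw ε hε
  have hwT : w ∈ Set.Ioc 0 T := ⟨by linarith [hw.1], by linarith [hw.2]⟩
  have hφm : ∀ v ∈ Set.Ioc 0 T, BddMeas (φ v) := fun v hv => (hφ v hv).1
  have hstrong : StrongAt (kernelOp P) (φ w) := by
    refine (hφ w hwT).strongAt ?_
    filter_upwards [Ioo_mem_nhdsGT hT] with t ht
    exact hP.bddMeas_kernelOp ⟨ht.1.le, ht.2.le⟩ (hφm w hwT)
  obtain ⟨δ₁, hδ₁, h1⟩ := hstrong (ε / 8) (by positivity)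
  obtain ⟨δ₂, hδ₂, h2⟩ := hφc (ε / 8) (by positivity)
  have main : ∀ u h, u₀ ≤ u → u + h ≤ τ → 0 < h → h < min δ₁ δ₂ → (w = u ∨ w = u + h) →
      |kernelOp P (τ - (u + h)) (φ (u + h)) x - kernelOp P (τ - u) (φ u) x| ≤ ε / 2 := by
    intro u h hu huh h0 hlt hor
    have hd1 := hlt.trans_le (min_le_left _ _)
    have hd2 := hlt.trans_le (min_le_right _ _)
    have huT : u ∈ Set.Ioc 0 T := ⟨by linarith, by linarith⟩
    have huhT : u + h ∈ Set.Ioc 0 T := ⟨by linarith, by linarith⟩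
    have hhT : h ∈ Set.Icc 0 T := ⟨h0.le, by linarith⟩
    have hsT : τ - (u + h) ∈ Set.Icc 0 T := ⟨by linarith, by linarith⟩
    have hfin : ∀ s ∈ Set.Icc 0 T, ∀ y, IsFiniteMeasure (P s y) := fun s hs y =>
      ⟨hP.finite s hs.1 y⟩
    have hB := hP.bddMeas_kernelOp hhT (hφm u huT)
    rw [show τ - u = (τ - (u + h)) + h by ring, hP.kernelOp_add hsT hhT (hφm u huT),
      ← kernelOp_sub (hφm _ huhT) hB (hfin _ hsT x)]
    refine hP.abs_kernelOp_le hsT (by positivity) (fun y => ?_) x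
    have f2 := abs_le.1 (h2 u hu h h0 hd2 y)
    rcases hor with rfl | rfl
    · have f1 := abs_le.1 (h1 h h0 hd1 y)
      rw [abs_le]
      constructor <;> linarith [f1.1, f1.2, f2.1, f2.2]
    · have f1 := abs_le.1 (h1 h h0 hd1 y)
      have f3 : |kernelOp P h (φ (u + h)) y - kernelOp P h (φ u) y| ≤ ε / 8 := by
        rw [← kernelOp_sub (hφm _ huhT) (hφm u huT) (hfin _ hhT y)]
        exact hP.abs_kernelOp_le hhT (by positivity) (h2 u hu h h0 hd2) y
      have f3' := abs_le.1 f3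
      rw [abs_le]
      constructor <;> linarith [f1.1, f1.2, f2.1, f2.2, f3'.1, f3'.2]
  refine ⟨min δ₁ δ₂, lt_min hδ₁ hδ₂, fun v hv hvd => ?_⟩
  rw [Real.dist_eq] at hvd ⊢
  rcases lt_trichotomy v w with hlt | rfl | hgt
  · rw [abs_sub_comm, abs_of_pos (by linarith)] at hvd
    have := main v (w - v) hv.1 (by linarith [hw.2]) (by linarith) hvd (Or.inr (by ring))
    rw [add_sub_cancel, abs_sub_comm] at this
    linarith
  · simpa using hε
  · rw [abs_of_pos (by linarith)] at hvd
    have := main w (v - w) hw.1 (by linarith [hv.2]) (by linarith) hvd (Or.inl rfl)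
    rw [add_sub_cancel] at this
    linarith

end Semigroup

end

section

/-! ### The frozen semigroups -/

variable {d : ℕ} {T : ℝ} {P : ℝ → Kernel (Sp d) (Sp d)} {p : Sp d → ℝ → Sp d → Sp d → ℝ}
  {θ : ℝ → Sp d → Sp d → ℝ} {γ β : ℝ → Sp d → Sp d → ℝ≥0} {ρ : ℝ}

namespace IsFrozenFamily

lemma measurable_section (hp : IsFrozenFamily T p) (z : Sp d) (t : ℝ) (x : Sp d) :
    Measurable (p z t x) :=
  hp.meas.comp (f := fun y => (z, t, x, y)) (by fun_prop)

lemma measurable_phi (hp : IsFrozenFamily T p) :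
    Measurable fun q : ℝ × Sp d × Sp d => phi p q.1 q.2.1 q.2.2 :=
  hp.meas.comp (f := fun q : ℝ × Sp d × Sp d => (q.2.1, q.1, q.2.2, q.2.1)) (by fun_prop)

lemma phi_nonneg (hp : IsFrozenFamily T p) {t : ℝ} (ht : 0 < t) (z x : Sp d) :
    0 ≤ phi p t z x := hp.nonneg z t x z ht

/-- The Chapman–Kolmogorov equation with the arrival point fixed. -/
lemma densityOp_phi (hp : IsFrozenFamily T p) (z : Sp d) {h u : ℝ} (hh : 0 < h) (hu : 0 < u)
    (y : Sp d) : densityOp (p z) h (phi p u z) y = phi p (u + h) z y := by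
  unfold densityOp
  have hm : Measurable (phi p u z) := hp.measurable_phi.comp (f := fun x => (u, z, x)) (by fun_prop)
  rw [integral_eq_lintegral_of_nonneg_ae
    (.of_forall fun w => mul_nonneg (hp.phi_nonneg hu z w) (hp.nonneg z h y w hh))
    (hm.mul (hp.measurable_section z h y)).aestronglyMeasurable]
  have := hp.chapman z h u y z hh hu
  have e : ∀ w, ENNReal.ofReal (phi p u z w * p z h y w)
      = ENNReal.ofReal (p z h y w) * ENNReal.ofReal (p z u w z) := fun w => by
    rw [ENNReal.ofReal_mul (hp.phi_nonneg hu z w), mul_comm]; rfl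
  simp_rw [e]
  rw [this, ENNReal.toReal_ofReal (hp.nonneg z _ y z (by linarith)), add_comm]
  rfl

lemma integrable_section (hp : IsFrozenFamily T p) (z : Sp d) {t : ℝ} (ht : 0 < t) (x : Sp d) :
    Integrable (p z t x) := by
  refine ⟨(hp.measurable_section z t x).aestronglyMeasurable, ?_⟩
  unfold HasFiniteIntegral
  have : ∀ y, ‖p z t x y‖ₑ = ENNReal.ofReal (p z t x y) := fun y =>
    Real.enorm_of_nonneg (hp.nonneg z t x y ht)
  simp_rw [this, hp.mass_one z t x ht]
  simp

lemma abs_densityOp_le (hp : IsFrozenFamily T p) (z : Sp d) {t : ℝ} (ht : 0 < t) {f : Sp d → ℝ}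
    {C : ℝ} (hC : ∀ y, |f y| ≤ C) (x : Sp d) : |densityOp (p z) t f x| ≤ C := by
  unfold densityOp
  have h1 : ∫ y, C * p z t x y = C := by
    rw [integral_const_mul, integral_eq_lintegral_of_nonneg_ae
      (.of_forall fun y => hp.nonneg z t x y ht)
      (hp.measurable_section z t x).aestronglyMeasurable, hp.mass_one z t x ht]
    simp
  rw [← Real.norm_eq_abs]
  refine (norm_integral_le_of_norm_le ((hp.integrable_section z ht x).const_mul C)
    (.of_forall fun y => ?_)).trans h1.le
  rw [norm_mul, Real.norm_eq_abs, Real.norm_eq_abs, abs_of_nonneg (hp.nonneg z t x y ht)]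
  exact mul_le_mul_of_nonneg_right (hC y) (hp.nonneg z t x y ht)

lemma densityOp_sub (hp : IsFrozenFamily T p) (z : Sp d) {t : ℝ} (ht : 0 < t) {f g : Sp d → ℝ}
    (hf : BddMeas f) (hg : BddMeas g) (x : Sp d) :
    densityOp (p z) t (fun y => f y - g y) x = densityOp (p z) t f x - densityOp (p z) t g x := by
  unfold densityOp
  have hi : ∀ f : Sp d → ℝ, BddMeas f → Integrable fun y => f y * p z t x y := fun f hf => by
    obtain ⟨C, hC⟩ := hf.2
    exact (hp.integrable_section z ht x).bdd_mul hf.1.aestronglyMeasurable (.of_forall hC)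
  simp_rw [sub_mul]
  exact integral_sub (hi f hf) (hi g hg)

/-- An increment of the frozen density in time is an increment of its own semigroup, so its time
derivative is L^z φ. -/
lemma tendstoUniformly_phi (hp : IsFrozenFamily T p) {z : Sp d} {u : ℝ} (hu : 0 < u)
    (h : InDomain (densityOp (p z)) (phi p u z)) :
    TendstoUniformly (fun h y => (phi p (u + h) z y - phi p u z y) / h)
      (generator (densityOp (p z)) (phi p u z)) (𝓝[>] (0:ℝ)) := by
  intro s hs
  filter_upwards [h.2 s hs, self_mem_nhdsWithin] with t h1 ht y
  simpa only [hp.densityOp_phi z ht hu] using h1 y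

/-- The increment at a time u > u₀ is the image of the increment at u₀ under a contraction, so
strong continuity at u₀ suffices for all later times. -/
lemma phi_uniform_continuity (hp : IsFrozenFamily T p) {z : Sp d} {u₀ : ℝ} (hu₀ : 0 < u₀)
    (hT : u₀ < T) (h : ∀ u ∈ Set.Ioc 0 T, InDomain (densityOp (p z)) (phi p u z)) :
    ∀ ε > (0:ℝ), ∃ δ > (0:ℝ), ∀ u, u₀ ≤ u → ∀ h, 0 < h → h < δ → ∀ y,
      |phi p (u + h) z y - phi p u z y| ≤ ε := by
  intro ε hε
  have hs : StrongAt (densityOp (p z)) (phi p u₀ z) := by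
    refine (h u₀ ⟨hu₀, hT.le⟩).strongAt ?_
    filter_upwards [Ioo_mem_nhdsGT (show (0:ℝ) < T - u₀ by linarith)] with t ht
    have : densityOp (p z) t (phi p u₀ z) = phi p (u₀ + t) z := by
      funext y; exact hp.densityOp_phi z ht.1 hu₀ y
    rw [this]
    exact (h (u₀ + t) ⟨by linarith [ht.1], by linarith [ht.2]⟩).1
  obtain ⟨δ, hδ, hd⟩ := hs ε hε
  refine ⟨min δ (T - u₀), lt_min hδ (by linarith), fun u hu k h0 hlt => ?_⟩
  have hkδ := hlt.trans_le (min_le_left _ _)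
  have hkT := hlt.trans_le (min_le_right _ _)
  have h0' : ∀ y, |phi p (u₀ + k) z y - phi p u₀ z y| ≤ ε := fun y => by
    have := hd k h0 hkδ y
    rwa [hp.densityOp_phi z h0 hu₀] at this
  rcases eq_or_lt_of_le hu with rfl | hlt'
  · exact h0'
  · intro y
    have e : ∀ v, 0 < v → phi p (v + (u - u₀)) z y = densityOp (p z) (u - u₀) (phi p v z) y :=
      fun v hv => (hp.densityOp_phi z (by linarith) hv y).symm
    have e1 := e (u₀ + k) (by linarith)
    have e2 := e u₀ hu₀
    rw [show u₀ + k + (u - u₀) = u + k by ring] at e1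
    rw [show u₀ + (u - u₀) = u by ring] at e2
    rw [e1, e2, ← hp.densityOp_sub z (by linarith)
      (h (u₀ + k) ⟨by linarith, by linarith⟩).1 (h u₀ ⟨hu₀, hT.le⟩).1]
    exact hp.abs_densityOp_le z (by linarith) h0' y

end IsFrozenFamily

/-! ### The Volterra equation -/

/-- Duhamel's formula comparing the main semigroup with the frozen density. -/
lemma kernelOp_phi_sub (hP : IsMainSemigroup T P) (hp : IsFrozenFamily T p)
    (hL : GeneratorsAgree T P p) (hreg : BackwardRegularity T P p) (hθ : IsBackwardWeight T P p θ)
    {t ε : ℝ} (ht : 0 < t) (hε : 0 < ε) (htε : t + ε ≤ T) (x z : Sp d)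
    (hint : IntervalIntegrable (fun u => kernelOp P (t + ε - u) (aHat p θ u z) x) volume
      ε (t + ε)) :
    kernelOp P t (phi p ε z) x - phi p (t + ε) z x
      = ∫ u in ε..(t + ε), kernelOp P (t + ε - u) (aHat p θ u z) x := by
  have hdom : ∀ u ∈ Set.Ioc 0 T, InDomain (kernelOp P) (phi p u z) := fun u hu =>
    hreg.phi_dom u hu z
  have hdomz : ∀ u ∈ Set.Ioc 0 T, InDomain (densityOp (p z)) (phi p u z) := fun u hu =>
    hreg.phi_dom_frozen u hu z z
  have hderiv : ∀ u ∈ Set.Ioo ε (t + ε), HasDerivWithinAt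
      (fun u => kernelOp P (t + ε - u) (phi p u z) x)
      (-(kernelOp P (t + ε - u) (aHat p θ u z) x)) (Set.Ioi u) u := by
    intro u hu
    have hu0 : 0 < u := hε.trans hu.1
    have huT : u ∈ Set.Ioc 0 T := ⟨hu0, by linarith [hu.2]⟩
    have := hP.hasDerivWithinAt_kernelOp hu0 htε hu.2 hdom
      (hp.tendstoUniformly_phi hu0 (hdomz u huT)) x
    convert this using 3
    funext y
    -- At the point y the main generator acts on φ_u^z as L^y, and (L^y - L^z) φ_u^z (y) is â_u(z,
    -- y).
    rw [hL.frozen u huT z y, hθ.eq u huT z y]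
    rfl
  have hcont := hP.continuousOn_kernelOp hε htε hdom
    (hp.phi_uniform_continuity hε (by linarith) hdomz) x
  have := intervalIntegral.integral_eq_sub_of_hasDeriv_right_of_le (by linarith) hcont hderiv
    hint.neg
  rw [intervalIntegral.integral_neg] at this
  simp only [sub_self, add_sub_cancel_right] at this
  rw [hP.kernelOp_zero (hdom _ ⟨by linarith, htε⟩).1.1] at this
  linarith

/-- On times at most T the Laplace weight is at least e^(-lT), so the Laplace bound controls the
bare power. -/
lemma lintegral_timePow_Iic_lt_top (h1 : ρ < 1) (T : ℝ) :
    ∫⁻ r in Set.Iic T, timePow ρ r < ∞ := by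
  obtain ⟨l, hl, hl'⟩ := lintegral_timePow_exp_le h1 (κ := 1) one_pos
  have hm := measurable_timePow ρ
  calc _ ≤ ∫⁻ r in Set.Iic T, ENNReal.ofReal (Real.exp (l * T)) *
        (timePow ρ r * ENNReal.ofReal (Real.exp (-(l * r)))) := by
        refine setLIntegral_mono (by fun_prop) fun r hr => ?_
        rw [mul_left_comm, ← ENNReal.ofReal_mul (Real.exp_pos _).le, ← Real.exp_add]
        refine le_mul_of_one_le_right zero_le ?_
        rw [ENNReal.one_le_ofReal]
        refine Real.one_le_exp ?_
        have : r ≤ T := hr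
        nlinarith
    _ ≤ ∫⁻ r, ENNReal.ofReal (Real.exp (l * T)) *
        (timePow ρ r * ENNReal.ofReal (Real.exp (-(l * r)))) := setLIntegral_le_lintegral _ _
    _ ≤ ENNReal.ofReal (Real.exp (l * T)) * 1 := by
        rw [lintegral_const_mul _ (by fun_prop)]
        gcongr
    _ < ∞ := by simp

lemma lintegral_timePow_sub_lt_top (h1 : ρ < 1) (t τ : ℝ) :
    ∫⁻ s in Set.Ioo 0 t, timePow ρ (τ - s) < ∞ := by
  calc _ ≤ ∫⁻ s, (Set.Iic τ).indicator (timePow ρ) (τ - s) := by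
        rw [← lintegral_indicator measurableSet_Ioo]
        refine lintegral_mono fun s => ?_
        unfold Set.indicator
        split_ifs with h h'
        · exact le_rfl
        · exact absurd (show τ - s ≤ τ by linarith [h.1]) h'
        · exact zero_le
        · exact le_rfl
    _ = ∫⁻ s, (Set.Iic τ).indicator (timePow ρ) s := lintegral_sub_left_eq_self _ τ
    _ = ∫⁻ s in Set.Iic τ, timePow ρ s := lintegral_indicator measurableSet_Iic _
    _ < ∞ := lintegral_timePow_Iic_lt_top h1 τ

/-- The occupation measure `P_s(x, dw) ds` up to time `t`. -/
def occ (hP : IsMainSemigroup T P) (x : Sp d) (t : ℝ) : Measure (ℝ × Sp d) :=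
  (volume.restrict (Set.Ioo 0 t)) ⊗ₘ timeKernel hP x

instance (hP : IsMainSemigroup T P) (x : Sp d) (t : ℝ) : IsFiniteMeasure (occ hP x t) := by
  unfold occ
  have : IsFiniteMeasure (volume.restrict (Set.Ioo 0 t)) := ⟨by simp⟩
  infer_instance

/-- The transition measures have mass at most one. -/
lemma lintegral_occ_fst_le (hP : IsMainSemigroup T P) (x : Sp d) (t : ℝ) {f : ℝ → ℝ≥0∞}
    (hf : Measurable f) : ∫⁻ q, f q.1 ∂(occ hP x t) ≤ ∫⁻ s in Set.Ioo 0 t, f s := by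
  unfold occ
  rw [Measure.lintegral_compProd (by fun_prop)]
  refine lintegral_mono fun s => ?_
  simp only [lintegral_const]
  exact mul_le_of_le_one_right zero_le (timeKernel_univ_le hP s x)

lemma ae_occ_mem (hP : IsMainSemigroup T P) (x : Sp d) (t : ℝ) :
    ∀ᵐ q ∂(occ hP x t), q.1 ∈ Set.Ioo 0 t := by
  have hm : MeasurableSet {q : ℝ × Sp d | q.1 ∉ Set.Ioo 0 t} :=
    (measurableSet_Ioo.preimage measurable_fst).compl
  rw [ae_iff, ← lintegral_indicator_one hm]
  have := lintegral_occ_fst_le hP x t (f := (Set.Ioo 0 t)ᶜ.indicator 1)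
    (measurable_one.indicator measurableSet_Ioo.compl)
  refine le_antisymm (this.trans ?_) zero_le
  rw [lintegral_indicator measurableSet_Ioo.compl, Measure.restrict_restrict
    measurableSet_Ioo.compl, Set.compl_inter_self]
  simp

/-- The integral is over the frozen point, the variable of the test function, since the semigroup
acts on the other one. Uniformity in w makes the bound usable against P_s(x, dw). -/
lemma BackwardDomination.exists_col_bound (hdom : BackwardDomination T p θ γ β ρ) {A : ℝ≥0∞}
    (ha : DominatedKernel T ρ γ A (trunc T (aHat p θ))) :
    ∃ C : ℝ≥0∞, C ≠ ∞ ∧ ∀ u w, ∫⁻ z, ‖trunc T (aHat p θ) u z w‖ₑ ≤ C * timePow ρ u := by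
  obtain ⟨C, hC⟩ := hdom.gamma_left
  refine ⟨A * C, ENNReal.mul_ne_top ha.ne_top (by simp), fun u w => ?_⟩
  by_cases hu : u ∈ Set.Ioc 0 T
  · calc _ ≤ ∫⁻ z, A * timePow ρ u * γ u z w := lintegral_mono fun z => ha.bound u z w
      _ = A * timePow ρ u * ∫⁻ z, γ u z w :=
        lintegral_const_mul' _ _ (ENNReal.mul_ne_top ha.ne_top (timePow_ne_top _ _))
      _ ≤ A * timePow ρ u * C := by gcongr; exact hC u hu w
      _ = _ := by ring
  · simp [ha.zero u hu]

section Volterra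

variable {A C : ℝ≥0∞} {a : ℝ → Sp d → Sp d → ℝ}

lemma measurable_kernel_occ (ha : Measurable fun q : ℝ × Sp d × Sp d => a q.1 q.2.1 q.2.2) (τ : ℝ) :
    Measurable fun q : Sp d × (ℝ × Sp d) => a (τ - q.2.1) q.1 q.2.2 :=
  ha.comp (f := fun q : Sp d × (ℝ × Sp d) => (τ - q.2.1, q.1, q.2.2)) (by fun_prop)

lemma lintegral_lintegral_occ_lt_top (hP : IsMainSemigroup T P)
    (h1 : ρ < 1)
    (hC : C ≠ ∞) (hcol : ∀ u w, ∫⁻ z, ‖a u z w‖ₑ ≤ C * timePow ρ u) (x : Sp d) (t τ : ℝ) :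
    ∫⁻ q, (∫⁻ z, ‖a (τ - q.1) z q.2‖ₑ) ∂(occ hP x t) < ∞ := by
  have hm := measurable_timePow ρ
  calc _ ≤ ∫⁻ q, C * timePow ρ (τ - q.1) ∂(occ hP x t) := lintegral_mono fun q => hcol _ _
    _ ≤ ∫⁻ s in Set.Ioo 0 t, C * timePow ρ (τ - s) := lintegral_occ_fst_le hP x t
        (f := fun s => C * timePow ρ (τ - s)) (by fun_prop)
    _ = C * ∫⁻ s in Set.Ioo 0 t, timePow ρ (τ - s) := lintegral_const_mul _ (by fun_prop)
    _ < ∞ := ENNReal.mul_lt_top hC.lt_top (lintegral_timePow_sub_lt_top h1 t τ)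

lemma integrable_prod_occ (hP : IsMainSemigroup T P)
    (ha : Measurable fun q : ℝ × Sp d × Sp d => a q.1 q.2.1 q.2.2) (h1 : ρ < 1)
    (hC : C ≠ ∞) (hcol : ∀ u w, ∫⁻ z, ‖a u z w‖ₑ ≤ C * timePow ρ u) (x : Sp d) (t τ : ℝ) :
    Integrable (fun q : Sp d × (ℝ × Sp d) => a (τ - q.2.1) q.1 q.2.2)
      (volume.prod (occ hP x t)) := by
  have hm := measurable_kernel_occ ha τ
  refine ⟨hm.aestronglyMeasurable, ?_⟩
  unfold HasFiniteIntegral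
  rw [lintegral_prod_symm _ hm.enorm.aemeasurable]
  exact lintegral_lintegral_occ_lt_top hP h1 hC hcol x t τ

end Volterra

end

/-! ### Duhamel's formula and the tested Volterra equation. -/

section

variable {d : ℕ} {T : ℝ} {P : ℝ → Kernel (Sp d) (Sp d)} {p : Sp d → ℝ → Sp d → Sp d → ℝ}
  {θ : ℝ → Sp d → Sp d → ℝ} {γ β : ℝ → Sp d → Sp d → ℝ≥0} {ρ : ℝ}

lemma integral_occ {hP : IsMainSemigroup T P} {x : Sp d} {t : ℝ} {f : ℝ × Sp d → ℝ}
    (hf : Integrable f (occ hP x t)) :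
    ∫ q, f q ∂(occ hP x t) = ∫ s in Set.Ioo 0 t, ∫ w, f (s, w) ∂(timeKernel hP x s) :=
  Measure.integral_compProd hf

lemma integrable_integral_occ {hP : IsMainSemigroup T P} {x : Sp d} {t : ℝ} {f : ℝ × Sp d → ℝ}
    (hf : Integrable f (occ hP x t)) :
    IntegrableOn (fun s => ∫ w, f (s, w) ∂(timeKernel hP x s)) (Set.Ioo 0 t) := by
  unfold occ Measure.compProd at hf
  have := hf.integral_compProd
  simpa [IntegrableOn] using this

/-- Duhamel's formula for almost every frozen point. -/
lemma duhamel_ae (hP : IsMainSemigroup T P) (hp : IsFrozenFamily T p)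
    (hL : GeneratorsAgree T P p) (hreg : BackwardRegularity T P p) (hθ : IsBackwardWeight T P p θ)
    (hdom : BackwardDomination T p θ γ β ρ) {A : ℝ≥0∞}
    (ha : DominatedKernel T ρ γ A (trunc T (aHat p θ)))
    {t ε : ℝ} (ht : 0 < t) (hε : 0 < ε) (htε : t + ε ≤ T) (x : Sp d) :
    ∀ᵐ z, kernelOp P t (phi p ε z) x - phi p (t + ε) z x
      = ∫ q, trunc T (aHat p θ) (t + ε - q.1) z q.2 ∂(occ hP x t) := by
  obtain ⟨C, hC, hcol⟩ := hdom.exists_col_bound ha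
  -- For an individual z the time integral is not known to converge. Fubini's theorem gives
  -- convergence for almost every z, which is enough after testing.
  filter_upwards [(integrable_prod_occ hP ha.meas ha.rho_lt_one hC hcol x t (t + ε)).prod_right_ae]
    with z hz
  have hz' := integrable_integral_occ hz
  rw [integral_occ hz]
  have e : Set.EqOn (fun s => ∫ w, trunc T (aHat p θ) (t + ε - s) z w ∂(timeKernel hP x s))
      (fun s => kernelOp P s (aHat p θ (t + ε - s) z) x) (Set.Ioo 0 t) := fun s hs => by
    have h1 : s ∈ Set.Icc 0 T := ⟨hs.1.le, by linarith [hs.2]⟩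
    have h2 : t + ε - s ∈ Set.Ioc 0 T := ⟨by linarith [hs.2], by linarith [hs.1]⟩
    simp only [timeKernel_apply hP h1, trunc_of_mem h2]
    rfl
  have hz'' : IntegrableOn (fun s => kernelOp P s (aHat p θ (t + ε - s) z) x) (Set.Ioo 0 t) :=
    hz'.congr_fun e measurableSet_Ioo
  have hI : IntervalIntegrable (fun s => kernelOp P s (aHat p θ (t + ε - s) z) x) volume 0 t := by
    rw [intervalIntegrable_iff_integrableOn_Ioo_of_le ht.le]
    exact hz''
  have hI' := (hI.comp_sub_left (t + ε)).symm
  simp only [sub_sub_cancel, sub_zero, add_sub_cancel_left] at hI'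
  rw [kernelOp_phi_sub hP hp hL hreg hθ ht hε htε x z hI',
    setIntegral_congr_fun measurableSet_Ioo e,
    ← integral_Ioc_eq_integral_Ioo, ← intervalIntegral.integral_of_le ht.le]
  have := intervalIntegral.integral_comp_sub_left (a := 0) (b := t)
    (fun u => kernelOp P (t + ε - u) (aHat p θ u z) x) (t + ε)
  simp only [sub_sub_cancel, sub_zero, add_sub_cancel_left] at this
  exact this.symm

lemma integrable_phi_row (hp : IsFrozenFamily T p) (hreg : BackwardRegularity T P p) {t : ℝ}
    (ht : t ∈ Set.Ioc 0 T) (x : Sp d) : Integrable fun z => phi p t z x := by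
  obtain ⟨C, hC⟩ := hreg.bdd_integral
  refine ⟨(hp.measurable_phi.comp (f := fun z => (t, z, x)) (by fun_prop)).aestronglyMeasurable, ?_⟩
  unfold HasFiniteIntegral
  have : ∀ z, ‖phi p t z x‖ₑ = ENNReal.ofReal (p z t x z) := fun z =>
    Real.enorm_of_nonneg (hp.phi_nonneg ht.1 z x)
  simp_rw [this]
  exact ((hC t ht).1 x).trans_lt (by simp)

/-- The space-time convolution of the occupation measure with the kernel `a`. -/
def occConv (a : ℝ → Sp d → Sp d → ℝ) (hP : IsMainSemigroup T P) (x : Sp d) (t : ℝ) (z : Sp d) :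
    ℝ := ∫ q, a (t - q.1) z q.2 ∂(occ hP x T)

lemma measurable_occConv {a : ℝ → Sp d → Sp d → ℝ}
    (ha : Measurable fun q : ℝ × Sp d × Sp d => a q.1 q.2.1 q.2.2) (hP : IsMainSemigroup T P)
    (x : Sp d) : Measurable fun q : ℝ × Sp d => occConv a hP x q.1 q.2 := by
  refine (StronglyMeasurable.integral_prod_right (ν := occ hP x T)
    (f := fun (q : (ℝ × Sp d)) (r : ℝ × Sp d) => a (q.1 - r.1) q.2 r.2) ?_).measurable
  exact (ha.comp (f := fun r : (ℝ × Sp d) × (ℝ × Sp d) => (r.1.1 - r.2.1, r.1.2, r.2.2))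
    (by fun_prop)).stronglyMeasurable

lemma occ_restrict (hP : IsMainSemigroup T P) (x : Sp d) {t : ℝ} (ht : t ≤ T) :
    occ hP x t = (occ hP x T).restrict (Set.Iio t ×ˢ Set.univ) := by
  unfold occ
  ext s hs
  have hm : MeasurableSet (Set.Iio t ×ˢ (Set.univ : Set (Sp d))) :=
    measurableSet_Iio.prod MeasurableSet.univ
  rw [Measure.restrict_apply hs, Measure.compProd_apply hs, Measure.compProd_apply (hs.inter hm),
    ← lintegral_indicator measurableSet_Ioo, ← lintegral_indicator measurableSet_Ioo]
  congr 1
  funext u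
  unfold Set.indicator
  by_cases h1 : u ∈ Set.Ioo 0 t
  · have h2 : u ∈ Set.Ioo 0 T := ⟨h1.1, h1.2.trans_le ht⟩
    have h3 : Prod.mk u ⁻¹' (s ∩ Set.Iio t ×ˢ Set.univ) = Prod.mk u ⁻¹' s := by
      ext w
      simp [h1.2]
    rw [if_pos h1, if_pos h2]
    beta_reduce
    rw [h3]
  · rw [if_neg h1]
    split_ifs with h2
    · have : Prod.mk u ⁻¹' (s ∩ Set.Iio t ×ˢ Set.univ) = ∅ := by
        ext w
        simp only [Set.mem_preimage, Set.mem_inter_iff, Set.mem_prod, Set.mem_Iio, Set.mem_univ,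
          and_true, Set.mem_empty_iff_false, iff_false, not_and]
        exact fun _ h => h1 ⟨h2.1, h⟩
      beta_reduce
      rw [this, measure_empty]
    · rfl

/-- The kernel vanishes at nonpositive durations, so one occupation measure, up to T, serves all t ≤
T. -/
lemma integral_occ_eq_occConv {a : ℝ → Sp d → Sp d → ℝ} (ha : ∀ t ≤ 0, ∀ x y, a t x y = 0)
    (hP : IsMainSemigroup T P) (x : Sp d) {t : ℝ} (ht : t ≤ T) (z : Sp d) :
    ∫ q, a (t - q.1) z q.2 ∂(occ hP x t) = occConv a hP x t z := by
  unfold occConv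
  rw [occ_restrict hP x ht]
  refine setIntegral_eq_integral_of_forall_compl_eq_zero fun q hq => ?_
  refine ha _ ?_ _ _
  simp only [Set.mem_prod, Set.mem_Iio, Set.mem_univ, and_true, not_lt] at hq
  linarith

/-- The Volterra equation for the main semigroup, tested against `C_c^∞`. -/
lemma volterra_isTest (hP : IsMainSemigroup T P) (hp : IsFrozenFamily T p)
    (hL : GeneratorsAgree T P p) (hreg : BackwardRegularity T P p) (hθ : IsBackwardWeight T P p θ)
    (hdom : BackwardDomination T p θ γ β ρ) {A : ℝ≥0∞}
    (ha : DominatedKernel T ρ γ A (trunc T (aHat p θ)))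
    (hphi : ContinuousOn (fun q : ℝ × Sp d × Sp d => phi p q.1 q.2.1 q.2.2)
      (Set.Ioc 0 T ×ˢ Set.univ))
    (haHat : ContinuousOn (fun q : ℝ × Sp d × Sp d => aHat p θ q.1 q.2.1 q.2.2)
      (Set.Ioc 0 T ×ˢ Set.univ))
    {t : ℝ} (ht : t ∈ Set.Ioo 0 T) (x : Sp d) {h : Sp d → ℝ} (hh : IsTest h) :
    kernelOp P t h x
      = ∫ z, h z * (phi p t z x + occConv (trunc T (aHat p θ)) hP x t z) := by
  set a := trunc T (aHat p θ) with ha_def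
  obtain ⟨C, hC, hcol⟩ := hdom.exists_col_bound ha
  obtain ⟨Ch, hCh⟩ := hh.exists_bound
  have hCh0 : 0 ≤ Ch := (abs_nonneg _).trans (hCh 0)
  have hhe : ∀ z, ‖h z‖ₑ ≤ ENNReal.ofReal Ch := fun z => by
    rw [← ofReal_norm]; exact ENNReal.ofReal_le_ofReal (hCh z)
  have hm := measurable_timePow ρ
  have hPfin : IsFiniteMeasure (P t x) := ⟨hP.finite t ht.1.le x⟩
  obtain ⟨Cp, hCp⟩ := hreg.bdd_integral
  have hbdd_mul : ∀ {f : Sp d → ℝ}, Integrable f → Integrable fun z => h z * f z := fun hf =>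
    hf.bdd_mul hh.measurable.aestronglyMeasurable (.of_forall hCh)
  have hphim : ∀ ε, Measurable fun q : Sp d × Sp d => phi p ε q.1 q.2 := fun ε =>
    hp.measurable_phi.comp (f := fun q : Sp d × Sp d => (ε, q.1, q.2)) (by fun_prop)
  have hev : ∀ᶠ ε in 𝓝[>] (0:ℝ), ε ∈ Set.Ioo 0 (T - t) :=
    Ioo_mem_nhdsGT (by linarith [ht.2])
  -- the double integral against `h`
  have hprod : ∀ τ, Integrable (fun q : Sp d × (ℝ × Sp d) => h q.1 * a (τ - q.2.1) q.1 q.2.2)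
      (volume.prod (occ hP x t)) := fun τ =>
    (integrable_prod_occ hP ha.meas ha.rho_lt_one hC hcol x t τ).bdd_mul
      (hh.measurable.comp measurable_fst).aestronglyMeasurable (.of_forall fun q => hCh q.1)
  have hphiprod : ∀ ε ∈ Set.Ioc 0 T, Integrable (fun q : Sp d × Sp d => h q.1 * phi p ε q.1 q.2)
      (volume.prod (P t x)) := fun ε hε => by
    refine Integrable.bdd_mul ?_ (hh.measurable.comp measurable_fst).aestronglyMeasurable
      (.of_forall fun q => hCh q.1)
    refine ⟨(hphim ε).aestronglyMeasurable, ?_⟩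
    unfold HasFiniteIntegral
    rw [lintegral_prod_symm _ (hphim ε).enorm.aemeasurable]
    calc _ ≤ ∫⁻ _, (Cp : ℝ≥0∞) ∂(P t x) := by
          refine lintegral_mono fun w => ?_
          have : ∀ z, ‖phi p ε z w‖ₑ = ENNReal.ofReal (p z ε w z) := fun z =>
            Real.enorm_of_nonneg (hp.phi_nonneg hε.1 z w)
          simp_rw [this]
          exact (hCp ε hε).1 w
      _ < ∞ := by rw [lintegral_const]; exact ENNReal.mul_lt_top (by simp) (measure_lt_top _ _)
  -- Duhamel's formula integrated against h, with the integral over z moved inside, where the limit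
  -- ε ↓ 0 can be taken.
  have hident : ∀ ε ∈ Set.Ioo 0 (T - t),
      ∫ w, (∫ z, h z * phi p ε z w) ∂(P t x) - ∫ z, h z * phi p (t + ε) z x
        = ∫ q, (∫ z, h z * a (t + ε - q.1) z q.2) ∂(occ hP x t) := by
    intro ε hε
    have hεT : ε ∈ Set.Ioc 0 T := ⟨hε.1, by linarith [hε.2, ht.1]⟩
    have htεT : t + ε ∈ Set.Ioc 0 T := ⟨by linarith [hε.1, ht.1], by linarith [hε.2]⟩
    have hsw1 := integral_integral_swap (f := fun z w => h z * phi p ε z w) (hphiprod ε hεT)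
    have hsw2 := integral_integral_swap (f := fun z (q : ℝ × Sp d) => h z * a (t + ε - q.1) z q.2)
      (hprod (t + ε))
    rw [← hsw1, ← hsw2, ← integral_sub]
    · refine integral_congr_ae ?_
      filter_upwards [duhamel_ae hP hp hL hreg hθ hdom ha ht.1 hε.1 htεT.2 x] with z hz
      rw [integral_const_mul, integral_const_mul, ← hz]
      unfold kernelOp
      ring
    · exact (hphiprod ε hεT).integral_prod_left
    · exact hbdd_mul (integrable_phi_row hp hreg htεT x)
  -- The frozen densities are an approximate identity in z, and their bounded integrals over z give
  -- the constant bound.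
  have hlim1 : Tendsto (fun ε => ∫ w, (∫ z, h z * phi p ε z w) ∂(P t x)) (𝓝[>] 0)
      (𝓝 (∫ w, h w ∂(P t x))) := by
    refine tendsto_integral_filter_of_dominated_convergence (fun _ => Ch * Cp) ?_ ?_
      (integrable_const _) (.of_forall fun w => hreg.approx_id h hh w)
    · refine .of_forall fun ε => ?_
      refine (StronglyMeasurable.integral_prod_left (μ := (volume : Measure (Sp d)))
        (f := fun z w => h z * phi p ε z w) ?_).aestronglyMeasurable
      exact ((hh.measurable.comp measurable_fst).mul (hphim ε)).stronglyMeasurable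
    · filter_upwards [hev] with ε hε
      refine .of_forall fun w => ?_
      have hεT : ε ∈ Set.Ioc 0 T := ⟨hε.1, by linarith [hε.2, ht.1]⟩
      have h1 : ‖∫ z, h z * phi p ε z w‖ₑ ≤ ENNReal.ofReal Ch * Cp := by
        refine (enorm_integral_le_lintegral_enorm _).trans ?_
        calc _ ≤ ∫⁻ z, ENNReal.ofReal Ch * ENNReal.ofReal (p z ε w z) := by
              refine lintegral_mono fun z => ?_
              rw [enorm_mul, Real.enorm_of_nonneg (hp.phi_nonneg hε.1 z w)]
              exact mul_le_mul_left (hhe z) _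
          _ = ENNReal.ofReal Ch * ∫⁻ z, ENNReal.ofReal (p z ε w z) :=
              lintegral_const_mul' _ _ (by simp)
          _ ≤ _ := by gcongr; exact (hCp ε hεT).1 w
      have h2 := ENNReal.toReal_mono (by finiteness) h1
      simpa [hCh0] using h2
  -- As h has compact support, joint continuity of φ is enough.
  have hlim2 : Tendsto (fun ε => ∫ z, h z * phi p (t + ε) z x) (𝓝[>] 0)
      (𝓝 (∫ z, h z * phi p t z x)) := by
    have hc : ContinuousOn (fun u => ∫ z, h z * phi p u z x) (Set.Ioc 0 T) := by
      refine continuousOn_integral_of_compact_support (k := tsupport h) hh.2 ?_ ?_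
      · refine (hh.1.continuous.comp continuous_snd).continuousOn.mul ?_
        exact hphi.comp (f := fun q : ℝ × Sp d => (q.1, q.2, x)) (by fun_prop)
          fun q hq => ⟨hq.1, Set.mem_univ _⟩
      · intro u z _ hz
        rw [image_eq_zero_of_notMem_tsupport hz, zero_mul]
    have h1 := hc t ⟨ht.1, ht.2.le⟩
    refine h1.tendsto.comp (tendsto_nhdsWithin_iff.2 ⟨?_, ?_⟩)
    · have : Tendsto (fun ε : ℝ => t + ε) (𝓝 0) (𝓝 (t + 0)) :=
        (continuous_const.add continuous_id).tendsto 0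
      rw [add_zero] at this
      exact this.mono_left inf_le_left
    · filter_upwards [hev] with ε hε
      exact ⟨by linarith [hε.1, ht.1], by linarith [hε.2]⟩
  have hlim3 : Tendsto (fun ε => ∫ q, (∫ z, h z * a (t + ε - q.1) z q.2) ∂(occ hP x t)) (𝓝[>] 0)
      (𝓝 (∫ q, (∫ z, h z * a (t - q.1) z q.2) ∂(occ hP x t))) := by
    -- The bound is independent of ε: t + ε - s exceeds t - s, and the singular power is decreasing.
    refine tendsto_integral_filter_of_dominated_convergence
      (fun q => (ENNReal.ofReal Ch * (C * timePow ρ (t - q.1))).toReal) ?_ ?_ ?_ ?_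
    · refine .of_forall fun ε => ?_
      refine (StronglyMeasurable.integral_prod_left (μ := (volume : Measure (Sp d)))
        (f := fun z (q : ℝ × Sp d) => h z * a (t + ε - q.1) z q.2) ?_).aestronglyMeasurable
      exact ((hh.measurable.comp measurable_fst).mul
        (measurable_kernel_occ ha.meas (t + ε))).stronglyMeasurable
    · filter_upwards [self_mem_nhdsWithin] with ε hε
      have hε0 : 0 < ε := hε
      filter_upwards [ae_occ_mem hP x t] with q hq
      have h1 : ‖∫ z, h z * a (t + ε - q.1) z q.2‖ₑ
          ≤ ENNReal.ofReal Ch * (C * timePow ρ (t - q.1)) := by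
        refine (enorm_integral_le_lintegral_enorm _).trans ?_
        calc _ ≤ ∫⁻ z, ENNReal.ofReal Ch * ‖a (t + ε - q.1) z q.2‖ₑ := by
              refine lintegral_mono fun z => ?_
              rw [enorm_mul]
              exact mul_le_mul_left (hhe z) _
          _ = ENNReal.ofReal Ch * ∫⁻ z, ‖a (t + ε - q.1) z q.2‖ₑ :=
              lintegral_const_mul' _ _ (by simp)
          _ ≤ ENNReal.ofReal Ch * (C * timePow ρ (t + ε - q.1)) := by gcongr; exact hcol _ _
          _ ≤ _ := by
              have hq' : 0 < t - q.1 := by linarith [hq.2]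
              rw [timePow_of_pos hq', timePow_of_pos (by linarith)]
              gcongr ENNReal.ofReal Ch * (C * ENNReal.ofReal ?_)
              exact Real.rpow_le_rpow_of_nonpos hq' (by linarith) (by linarith [ha.rho_nonneg])
      have h2 := ENNReal.toReal_mono (ENNReal.mul_ne_top (by simp)
        (ENNReal.mul_ne_top hC (timePow_ne_top _ _))) h1
      rwa [toReal_enorm] at h2
    · refine integrable_toReal_of_lintegral_ne_top (by fun_prop) ?_
      refine ne_top_of_le_ne_top ?_ (lintegral_occ_fst_le hP x t
        (f := fun s => ENNReal.ofReal Ch * (C * timePow ρ (t - s))) (by fun_prop))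
      rw [lintegral_const_mul _ (by fun_prop), lintegral_const_mul _ (by fun_prop)]
      have := (lintegral_timePow_sub_lt_top ha.rho_lt_one t t).ne
      finiteness
    · filter_upwards [ae_occ_mem hP x t] with q hq
      have hc : ContinuousOn (fun u => ∫ z, h z * aHat p θ u z q.2) (Set.Ioc 0 T) := by
        refine continuousOn_integral_of_compact_support (k := tsupport h) hh.2 ?_ ?_
        · refine (hh.1.continuous.comp continuous_snd).continuousOn.mul ?_
          exact haHat.comp (f := fun r : ℝ × Sp d => (r.1, r.2, q.2)) (by fun_prop)
            fun q hq => ⟨hq.1, Set.mem_univ _⟩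
        · intro u z _ hz
          rw [image_eq_zero_of_notMem_tsupport hz, zero_mul]
      have hmem : t - q.1 ∈ Set.Ioc 0 T := ⟨by linarith [hq.2], by linarith [hq.1, ht.2]⟩
      have h1 := (hc (t - q.1) hmem).tendsto.comp (f := fun ε => t + ε - q.1) (x := 𝓝[>] 0)
        (tendsto_nhdsWithin_iff.2 ⟨?_, ?_⟩)
      · have e1 : ∀ z, a (t - q.1) z q.2 = aHat p θ (t - q.1) z q.2 := fun z =>
          trunc_of_mem hmem _ _ _
        simp_rw [e1]
        refine h1.congr' ?_
        filter_upwards [hev] with ε hε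
        have hmem' : t + ε - q.1 ∈ Set.Ioc 0 T :=
          ⟨by linarith [hq.2, hε.1], by linarith [hq.1, hε.2]⟩
        have e2 : ∀ z, a (t + ε - q.1) z q.2 = aHat p θ (t + ε - q.1) z q.2 := fun z =>
          trunc_of_mem hmem' _ _ _
        simp only [Function.comp, e2]
      · have : Tendsto (fun ε : ℝ => t + ε - q.1) (𝓝 0) (𝓝 (t + 0 - q.1)) :=
          ((continuous_const.add continuous_id).sub continuous_const).tendsto 0
        rw [add_zero] at this
        exact this.mono_left inf_le_left
      · filter_upwards [hev] with ε hε
        exact ⟨by linarith [hε.1, hq.2], by linarith [hε.2, hq.1]⟩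
  have hfinal : ∫ w, h w ∂(P t x) - ∫ z, h z * phi p t z x
      = ∫ q, (∫ z, h z * a (t - q.1) z q.2) ∂(occ hP x t) := by
    refine tendsto_nhds_unique (hlim1.sub hlim2) (hlim3.congr' ?_)
    filter_upwards [hev] with ε hε
    exact (hident ε hε).symm
  have hsw := integral_integral_swap (f := fun z (q : ℝ × Sp d) => h z * a (t - q.1) z q.2)
    (hprod t)
  have hint2 := (hprod t).integral_prod_left
  rw [← hsw] at hfinal
  have e3 : ∀ z, ∫ q, h z * a (t - q.1) z q.2 ∂(occ hP x t) = h z * occConv a hP x t z :=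
    fun z => by
    rw [integral_const_mul, integral_occ_eq_occConv ha.zero_of_nonpos hP x ht.2.le]
  simp only [e3] at hfinal hint2
  simp_rw [mul_add]
  rw [integral_add (hbdd_mul (integrable_phi_row hp hreg ⟨ht.1, ht.2.le⟩ x)) hint2, ← hfinal]
  unfold kernelOp
  ring

end

section

/-! ### The density of the main semigroup -/

variable {d : ℕ} {T : ℝ} {P : ℝ → Kernel (Sp d) (Sp d)} {p : Sp d → ℝ → Sp d → Sp d → ℝ}
  {θ : ℝ → Sp d → Sp d → ℝ} {γ β : ℝ → Sp d → Sp d → ℝ≥0} {ρ : ℝ}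

lemma integrable_ofReal_toReal_mul {α : Type*} [MeasurableSpace α] {ν : Measure α} {q h : α → ℝ}
    (hq : Integrable q ν) (hh : Measurable h) {C : ℝ} (hC : ∀ x, |h x| ≤ C) :
    Integrable (fun x => (ENNReal.ofReal (q x)).toReal * h x) ν := by
  refine Integrable.mul_bdd (c := C) ?_ hh.aestronglyMeasurable (.of_forall hC)
  simp_rw [ENNReal.toReal_ofReal']
  exact hq.pos_part

/-- A finite measure whose test integrals are given by a function has that function as density. -/
lemma eq_withDensity_of_isTest {μ : Measure (Sp d)} [IsFiniteMeasure μ] {q : Sp d → ℝ}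
    (hqm : Measurable q) (hq : Integrable q)
    (h : ∀ f : Sp d → ℝ, IsTest f → ∫ x, f x ∂μ = ∫ x, f x * q x) :
    (∀ᵐ x, 0 ≤ q x) ∧ μ = volume.withDensity fun x => ENNReal.ofReal (q x) := by
  set ν₁ := (volume : Measure (Sp d)).withDensity fun x => ENNReal.ofReal (q x)
  set ν₂ := (volume : Measure (Sp d)).withDensity fun x => ENNReal.ofReal (-q x)
  have : IsFiniteMeasure ν₁ := isFiniteMeasure_withDensity_ofReal hq.2
  have : IsFiniteMeasure ν₂ := isFiniteMeasure_withDensity_ofReal hq.neg.2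
  -- The sign of q is not yet known. Moving its negative part to the left leaves an identity of
  -- positive finite measures, which test functions determine; on {q < 0} the right side has no
  -- mass, so the negative part is null.
  have key : μ + ν₂ = ν₁ := by
    refine measure_ext_of_isTest fun f hf => ?_
    obtain ⟨C, hC⟩ := hf.exists_bound
    rw [integral_add_measure (hf.bddMeas.integrable _) (hf.bddMeas.integrable _), h f hf,
      integral_withDensity_eq_integral_toReal_smul (by fun_prop) (.of_forall fun _ => by simp),
      integral_withDensity_eq_integral_toReal_smul (by fun_prop) (.of_forall fun _ => by simp)]
    simp only [smul_eq_mul]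
    rw [← integral_add]
    · congr 1
      funext x
      rw [ENNReal.toReal_ofReal', ENNReal.toReal_ofReal']
      rcases le_total 0 (q x) with h0 | h0
      · rw [max_eq_left h0, max_eq_right (by linarith)]; ring
      · rw [max_eq_right h0, max_eq_left (by linarith)]; ring
    · exact hq.bdd_mul hf.measurable.aestronglyMeasurable (.of_forall hC)
    · exact integrable_ofReal_toReal_mul hq.neg hf.measurable hC
  have hS : MeasurableSet {x | q x < 0} := measurableSet_lt hqm measurable_const
  have h1 : ν₁ {x | q x < 0} = 0 := by
    rw [withDensity_apply _ hS, setLIntegral_congr_fun (g := fun _ => 0) hS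
      (fun x hx => ENNReal.ofReal_of_nonpos (le_of_lt hx))]
    simp
  have h2 : ν₂ {x | q x < 0} = 0 := le_antisymm
    (((Measure.le_add_left le_rfl : ν₂ ≤ μ + ν₂) _).trans (by rw [key, h1])) zero_le
  have hnn : ∀ᵐ x, 0 ≤ q x := by
    rw [withDensity_apply _ hS, lintegral_eq_zero_iff (by fun_prop),
      Filter.EventuallyEq, ae_restrict_iff' hS] at h2
    filter_upwards [h2] with x hx
    by_contra hx0
    push Not at hx0
    have := hx hx0
    simp only [Pi.zero_apply, ENNReal.ofReal_eq_zero] at this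
    linarith
  refine ⟨hnn, ?_⟩
  have h3 : ν₂ = 0 := by
    rw [show ν₂ = volume.withDensity fun x => ENNReal.ofReal (-q x) from rfl,
      withDensity_congr_ae (g := 0)]
    · exact withDensity_zero
    · filter_upwards [hnn] with x hx
      simpa using hx
  rw [← key, h3, add_zero]

/-- The density of the occupation measure. -/
def occDensity (p : Sp d → ℝ → Sp d → Sp d → ℝ) (θ : ℝ → Sp d → Sp d → ℝ)
    (hP : IsMainSemigroup T P) (x : Sp d) (r : ℝ × Sp d) : ℝ :=
  trunc T (phi p) r.1 r.2 x + occConv (trunc T (aHat p θ)) hP x r.1 r.2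

lemma measurable_trunc {F : Type*} [NormedAddCommGroup F] [MeasurableSpace F]
    {f : ℝ → Sp d → Sp d → F}
    (hf : Measurable fun q : ℝ × Sp d × Sp d => f q.1 q.2.1 q.2.2) :
    Measurable fun q : ℝ × Sp d × Sp d => trunc T f q.1 q.2.1 q.2.2 := by
  have : (fun q : ℝ × Sp d × Sp d => trunc T f q.1 q.2.1 q.2.2)
      = (Set.Ioc 0 T ×ˢ Set.univ).indicator fun q => f q.1 q.2.1 q.2.2 := by
    funext q
    by_cases h : q.1 ∈ Set.Ioc 0 T
    · rw [trunc_of_mem h,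
        Set.indicator_of_mem (show q ∈ Set.Ioc 0 T ×ˢ Set.univ from ⟨h, Set.mem_univ _⟩)]
    · rw [trunc_of_notMem h, Set.indicator_of_notMem fun h' => h h'.1]
  rw [this]
  exact hf.indicator (measurableSet_Ioc.prod MeasurableSet.univ)

lemma measurable_occDensity {A : ℝ≥0∞} (hp : IsFrozenFamily T p)
    (ha : DominatedKernel T ρ γ A (trunc T (aHat p θ))) (hP : IsMainSemigroup T P) (x : Sp d) :
    Measurable (occDensity p θ hP x) :=
  ((measurable_trunc hp.measurable_phi).comp (f := fun r : ℝ × Sp d => (r.1, r.2, x))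
    (by fun_prop)).add (measurable_occConv ha.meas hP x)

lemma integrable_occDensity {A C : ℝ≥0∞} (hp : IsFrozenFamily T p)
    (hreg : BackwardRegularity T P p)
    (ha : DominatedKernel T ρ γ A (trunc T (aHat p θ))) (hP : IsMainSemigroup T P)
    (hC : C ≠ ∞) (hcol : ∀ u w, ∫⁻ z, ‖trunc T (aHat p θ) u z w‖ₑ ≤ C * timePow ρ u) (x : Sp d)
    {t : ℝ} (ht : t ∈ Set.Ioc 0 T) : Integrable fun z => occDensity p θ hP x (t, z) := by
  unfold occDensity
  simp only [trunc_of_mem ht]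
  exact (integrable_phi_row hp hreg ht x).add
    (integrable_prod_occ hP ha.meas ha.rho_lt_one hC hcol x T t).integral_prod_left

/-! ### Absolute continuity of the transition measures. -/

section Occ

variable (hP : IsMainSemigroup T P) (hp : IsFrozenFamily T p)
    (hL : GeneratorsAgree T P p) (hreg : BackwardRegularity T P p) (hθ : IsBackwardWeight T P p θ)
    (hdom : BackwardDomination T p θ γ β ρ) {A : ℝ≥0∞}
    (ha : DominatedKernel T ρ γ A (trunc T (aHat p θ)))
    (hphi : ContinuousOn (fun q : ℝ × Sp d × Sp d => phi p q.1 q.2.1 q.2.2)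
      (Set.Ioc 0 T ×ˢ Set.univ))
    (haHat : ContinuousOn (fun q : ℝ × Sp d × Sp d => aHat p θ q.1 q.2.1 q.2.2)
      (Set.Ioc 0 T ×ˢ Set.univ))
include hp hL hreg hθ hdom ha hphi haHat

/-- The time T is left out because the regularized formula uses times t + ε ≤ T. -/
lemma kernel_eq_withDensity (x : Sp d) {t : ℝ} (ht : t ∈ Set.Ioo 0 T) :
    (∀ᵐ z, 0 ≤ occDensity p θ hP x (t, z)) ∧
      P t x = volume.withDensity fun z => ENNReal.ofReal (occDensity p θ hP x (t, z)) := by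
  obtain ⟨C, hC, hcol⟩ := hdom.exists_col_bound ha
  have : IsFiniteMeasure (P t x) := ⟨hP.finite t ht.1.le x⟩
  have ht' : t ∈ Set.Ioc 0 T := ⟨ht.1, ht.2.le⟩
  refine eq_withDensity_of_isTest
    ((measurable_occDensity hp ha hP x).comp measurable_prodMk_left)
    (integrable_occDensity hp hreg ha hP hC hcol x ht') fun f hf => ?_
  have := volterra_isTest hP hp hL hreg hθ hdom ha hphi haHat ht x hf
  unfold occDensity
  simp only [trunc_of_mem ht']
  exact this

lemma occ_eq_withDensity (x : Sp d) :
    (∀ᵐ r ∂(volume.restrict (Set.Ioo 0 T ×ˢ Set.univ)), 0 ≤ occDensity p θ hP x r) ∧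
      occ hP x T = (volume.restrict (Set.Ioo 0 T ×ˢ Set.univ)).withDensity
        fun r => ENNReal.ofReal (occDensity p θ hP x r) := by
  have hQ := measurable_occDensity hp ha hP x
  have hv : (volume : Measure (ℝ × Sp d)).restrict (Set.Ioo 0 T ×ˢ Set.univ)
      = (volume.restrict (Set.Ioo 0 T)).prod volume := by
    rw [show (volume : Measure (ℝ × Sp d)) = (volume : Measure ℝ).prod volume from rfl,
      ← Measure.prod_restrict, Measure.restrict_univ]
  have hk := fun t ht =>
    kernel_eq_withDensity hP hp hL hreg hθ hdom ha hphi haHat (t := t) x ht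
  rw [hv]
  refine ⟨?_, ?_⟩
  · have hm : MeasurableSet {r | 0 ≤ occDensity p θ hP x r} := measurableSet_le measurable_const hQ
    rw [Measure.ae_prod_iff_ae_ae hm, ae_restrict_iff' measurableSet_Ioo]
    exact .of_forall fun t ht => (hk t ht).1
  · refine Measure.ext fun s hs => ?_
    rw [← lintegral_indicator_one hs, ← lintegral_indicator_one hs,
      lintegral_withDensity_eq_lintegral_mul _ (by fun_prop) (measurable_one.indicator hs)]
    unfold occ
    rw [Measure.lintegral_compProd (measurable_one.indicator hs), lintegral_prod _
      (by exact ((by fun_prop : Measurable fun r => ENNReal.ofReal (occDensity p θ hP x r)).mul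
        (measurable_one.indicator hs)).aemeasurable)]
    refine setLIntegral_congr_fun measurableSet_Ioo fun t ht => ?_
    have hI : Measurable fun w : Sp d => s.indicator (1 : ℝ × Sp d → ℝ≥0∞) (t, w) :=
      (measurable_one.indicator hs).comp measurable_prodMk_left
    have hQ' : Measurable fun w : Sp d => ENNReal.ofReal (occDensity p θ hP x (t, w)) :=
      (hQ.comp measurable_prodMk_left).ennreal_ofReal
    beta_reduce
    rw [timeKernel_apply hP ⟨ht.1.le, ht.2.le⟩, (hk t ht).2,
      lintegral_withDensity_eq_lintegral_mul _ hQ' hI]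
    rfl

/-- This is what allows the Volterra equation to be substituted into itself. -/
lemma integral_occ_eq (x : Sp d) (f : ℝ × Sp d → ℝ) :
    ∫ r, f r ∂(occ hP x T) = ∫ r in Set.Ioo 0 T ×ˢ Set.univ, f r * occDensity p θ hP x r := by
  have hQ := measurable_occDensity hp ha hP x
  obtain ⟨h0, h1⟩ := occ_eq_withDensity hP hp hL hreg hθ hdom ha hphi haHat x
  rw [h1, integral_withDensity_eq_integral_toReal_smul (by fun_prop) (.of_forall fun _ => by simp)]
  refine integral_congr_ae ?_
  filter_upwards [h0] with r hr
  rw [ENNReal.toReal_ofReal hr, smul_eq_mul, mul_comm]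

end Occ

/-! ### Decay of the iterated kernels. -/

section Iteration

variable {C : ℝ≥0∞} {a : ℝ → Sp d → Sp d → ℝ}

/-- No integrability is required, since a Bochner integral that does not converge is zero. -/
lemma enorm_chainInt_succ_le {G : ℝ → Sp d → Sp d → ℝ} (n : ℕ) (t : ℝ) (x y : Sp d) :
    ‖chainInt a G (n + 1) t x y‖ₑ
      ≤ ∫⁻ w : ℝ × Sp d, ‖chainInt a a n w.1 x w.2‖ₑ * ‖G (t - w.1) w.2 y‖ₑ := by
  by_cases h : Integrable (chainTerm a G (n + 1) t x y)
  · rw [chainInt_succ h]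
    refine (enorm_integral_le_lintegral_enorm _).trans_eq ?_
    simp_rw [enorm_smul]
  · unfold chainInt
    rw [integral_undef h, enorm_zero]
    exact zero_le

lemma one_le_ofReal_exp_mul {l u : ℝ} (hl : 0 ≤ l) :
    timePow ρ u ≤ ENNReal.ofReal (Real.exp (l * u)) * timePow ρ u := by
  rcases le_or_gt u 0 with hu | hu
  · simp [timePow_of_nonpos hu]
  · refine le_mul_of_one_le_left zero_le ?_
    rw [ENNReal.one_le_ofReal]
    exact Real.one_le_exp (by positivity)

/-- The iterated kernels decay geometrically in `L^1` in the first variable. -/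
lemma exists_col_bound_chainInt (ham : Measurable fun q : ℝ × Sp d × Sp d => a q.1 q.2.1 q.2.2)
    (h0 : 0 ≤ ρ) (h1 : ρ < 1) (hC : C ≠ ∞)
    (hcol : ∀ u w, ∫⁻ z, ‖a u z w‖ₑ ≤ C * timePow ρ u) :
    ∃ l : ℝ, 0 ≤ l ∧ (∀ (n : ℕ) u w, ∫⁻ z, ‖chainInt a a n u z w‖ₑ
      ≤ C * 2⁻¹ ^ n * (ENNReal.ofReal (Real.exp (l * u)) * timePow ρ u)) ∧
      ∀ (n : ℕ) u w,
        ∫⁻ z, ∫⁻ v : ℝ × Sp d, ‖chainInt a a n v.1 z v.2‖ₑ * ‖a (u - v.1) v.2 w‖ₑ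
          ≤ C * 2⁻¹ ^ (n + 1) * (ENNReal.ofReal (Real.exp (l * u)) * timePow ρ u) := by
  -- With C κ ≤ 1/2, each convolution gains a factor 1/2 relative to the weight e^(lu) u^(-ρ).
  obtain ⟨l, hl, hl'⟩ := timePow_convolution_le h0 h1 (κ := (2 * (C + 1))⁻¹)
    (ENNReal.inv_pos.2 (by finiteness))
  have hm := measurable_timePow ρ
  have hκ : C * (2 * (C + 1))⁻¹ ≤ 2⁻¹ := by
    rw [ENNReal.mul_inv (by simp) (by simp), mul_left_comm]
    refine mul_le_of_le_one_right zero_le ?_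
    rw [← div_eq_mul_inv]
    exact ENNReal.div_le_of_le_mul (by rw [one_mul]; exact le_self_add)
  have step : ∀ n, (∀ u w, ∫⁻ z, ‖chainInt a a n u z w‖ₑ
      ≤ C * 2⁻¹ ^ n * (ENNReal.ofReal (Real.exp (l * u)) * timePow ρ u)) → ∀ u w,
      ∫⁻ z, ∫⁻ v : ℝ × Sp d, ‖chainInt a a n v.1 z v.2‖ₑ * ‖a (u - v.1) v.2 w‖ₑ
        ≤ C * 2⁻¹ ^ (n + 1) * (ENNReal.ofReal (Real.exp (l * u)) * timePow ρ u) := by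
    intro n ih u w
    have hK := measurable_chainInt ham ham n
    have hF : Measurable fun q : Sp d × (ℝ × Sp d) =>
        ‖chainInt a a n q.2.1 q.1 q.2.2‖ₑ * ‖a (u - q.2.1) q.2.2 w‖ₑ :=
      (hK.comp (f := fun q : Sp d × (ℝ × Sp d) => (q.2.1, q.1, q.2.2)) (by fun_prop)).enorm.mul
        (ham.comp (f := fun q : Sp d × (ℝ × Sp d) => (u - q.2.1, q.2.2, w)) (by fun_prop)).enorm
    have hA : Measurable fun v : ℝ × Sp d => ‖a (u - v.1) v.2 w‖ₑ :=
      (ham.comp (f := fun v : ℝ × Sp d => (u - v.1, v.2, w)) (by fun_prop)).enorm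
    calc _ = ∫⁻ v : ℝ × Sp d, (∫⁻ z, ‖chainInt a a n v.1 z v.2‖ₑ) * ‖a (u - v.1) v.2 w‖ₑ := by
          rw [lintegral_lintegral_swap hF.aemeasurable]
          refine lintegral_congr fun v => ?_
          exact lintegral_mul_const' _ _ enorm_ne_top
      _ ≤ ∫⁻ v : ℝ × Sp d, (C * 2⁻¹ ^ n * (ENNReal.ofReal (Real.exp (l * v.1)) * timePow ρ v.1))
            * ‖a (u - v.1) v.2 w‖ₑ := by
          refine lintegral_mono fun v => ?_
          exact mul_le_mul_left (ih _ _) _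
      _ = ∫⁻ s, (C * 2⁻¹ ^ n * (ENNReal.ofReal (Real.exp (l * s)) * timePow ρ s)) *
            ∫⁻ z, ‖a (u - s) z w‖ₑ := by
          rw [show (volume : Measure (ℝ × Sp d)) = (volume : Measure ℝ).prod volume from rfl,
            lintegral_prod _ (by fun_prop)]
          refine lintegral_congr fun s => ?_
          have := timePow_ne_top ρ s
          have h2 : C * 2⁻¹ ^ n * (ENNReal.ofReal (Real.exp (l * s)) * timePow ρ s) ≠ ∞ := by
            finiteness
          exact lintegral_const_mul' _ _ h2
      _ ≤ ∫⁻ s, (C * 2⁻¹ ^ n * (ENNReal.ofReal (Real.exp (l * s)) * timePow ρ s)) *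
            (C * timePow ρ (u - s)) := by
          gcongr with s
          exact hcol _ _
      _ = (C * 2⁻¹ ^ n * C) * ∫⁻ s, timePow ρ s * ENNReal.ofReal (Real.exp (l * s)) *
            timePow ρ (u - s) := by
          rw [← lintegral_const_mul _ (by fun_prop)]
          refine lintegral_congr fun s => ?_
          ring
      _ ≤ (C * 2⁻¹ ^ n * C) * ((2 * (C + 1))⁻¹ *
            (ENNReal.ofReal (Real.exp (l * u)) * timePow ρ u)) := by
          gcongr
          exact hl' u
      _ = (C * 2⁻¹ ^ n * (ENNReal.ofReal (Real.exp (l * u)) * timePow ρ u)) *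
            (C * (2 * (C + 1))⁻¹) := by ring
      _ ≤ (C * 2⁻¹ ^ n * (ENNReal.ofReal (Real.exp (l * u)) * timePow ρ u)) * 2⁻¹ := by gcongr
      _ = _ := by ring
  have main : ∀ (n : ℕ) u w, ∫⁻ z, ‖chainInt a a n u z w‖ₑ
      ≤ C * 2⁻¹ ^ n * (ENNReal.ofReal (Real.exp (l * u)) * timePow ρ u) := by
    intro n
    induction n with
    | zero =>
      intro u w
      simp_rw [chainInt_zero, pow_zero, mul_one]
      exact (hcol u w).trans (by gcongr; exact one_le_ofReal_exp_mul hl)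
    | succ n ih =>
      exact fun u w =>
        (lintegral_mono fun z => enorm_chainInt_succ_le n u z w).trans (step n ih u w)
  exact ⟨l, hl, main, fun n => step n (main n)⟩

/-- The convolutions of the iterated kernels with the occupation measure tend to zero. -/
lemma tendsto_occConv_chainInt (ham : Measurable fun q : ℝ × Sp d × Sp d => a q.1 q.2.1 q.2.2)
    (h0 : 0 ≤ ρ) (h1 : ρ < 1) (hC : C ≠ ∞)
    (hcol : ∀ u w, ∫⁻ z, ‖a u z w‖ₑ ≤ C * timePow ρ u) (hP : IsMainSemigroup T P) (x : Sp d)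
    (t : ℝ) : ∀ᵐ z, Tendsto (fun n => occConv (chainInt a a n) hP x t z) atTop (𝓝 0) := by
  obtain ⟨l, hl, hlb, -⟩ := exists_col_bound_chainInt ham h0 h1 hC hcol
  have hm := measurable_timePow ρ
  set M := C * ENNReal.ofReal (Real.exp (l * t)) * ∫⁻ s in Set.Ioo 0 T, timePow ρ (t - s)
  have hM : M ≠ ∞ := by
    have := (lintegral_timePow_sub_lt_top h1 T t).ne
    finiteness
  have hmK := fun n => measurable_occConv (measurable_chainInt ham ham n) hP x
  have hmK' : ∀ n, Measurable fun z => occConv (chainInt a a n) hP x t z := fun n =>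
    (hmK n).comp (f := fun z : Sp d => (t, z)) (by fun_prop)
  have key : ∀ n, ∫⁻ z, ‖occConv (chainInt a a n) hP x t z‖ₑ ≤ M * 2⁻¹ ^ n := by
    intro n
    calc _ ≤ ∫⁻ z, (∫⁻ q, ‖chainInt a a n (t - q.1) z q.2‖ₑ ∂(occ hP x T)) :=
          lintegral_mono fun z => enorm_integral_le_lintegral_enorm _
      _ = ∫⁻ q, (∫⁻ z, ‖chainInt a a n (t - q.1) z q.2‖ₑ) ∂(occ hP x T) :=
          lintegral_lintegral_swap
            (measurable_kernel_occ (measurable_chainInt ham ham n) t).enorm.aemeasurable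
      _ ≤ ∫⁻ q, C * 2⁻¹ ^ n * (ENNReal.ofReal (Real.exp (l * (t - q.1))) * timePow ρ (t - q.1))
            ∂(occ hP x T) := lintegral_mono fun q => hlb _ _ _
      _ ≤ ∫⁻ s in Set.Ioo 0 T,
            C * 2⁻¹ ^ n * (ENNReal.ofReal (Real.exp (l * (t - s))) * timePow ρ (t - s)) :=
          lintegral_occ_fst_le hP x T (f := fun s =>
            C * 2⁻¹ ^ n * (ENNReal.ofReal (Real.exp (l * (t - s))) * timePow ρ (t - s)))
            (by fun_prop)
      _ ≤ ∫⁻ s in Set.Ioo 0 T,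
            C * 2⁻¹ ^ n * ENNReal.ofReal (Real.exp (l * t)) * timePow ρ (t - s) := by
          refine setLIntegral_mono (by fun_prop) fun s hs => ?_
          rw [← mul_assoc]
          gcongr
          linarith [hs.1]
      _ = M * 2⁻¹ ^ n := by
          rw [lintegral_const_mul _ (by fun_prop)]
          ring
  -- Summable L¹ norms give convergence to zero almost everywhere along the whole sequence; L¹
  -- convergence alone would give it along a subsequence.
  have hsum : ∫⁻ z, ∑' n, ‖occConv (chainInt a a n) hP x t z‖ₑ ≠ ∞ := by
    rw [lintegral_tsum fun n => (hmK' n).enorm.aemeasurable]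
    refine ne_top_of_le_ne_top ?_ (ENNReal.tsum_le_tsum key)
    rw [ENNReal.tsum_mul_left, ENNReal.tsum_geometric]
    exact ENNReal.mul_ne_top hM (by simp)
  filter_upwards [ae_lt_top (by exact Measurable.ennreal_tsum fun n => (hmK' n).enorm) hsum]
    with z hz
  have := ENNReal.tendsto_atTop_zero_of_tsum_ne_top hz.ne
  rw [tendsto_zero_iff_norm_tendsto_zero]
  have h2 := (ENNReal.tendsto_toReal ENNReal.zero_ne_top).comp this
  simpa [Function.comp_def, toReal_enorm] using h2

end Iteration

end

section

/-! ### The Neumann series -/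

variable {d : ℕ} {T : ℝ} {P : ℝ → Kernel (Sp d) (Sp d)} {p : Sp d → ℝ → Sp d → Sp d → ℝ}
  {θ : ℝ → Sp d → Sp d → ℝ} {γ β : ℝ → Sp d → Sp d → ℝ≥0} {ρ : ℝ}

/-- Reflection of the time variable. -/
def timeReflect (d : ℕ) (t : ℝ) : ℝ × Sp d ≃ᵐ ℝ × Sp d :=
  (MeasurableEquiv.subLeft t).prodCongr (MeasurableEquiv.refl _)

lemma measurePreserving_timeReflect (t : ℝ) : MeasurePreserving (timeReflect d t) :=
  (Measure.measurePreserving_sub_left volume t).prod (MeasurePreserving.id volume)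

lemma integral_timeReflect (t : ℝ) (f : ℝ × Sp d → ℝ) :
    ∫ r : ℝ × Sp d, f (t - r.1, r.2) = ∫ r, f r :=
  (measurePreserving_timeReflect t).integral_comp (timeReflect d t).measurableEmbedding f

lemma integrable_timeReflect {t : ℝ} {f : ℝ × Sp d → ℝ} (hf : Integrable f) :
    Integrable fun r : ℝ × Sp d => f (t - r.1, r.2) :=
  ((measurePreserving_timeReflect t).integrable_comp_emb
    (timeReflect d t).measurableEmbedding).2 hf

lemma lintegral_timeReflect (t : ℝ) (f : ℝ × Sp d → ℝ≥0∞) :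
    ∫⁻ r : ℝ × Sp d, f (t - r.1, r.2) = ∫⁻ r, f r :=
  (measurePreserving_timeReflect t).lintegral_comp_emb (timeReflect d t).measurableEmbedding f

lemma occConv_of_nonpos {a : ℝ → Sp d → Sp d → ℝ} (ha : ∀ t ≤ 0, ∀ x y, a t x y = 0)
    (hP : IsMainSemigroup T P) (x : Sp d) {t : ℝ} (ht : t ≤ 0) (z : Sp d) :
    occConv a hP x t z = 0 := by
  unfold occConv
  refine integral_eq_zero_of_ae ?_
  filter_upwards [ae_occ_mem hP x T] with q hq
  exact ha _ (by linarith [hq.1]) _ _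

/-- Almost every section of the convolution integrals is integrable. -/
lemma ae_integrable_chainInt_mul {C : ℝ≥0∞} {a : ℝ → Sp d → Sp d → ℝ}
    (ham : Measurable fun q : ℝ × Sp d × Sp d => a q.1 q.2.1 q.2.2)
    (h0 : 0 ≤ ρ) (h1 : ρ < 1) (hC : C ≠ ∞)
    (hcol : ∀ u w, ∫⁻ z, ‖a u z w‖ₑ ≤ C * timePow ρ u) (hP : IsMainSemigroup T P) (x : Sp d)
    (t : ℝ) (n : ℕ) : ∀ᵐ z, Integrable (fun q : (ℝ × Sp d) × (ℝ × Sp d) =>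
      chainInt a a n (t - q.1.1) z q.1.2 * a (q.1.1 - q.2.1) q.1.2 q.2.2)
      (volume.prod (occ hP x T)) := by
  obtain ⟨l, hl, -, hlb⟩ := exists_col_bound_chainInt ham h0 h1 hC hcol
  have hm := measurable_timePow ρ
  have hK := measurable_chainInt ham ham n
  have hF : Measurable fun q : Sp d × ((ℝ × Sp d) × (ℝ × Sp d)) =>
      chainInt a a n (t - q.2.1.1) q.1 q.2.1.2 * a (q.2.1.1 - q.2.2.1) q.2.1.2 q.2.2.2 :=
    (hK.comp (f := fun q : Sp d × ((ℝ × Sp d) × (ℝ × Sp d)) => (t - q.2.1.1, q.1, q.2.1.2))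
      (by fun_prop)).mul
      (ham.comp (f := fun q : Sp d × ((ℝ × Sp d) × (ℝ × Sp d)) =>
        (q.2.1.1 - q.2.2.1, q.2.1.2, q.2.2.2)) (by fun_prop))
  have key : ∫⁻ z, (∫⁻ q : (ℝ × Sp d) × (ℝ × Sp d),
      ‖chainInt a a n (t - q.1.1) z q.1.2 * a (q.1.1 - q.2.1) q.1.2 q.2.2‖ₑ
        ∂(volume.prod (occ hP x T))) ≠ ∞ := by
    refine ne_top_of_le_ne_top (b := ∫⁻ q, C * 2⁻¹ ^ (n + 1) *
      (ENNReal.ofReal (Real.exp (l * (t - q.1))) * timePow ρ (t - q.1)) ∂(occ hP x T)) ?_ ?_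
    · refine ((lintegral_occ_fst_le hP x T (f := fun s => C * 2⁻¹ ^ (n + 1) *
        (ENNReal.ofReal (Real.exp (l * (t - s))) * timePow ρ (t - s))) (by fun_prop)).trans_lt ?_).ne
      calc _ ≤ ∫⁻ s in Set.Ioo 0 T, C * 2⁻¹ ^ (n + 1) * ENNReal.ofReal (Real.exp (l * t)) *
              timePow ρ (t - s) := by
            refine setLIntegral_mono (by fun_prop) fun s hs => ?_
            rw [← mul_assoc]
            gcongr
            linarith [hs.1]
        _ < ∞ := by
            rw [lintegral_const_mul _ (by fun_prop)]
            have := (lintegral_timePow_sub_lt_top h1 T t).ne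
            finiteness
    -- After an exchange of integrals and a reflection of time at t, the inner integral is a
    -- convolution of the iterated kernel with a, over the elapsed time t - q.1.
    · have hz : ∀ z, ∫⁻ q : (ℝ × Sp d) × (ℝ × Sp d),
          ‖chainInt a a n (t - q.1.1) z q.1.2 * a (q.1.1 - q.2.1) q.1.2 q.2.2‖ₑ
            ∂(volume.prod (occ hP x T))
          = ∫⁻ q, (∫⁻ v : ℝ × Sp d, ‖chainInt a a n v.1 z v.2‖ₑ *
              ‖a (t - q.1 - v.1) v.2 q.2‖ₑ) ∂(occ hP x T) := fun z => by
        rw [lintegral_prod_symm _ (by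
          exact (hF.comp (f := fun q => (z, q)) (by fun_prop)).enorm.aemeasurable)]
        refine lintegral_congr fun q => ?_
        rw [← lintegral_timeReflect t]
        refine lintegral_congr fun v => ?_
        rw [enorm_mul]
        dsimp only
        rw [sub_sub_cancel, show t - v.1 - q.1 = t - q.1 - v.1 by ring]
      simp_rw [hz]
      have hG : Measurable fun r : (Sp d × (ℝ × Sp d)) × (ℝ × Sp d) =>
          ‖chainInt a a n r.2.1 r.1.1 r.2.2‖ₑ * ‖a (t - r.1.2.1 - r.2.1) r.2.2 r.1.2.2‖ₑ :=
        (hK.comp (f := fun r : (Sp d × (ℝ × Sp d)) × (ℝ × Sp d) => (r.2.1, r.1.1, r.2.2))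
          (by fun_prop)).enorm.mul
          (ham.comp (f := fun r : (Sp d × (ℝ × Sp d)) × (ℝ × Sp d) =>
            (t - r.1.2.1 - r.2.1, r.2.2, r.1.2.2)) (by fun_prop)).enorm
      rw [lintegral_lintegral_swap (by exact hG.lintegral_prod_right'.aemeasurable)]
      exact lintegral_mono fun q => hlb n (t - q.1) q.2
  filter_upwards [ae_lt_top (by exact hF.enorm.lintegral_prod_right') key] with z hz
  exact ⟨(hF.comp (f := fun q => (z, q)) (by fun_prop)).aestronglyMeasurable, hz⟩

/-! ### Iteration of the Volterra equation. -/

section Occ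

variable (hP : IsMainSemigroup T P) (hp : IsFrozenFamily T p)
    (hL : GeneratorsAgree T P p) (hreg : BackwardRegularity T P p) (hθ : IsBackwardWeight T P p θ)
    (hdom : BackwardDomination T p θ γ β ρ) {A : ℝ≥0∞}
    (ha : DominatedKernel T ρ γ A (trunc T (aHat p θ)))
    (hphi : ContinuousOn (fun q : ℝ × Sp d × Sp d => phi p q.1 q.2.1 q.2.2)
      (Set.Ioc 0 T ×ˢ Set.univ))
    (haHat : ContinuousOn (fun q : ℝ × Sp d × Sp d => aHat p θ q.1 q.2.1 q.2.2)
      (Set.Ioc 0 T ×ˢ Set.univ))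
include hp hL hreg hθ hdom ha hphi haHat

/-- One step of the iteration of the Volterra equation. -/
lemma occConv_chainInt_eq (x : Sp d) {t : ℝ} (ht : t ∈ Set.Ioo 0 T) (n : ℕ)
    (hint : ∀ z, Integrable (chainTerm (trunc T (aHat p θ)) (trunc T (phi p)) (n + 1) t z x)) :
    ∀ᵐ z, occConv (chainInt (trunc T (aHat p θ)) (trunc T (aHat p θ)) n) hP x t z
      = chainInt (trunc T (aHat p θ)) (trunc T (phi p)) (n + 1) t z x
        + occConv (chainInt (trunc T (aHat p θ)) (trunc T (aHat p θ)) (n + 1)) hP x t z := by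
  obtain ⟨C, hC, hcol⟩ := hdom.exists_col_bound ha
  set a := trunc T (aHat p θ) with ha_def
  filter_upwards [ae_integrable_chainInt_mul ha.meas ha.rho_nonneg ha.rho_lt_one hC hcol hP x t n]
    with z hz
  -- The occupation measure is replaced by its density, which is itself a frozen density plus a
  -- convolution. The integrand vanishes outside (0, T), so the time restriction can be dropped.
  have e1 : occConv (chainInt a a n) hP x t z
      = ∫ r : ℝ × Sp d, chainInt a a n (t - r.1) z r.2 * occDensity p θ hP x r := by
    unfold occConv
    rw [integral_occ_eq hP hp hL hreg hθ hdom ha hphi haHat x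
      (fun q => chainInt a a n (t - q.1) z q.2)]
    refine setIntegral_eq_integral_of_forall_compl_eq_zero fun r hr => ?_
    simp only [Set.mem_prod, Set.mem_Ioo, Set.mem_univ, and_true, not_and_or, not_lt] at hr
    rcases hr with hr | hr
    · unfold occDensity
      rw [trunc_of_nonpos hr, occConv_of_nonpos ha.zero_of_nonpos hP x hr, add_zero, mul_zero]
    · rw [chainInt_of_nonpos ha.zero_of_nonpos ha.zero_of_nonpos n (by linarith [ht.2]), zero_mul]
  have hi1 : Integrable fun r : ℝ × Sp d =>
      chainInt a a n (t - r.1) z r.2 * trunc T (phi p) r.1 r.2 x := by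
    have := integrable_timeReflect (t := t) (integrable_chainInt_smul (hint z))
    simpa using this
  have hi2 : Integrable fun r : ℝ × Sp d =>
      chainInt a a n (t - r.1) z r.2 * occConv a hP x r.1 r.2 := by
    have := hz.integral_prod_left
    simp only [integral_const_mul] at this
    exact this
  rw [e1]
  unfold occDensity
  simp_rw [mul_add]
  rw [integral_add hi1 hi2]
  congr 1
  · rw [chainInt_succ (hint z), ← integral_timeReflect t]
    simp
  · have e2 : ∀ r : ℝ × Sp d, chainInt a a n (t - r.1) z r.2 * occConv a hP x r.1 r.2
        = ∫ q, chainInt a a n (t - r.1) z r.2 * a (r.1 - q.1) r.2 q.2 ∂(occ hP x T) := fun r =>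
      (integral_const_mul _ _).symm
    simp_rw [e2]
    -- By Fubini's theorem the middle point is integrated first, which composes the iterated kernel
    -- with a and gives the next iterated kernel.
    rw [integral_integral_swap (f := fun (r q : ℝ × Sp d) =>
      chainInt a a n (t - r.1) z r.2 * a (r.1 - q.1) r.2 q.2) hz]
    unfold occConv
    refine integral_congr_ae ?_
    filter_upwards [ae_occ_mem hP x T] with q hq
    rw [chainInt_succ (hdom.gamma_class.integrable_chainTerm ha (n + 1)
      (by linarith [hq.1, ht.2]) z q.2), ← integral_timeReflect t]
    refine integral_congr_ae (.of_forall fun r => ?_)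
    simp only [smul_eq_mul]
    rw [sub_sub_cancel, show t - r.1 - q.1 = t - q.1 - r.1 by ring]

/-- The density of the main semigroup is the sum of the parametrix series. -/
lemma occDensity_eq_tsum (x : Sp d) {t : ℝ} (ht : t ∈ Set.Ioo 0 T)
    (hint : ∀ n z, Integrable (chainTerm (trunc T (aHat p θ)) (trunc T (phi p)) n t z x))
    (hsum : ∀ z, Summable fun n => chainInt (trunc T (aHat p θ)) (trunc T (phi p)) n t z x) :
    ∀ᵐ z, occDensity p θ hP x (t, z)
      = ∑' n, chainInt (trunc T (aHat p θ)) (trunc T (phi p)) n t z x := by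
  obtain ⟨C, hC, hcol⟩ := hdom.exists_col_bound ha
  filter_upwards [ae_all_iff.2 fun n => occConv_chainInt_eq hP hp hL hreg hθ hdom ha hphi haHat x ht
    n (hint (n + 1)), tendsto_occConv_chainInt ha.meas ha.rho_nonneg ha.rho_lt_one hC hcol hP x t]
    with z hz hlim
  set a := trunc T (aHat p θ) with ha_def
  have key : ∀ n, occDensity p θ hP x (t, z)
      = ∑ i ∈ Finset.range (n + 1), chainInt a (trunc T (phi p)) i t z x
        + occConv (chainInt a a n) hP x t z := by
    intro n
    induction n with
    | zero =>
      have : occConv (chainInt a a 0) hP x t z = occConv a hP x t z := by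
        unfold occConv
        simp_rw [chainInt_zero]
      simp only [zero_add, Finset.range_one, Finset.sum_singleton, chainInt_zero, this]
      rfl
    | succ n ih => rw [ih, hz n, Finset.sum_range_succ _ (n + 1)]; ring
  have h1 := ((hsum z).hasSum.tendsto_sum_nat.comp (tendsto_add_atTop_nat 1)).add hlim
  rw [add_zero] at h1
  refine tendsto_nhds_unique (Tendsto.congr (fun n => key n) tendsto_const_nhds) h1

include hP in
/-- The main semigroup is given by the sum of the parametrix series. -/
lemma kernelOp_eq_integral_tsum
    (hint : ∀ t ∈ Set.Ioc 0 T, ∀ n z x,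
      Integrable (chainTerm (trunc T (aHat p θ)) (trunc T (phi p)) n t z x))
    (hsum : ∀ t ∈ Set.Ioc 0 T, ∀ z x,
      Summable fun n => chainInt (trunc T (aHat p θ)) (trunc T (phi p)) n t z x)
    (hcont : ContinuousOn (fun q : ℝ × Sp d × Sp d =>
      ∑' n, chainInt (trunc T (aHat p θ)) (trunc T (phi p)) n q.1 q.2.1 q.2.2)
      (Set.Ioc 0 T ×ˢ Set.univ))
    {t : ℝ} (ht : t ∈ Set.Ioc 0 T) (x : Sp d) {f : Sp d → ℝ} (hf : IsTest f) :
    kernelOp P t f x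
      = ∫ z, f z * ∑' n, chainInt (trunc T (aHat p θ)) (trunc T (phi p)) n t z x := by
  set S : ℝ → Sp d → Sp d → ℝ := fun t z x =>
    ∑' n, chainInt (trunc T (aHat p θ)) (trunc T (phi p)) n t z x with hS
  have hlt : ∀ t ∈ Set.Ioo 0 T, kernelOp P t f x = ∫ z, f z * S t z x := by
    intro t ht
    have ht' : t ∈ Set.Ioc 0 T := ⟨ht.1, ht.2.le⟩
    rw [volterra_isTest hP hp hL hreg hθ hdom ha hphi haHat ht x hf]
    refine integral_congr_ae ?_
    filter_upwards [occDensity_eq_tsum hP hp hL hreg hθ hdom ha hphi haHat x ht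
      (fun n z => hint t ht' n z x) (fun z => hsum t ht' z x)] with z hz
    unfold occDensity at hz
    rw [trunc_of_mem ht'] at hz
    rw [hz]
  rcases ht.2.lt_or_eq with h | rfl
  · exact hlt t ⟨ht.1, h⟩
  -- Only the final time is left, and t now stands for T. Both sides are continuous from the left
  -- there.
  have hc : ContinuousOn (fun u => ∫ z, f z * S u z x) (Set.Ioc 0 t) := by
    refine continuousOn_integral_of_compact_support (k := tsupport f) hf.2 ?_ ?_
    · refine (hf.1.continuous.comp continuous_snd).continuousOn.mul ?_
      exact hcont.comp (f := fun q : ℝ × Sp d => (q.1, q.2, x)) (by fun_prop)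
        fun q hq => ⟨hq.1, Set.mem_univ _⟩
    · intro u z _ hz
      rw [image_eq_zero_of_notMem_tsupport hz, zero_mul]
  have h1 : Tendsto (fun u => ∫ z, f z * S u z x) (𝓝[<] t) (𝓝 (∫ z, f z * S t z x)) := by
    refine (hc t ht).tendsto.mono_left ?_
    rw [← nhdsWithin_Ioo_eq_nhdsLT ht.1]
    exact nhdsWithin_mono _ Set.Ioo_subset_Ioc_self
  have h2 : Tendsto (fun u => kernelOp P u f x) (𝓝[<] t) (𝓝 (kernelOp P t f x)) := by
    have hst : StrongAt (kernelOp P) f := by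
      refine (hP.test_dom f hf).strongAt ?_
      filter_upwards [Ioo_mem_nhdsGT ht.1] with u hu
      exact hP.bddMeas_kernelOp ⟨hu.1.le, hu.2.le⟩ hf.bddMeas
    rw [Metric.tendsto_nhds]
    intro ε hε
    obtain ⟨δ, hδ, hd⟩ := hst (ε / 2) (by positivity)
    filter_upwards [Ioo_mem_nhdsLT (show max 0 (t - δ) < t from max_lt ht.1 (by linarith))]
      with u hu
    have hu0 : 0 < u := (le_max_left _ _).trans_lt hu.1
    have huδ : t - δ < u := (le_max_right _ _).trans_lt hu.1
    have hu1 : u ∈ Set.Icc 0 t := ⟨hu0.le, hu.2.le⟩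
    have hu2 : t - u ∈ Set.Icc 0 t := ⟨by linarith [hu.2], by linarith⟩
    -- P_t f - P_u f = P_u (P_{t-u} f - f), and P_u is a contraction.
    have e := hP.kernelOp_add hu1 hu2 hf.bddMeas x
    rw [add_sub_cancel] at e
    rw [dist_comm, Real.dist_eq, e,
      ← kernelOp_sub (hP.bddMeas_kernelOp hu2 hf.bddMeas) hf.bddMeas ⟨hP.finite u hu0.le x⟩]
    refine (hP.abs_kernelOp_le hu1 (by positivity)
      (hd (t - u) (by linarith [hu.2]) (by linarith)) x).trans_lt (by linarith)
  refine tendsto_nhds_unique (h2.congr' ?_) h1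
  filter_upwards [Ioo_mem_nhdsLT ht.1] with u hu
  exact hlt u hu

end Occ

end

section

/-! ### The transition density as a sum of chain integrals -/

variable {d : ℕ} {T : ℝ} {P : ℝ → Kernel (Sp d) (Sp d)} {p : Sp d → ℝ → Sp d → Sp d → ℝ}
  {θ : ℝ → Sp d → Sp d → ℝ} {γ β : ℝ → Sp d → Sp d → ℝ≥0} {ρ : ℝ}

/-- Nothing is needed of f at times outside (0, T], where the truncation is zero. -/
lemma measurable_trunc_of_continuousOn {F : Type*} [NormedAddCommGroup F] [MeasurableSpace F]
    [BorelSpace F] {f : ℝ → Sp d → Sp d → F}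
    (hf : ContinuousOn (fun q : ℝ × Sp d × Sp d => f q.1 q.2.1 q.2.2) (Set.Ioc 0 T ×ˢ Set.univ)) :
    Measurable fun q : ℝ × Sp d × Sp d => trunc T f q.1 q.2.1 q.2.2 := by
  classical
  have : (fun q : ℝ × Sp d × Sp d => trunc T f q.1 q.2.1 q.2.2)
      = (Set.Ioc 0 T ×ˢ Set.univ).piecewise (fun q => f q.1 q.2.1 q.2.2) fun _ => 0 := by
    funext q
    by_cases h : q.1 ∈ Set.Ioc 0 T
    · rw [trunc_of_mem h, Set.piecewise_eq_of_mem _ _ _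
        (show q ∈ Set.Ioc 0 T ×ˢ Set.univ from ⟨h, Set.mem_univ _⟩)]
    · rw [trunc_of_notMem h, Set.piecewise_eq_of_notMem _ _ _ fun h' => h h'.1]
  rw [this]
  exact hf.measurable_piecewise continuousOn_const (measurableSet_Ioc.prod MeasurableSet.univ)

lemma continuousOn_trunc {F : Type*} [NormedAddCommGroup F] {f : ℝ → Sp d → Sp d → F}
    (hf : ContinuousOn (fun q : ℝ × Sp d × Sp d => f q.1 q.2.1 q.2.2) (Set.Ioc 0 T ×ˢ Set.univ)) :
    ContinuousOn (fun q : ℝ × Sp d × Sp d => trunc T f q.1 q.2.1 q.2.2)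
      (Set.Ioc 0 T ×ˢ Set.univ) :=
  hf.congr fun _ hq => trunc_of_mem hq.1 _ _ _

lemma BackwardDomination.exists_dominatedKernel (hdom : BackwardDomination T p θ γ β ρ)
    (haHat : ContinuousOn (fun q : ℝ × Sp d × Sp d => aHat p θ q.1 q.2.1 q.2.2)
      (Set.Ioc 0 T ×ˢ Set.univ)) :
    ∃ A, DominatedKernel T ρ γ A (trunc T (aHat p θ)) := by
  obtain ⟨C, hC⟩ := hdom.bound
  -- The hypothesis does not fix the sign of C.
  refine ⟨ENNReal.ofReal |C|, measurable_trunc_of_continuousOn haHat,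
    fun t ht x y => trunc_of_notMem ht _ _ _, fun t x y => ?_, ENNReal.ofReal_ne_top,
    hdom.rho_nonneg, hdom.rho_lt_one⟩
  by_cases ht : t ∈ Set.Ioc 0 T
  · rw [trunc_of_mem ht, timePow_of_pos ht.1, ← ENNReal.ofReal_mul (abs_nonneg _),
      ← ofReal_norm, ← ENNReal.ofReal_coe_nnreal, ← ENNReal.ofReal_mul
        (mul_nonneg (abs_nonneg _) (Real.rpow_nonneg ht.1.le _))]
    refine ENNReal.ofReal_le_ofReal ((hC t ht x y).trans ?_)
    rw [div_eq_mul_inv, ← Real.rpow_neg ht.1.le]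
    have := Real.rpow_nonneg ht.1.le (-ρ)
    gcongr
    exact le_abs_self C
  · rw [trunc_of_notMem ht, enorm_zero]
    exact zero_le

section Density

variable {A : ℝ≥0∞} {r ζ : ℝ} {Ξ : ℝ → ℝ≥0∞} (hp : IsFrozenFamily T p)
  (hdom : BackwardDomination T p θ γ β ρ)
  (ha : DominatedKernel T ρ γ A (trunc T (aHat p θ)))
  (hb : ChainBounds T r ζ Ξ (trunc T (aHat p θ)) (trunc T (phi p))) (hr : 0 < r)
  (hΞ : ∀ t₀ > (0 : ℝ), ∃ M : ℝ≥0∞, M ≠ ∞ ∧ ∀ t ∈ Set.Icc t₀ T, Ξ t ≤ M)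
include hp hdom ha hb hr hΞ

lemma summable_seriesTerm {t : ℝ} (ht : t ∈ Set.Ioc 0 T) (x y : Sp d) :
    Summable fun n => seriesTerm p θ n t x y := by
  have hs := hb.summable hr hΞ ht y x
  rw [← summable_nat_add_iff 1] at hs
  refine hs.congr fun n => ?_
  exact (seriesTerm_eq_chainInt hdom.gamma_class ha ht
    (hb.integrable hr hΞ ha.meas (measurable_trunc hp.measurable_phi) _ ht y x)).symm

lemma transDensity_eq_tsum {t : ℝ} (ht : t ∈ Set.Ioc 0 T) (x y : Sp d) :
    transDensity p θ t x y
      = ∑' n, chainInt (trunc T (aHat p θ)) (trunc T (phi p)) n t y x := by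
  rw [(hb.summable hr hΞ ht y x).tsum_eq_zero_add, chainInt_zero, trunc_of_mem ht]
  unfold transDensity
  congr 1
  refine tsum_congr fun n => ?_
  exact seriesTerm_eq_chainInt hdom.gamma_class ha ht
    (hb.integrable hr hΞ ha.meas (measurable_trunc hp.measurable_phi) _ ht y x)

end Density

end

section

/-! ### Jump times of the Poisson process -/

section Poisson

variable {Ω : Type*} [MeasurableSpace Ω] {μ : Measure Ω} {τ : ℕ → Ω → ℝ}

/-- The first `n` jump times. -/
def jumpTuple (τ : ℕ → Ω → ℝ) (n : ℕ) (ω : Ω) (i : Fin n) : ℝ := τ (i + 1) ω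

lemma jumpTuple_succ (n : ℕ) (ω : Ω) :
    jumpTuple τ (n + 1) ω = Fin.snoc (jumpTuple τ n ω) (τ (n + 1) ω) := by
  funext i
  refine Fin.lastCases ?_ (fun j => ?_) i <;> simp [jumpTuple]

namespace IsPoissonJumpTimes

variable (hτ : IsPoissonJumpTimes μ τ)
include hτ

lemma path_jumpTuple {n : ℕ} (ω : Ω) (i : Fin (n + 1)) :
    path 0 (jumpTuple τ n ω) i = τ i ω := by
  refine Fin.cases ?_ (fun j => ?_) i
  · simp [path, hτ.zero]
  · rw [path_succ]; simp [jumpTuple]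

lemma pathEnd_jumpTuple (n : ℕ) (ω : Ω) : pathEnd 0 (jumpTuple τ n ω) = τ n ω := by
  unfold pathEnd
  rw [hτ.path_jumpTuple]
  simp

lemma measurable_jumpTuple (n : ℕ) : Measurable (jumpTuple τ n) :=
  measurable_pi_lambda _ fun i => hτ.meas _

/-- The first n jump times are partial sums of the first n waiting times, which are independent of
the next one. -/
lemma indepFun_jumpTuple (n : ℕ) :
    IndepFun (jumpTuple τ n) (fun ω => τ (n + 1) ω - τ n ω) μ := by
  have hm : ∀ i, Measurable fun ω => τ (i + 1) ω - τ i ω := fun i => (hτ.meas _).sub (hτ.meas _)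
  have h := hτ.indep.indepFun_finset (Finset.range n) {n} (by simp) hm
  let φ : ((i : Finset.range n) → ℝ) → Fin n → ℝ := fun g i =>
    ∑ k ∈ Finset.range (i + 1), if h : k ∈ Finset.range n then g ⟨k, h⟩ else 0
  have hφ : Measurable φ := by
    refine measurable_pi_lambda _ fun i => Finset.measurable_sum _ fun k _ => ?_
    split_ifs <;> fun_prop
  have h2 := h.comp hφ (measurable_pi_apply (⟨n, by simp⟩ : ({n} : Finset ℕ)))
  convert h2 using 1
  swap
  · rfl
  funext ω i
  have : ∀ k ∈ Finset.range ((i : ℕ) + 1),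
      (if h : k ∈ Finset.range n then τ (k + 1) ω - τ k ω else 0) = τ (k + 1) ω - τ k ω :=
    fun k hk => by
      have h1 := i.2
      have h2 := Finset.mem_range.1 hk
      rw [dif_pos (Finset.mem_range.2 (by omega))]
  simp only [Function.comp_apply, φ]
  rw [Finset.sum_congr rfl this, Finset.sum_range_sub (fun k => τ k ω), hτ.zero, sub_zero]
  rfl

omit hτ in
lemma measurable_exp_weight (n : ℕ) :
    Measurable fun s : Fin n → ℝ => chainWeight (fun a b => exponentialPDF 1 (b - a)) 0 s := by
  have h1 : Measurable (exponentialPDF 1) := (measurable_exponentialPDFReal 1).ennreal_ofReal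
  generalize exponentialPDF 1 = f at h1 ⊢
  have h2 : Measurable fun q : ℝ × ℝ => f (q.2 - q.1) := by fun_prop
  exact (measurable_chainWeight (n := n) (ℓ := fun a b => f (b - a)) h2).comp
    (measurable_const.prodMk measurable_id)

omit hτ in
lemma lintegral_expMeasure_add (c : ℝ) {f : ℝ → ℝ≥0∞} (hf : Measurable f) :
    ∫⁻ g, f (c + g) ∂(expMeasure 1) = ∫⁻ u, exponentialPDF 1 (u - c) * f u := by
  have hpdf : Measurable (exponentialPDF 1) := (measurable_exponentialPDFReal 1).ennreal_ofReal
  rw [show expMeasure 1 = volume.withDensity (exponentialPDF 1) from rfl,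
    lintegral_withDensity_eq_lintegral_mul _ hpdf (by fun_prop),
    ← lintegral_add_left_eq_self (fun u => exponentialPDF 1 (u - c) * f u) c]
  simp_rw [add_sub_cancel_left]
  rfl

/-- The law of the first `n` jump times. -/
lemma lintegral_jumpTuple [IsProbabilityMeasure μ] (n : ℕ) {F : (Fin n → ℝ) → ℝ≥0∞}
    (hF : Measurable F) :
    ∫⁻ ω, F (jumpTuple τ n ω) ∂μ
      = ∫⁻ s : Fin n → ℝ, chainWeight (fun a b => exponentialPDF 1 (b - a)) 0 s * F s := by
  have hpdf : Measurable (exponentialPDF 1) := (measurable_exponentialPDFReal 1).ennreal_ofReal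
  induction n with
  | zero =>
    rw [lintegral_fin_zero, chainWeight_zero, one_mul]
    have : ∀ ω, jumpTuple τ 0 ω = Fin.elim0 := fun ω => by funext i; exact i.elim0
    simp_rw [this]
    simp
  | succ n ih =>
    have hE : Measurable fun s : Fin n → ℝ => pathEnd 0 s :=
      measurable_pathEnd.comp (measurable_const.prodMk measurable_id)
    have hgm : Measurable fun ω => τ (n + 1) ω - τ n ω := (hτ.meas _).sub (hτ.meas _)
    have hW := measurable_exp_weight n
    have hH : Measurable fun q : (Fin n → ℝ) × ℝ =>
        F (Fin.snoc q.1 (pathEnd 0 q.1 + q.2) : Fin (n + 1) → ℝ) :=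
      hF.comp (measurable_snoc.comp (f := fun q : (Fin n → ℝ) × ℝ => (pathEnd 0 q.1 + q.2, q.1))
        (by fun_prop))
    have e1 : ∀ ω, F (jumpTuple τ (n + 1) ω)
        = F (Fin.snoc (jumpTuple τ n ω) (pathEnd 0 (jumpTuple τ n ω) + (τ (n + 1) ω - τ n ω)) :
            Fin (n + 1) → ℝ) := fun ω => by
      rw [hτ.pathEnd_jumpTuple, add_sub_cancel, jumpTuple_succ]
    have e2 := (indepFun_iff_map_prod_eq_prod_map_map (hτ.measurable_jumpTuple n).aemeasurable
      hgm.aemeasurable).1 (hτ.indepFun_jumpTuple n)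
    simp_rw [e1]
    rw [← lintegral_map (μ := μ) hH ((hτ.measurable_jumpTuple n).prodMk hgm), e2, hτ.law n]
    have := isProbabilityMeasure_expMeasure one_pos
    rw [lintegral_prod _ hH.aemeasurable,
      lintegral_map hH.lintegral_prod_right' (hτ.measurable_jumpTuple n)]
    rw [ih (F := fun s => ∫⁻ g, F (Fin.snoc s (pathEnd 0 s + g) : Fin (n + 1) → ℝ) ∂(expMeasure 1))
      hH.lintegral_prod_right']
    have hm3 : Measurable fun q : ℝ × (Fin n → ℝ) =>
        chainWeight (fun a b => exponentialPDF 1 (b - a)) 0 q.2 *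
          exponentialPDF 1 (q.1 - pathEnd 0 q.2) * F (Fin.snoc q.2 q.1 : Fin (n + 1) → ℝ) :=
      ((hW.comp measurable_snd).mul (by fun_prop)).mul (hF.comp measurable_snoc)
    rw [lintegral_snoc (F := fun s => chainWeight (fun a b => exponentialPDF 1 (b - a)) 0 s * F s)
      ((measurable_exp_weight (n + 1)).mul hF)]
    simp_rw [chainWeight_snoc]
    rw [lintegral_lintegral_swap hm3.aemeasurable]
    refine lintegral_congr fun s => ?_
    have hFs : Measurable fun u : ℝ => F (Fin.snoc s u : Fin (n + 1) → ℝ) :=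
      hF.comp (measurable_snoc.comp (f := fun u : ℝ => (u, s)) (by fun_prop))
    simp_rw [mul_assoc]
    rw [lintegral_const_mul _ (by fun_prop)]
    congr 1
    exact lintegral_expMeasure_add (pathEnd 0 s) hFs

omit hτ in
lemma lintegral_exponentialPDF_Ioi {c t : ℝ} (h : c ≤ t) :
    ∫⁻ u in Set.Ioi t, exponentialPDF 1 (u - c) = ENNReal.ofReal (Real.exp (-(t - c))) := by
  have hpdf : Measurable (exponentialPDF 1) := (measurable_exponentialPDFReal 1).ennreal_ofReal
  have e1 : ∫⁻ u in Set.Ioi t, exponentialPDF 1 (u - c)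
      = ∫⁻ u in Set.Ioi (t - c), exponentialPDF 1 u := by
    rw [← lintegral_indicator measurableSet_Ioi, ← lintegral_indicator measurableSet_Ioi,
      ← lintegral_sub_right_eq_self (fun u => (Set.Ioi (t - c)).indicator _ u) c]
    refine lintegral_congr fun u => ?_
    simp [Set.indicator_apply]
  have e2 := lintegral_add_compl (μ := (volume : Measure ℝ)) (exponentialPDF 1)
    (measurableSet_Iic (a := t - c))
  have e3 := lintegral_exponentialPDF_eq_antiDeriv one_pos (t - c)
  rw [if_pos (by linarith), one_mul] at e3
  rw [Set.compl_Iic, e3, lintegral_exponentialPDF_eq_one one_pos] at e2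
  rw [e1]
  have h1 : Real.exp (-(t - c)) ≤ 1 := Real.exp_le_one_iff.2 (by linarith)
  have h2 : ENNReal.ofReal (1 - Real.exp (-(t - c)))
      + ENNReal.ofReal (Real.exp (-(t - c))) = 1 := by
    rw [← ENNReal.ofReal_add (by linarith) (Real.exp_pos _).le]
    simp
  rw [← h2] at e2
  exact (ENNReal.add_right_inj ENNReal.ofReal_ne_top).1 e2

omit hτ in
-- The exponents telescope, so on increasing times the joint density depends on the last jump alone.
lemma chainWeight_exponentialPDF {n : ℕ} (s : Fin n → ℝ) :
    chainWeight (fun a b => exponentialPDF 1 (b - a)) 0 s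
      = ENNReal.ofReal (Real.exp (-(pathEnd 0 s))) *
        chainWeight (fun a b => if a ≤ b then 1 else 0) 0 s := by
  induction n with
  | zero => simp [chainWeight_zero, pathEnd_zero]
  | succ n ih =>
    obtain ⟨q, rfl⟩ : ∃ q : ℝ × (Fin n → ℝ), s = Fin.snoc q.2 q.1 :=
      ⟨(s (Fin.last n), Fin.init s), (Fin.snoc_init_self s).symm⟩
    rw [chainWeight_snoc, chainWeight_snoc, pathEnd_snoc, ih, exponentialPDF_eq]
    by_cases h : pathEnd 0 q.2 ≤ q.1
    · rw [if_pos h, if_pos (by linarith), mul_one, mul_right_comm, ← ENNReal.ofReal_mul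
        (Real.exp_pos _).le, one_mul, ← Real.exp_add]
      congr 3
      ring
    · rw [if_neg h, if_neg (by linarith)]
      simp

/-- The law of the jump times before `t`, on the event that there are `n` of them. -/
lemma setLIntegral_jumpTuple [IsProbabilityMeasure μ] (n : ℕ) {F : (Fin n → ℝ) → ℝ≥0∞}
    (hF : Measurable F) (t : ℝ) :
    ∫⁻ ω in {ω | τ n ω ≤ t ∧ t < τ (n + 1) ω}, F (jumpTuple τ n ω) ∂μ
      = ENNReal.ofReal (Real.exp (-t)) * ∫⁻ s : Fin n → ℝ in {s | pathEnd 0 s ≤ t},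
          chainWeight (fun a b => if a ≤ b then 1 else 0) 0 s * F s := by
  have hpdf : Measurable (exponentialPDF 1) := (measurable_exponentialPDFReal 1).ennreal_ofReal
  have hE : ∀ n, Measurable fun s : Fin n → ℝ => pathEnd 0 s := fun n =>
    measurable_pathEnd.comp (measurable_const.prodMk measurable_id)
  have hW := measurable_exp_weight n
  have hinit : Measurable fun v : Fin (n + 1) → ℝ => (fun i : Fin n => v i.castSucc) := by fun_prop
  have hA : MeasurableSet {v : Fin (n + 1) → ℝ |
      pathEnd 0 (fun i : Fin n => v i.castSucc) ≤ t ∧ t < v (Fin.last n)} :=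
    (measurableSet_le ((hE n).comp hinit) measurable_const).inter
      (measurableSet_lt measurable_const (measurable_pi_apply _))
  have hS : MeasurableSet {ω | τ n ω ≤ t ∧ t < τ (n + 1) ω} :=
    (measurableSet_le (hτ.meas n) measurable_const).inter
      (measurableSet_lt measurable_const (hτ.meas (n + 1)))
  have hB : MeasurableSet {s : Fin n → ℝ | pathEnd 0 s ≤ t} :=
    measurableSet_le (hE n) measurable_const
  set F₁ : (Fin (n + 1) → ℝ) → ℝ≥0∞ := {v : Fin (n + 1) → ℝ |
      pathEnd 0 (fun i : Fin n => v i.castSucc) ≤ t ∧ t < v (Fin.last n)}.indicator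
      fun v => F fun i => v i.castSucc with hF₁
  have hF₁m : Measurable F₁ := (hF.comp hinit).indicator hA
  have e1 : ∫⁻ ω in {ω | τ n ω ≤ t ∧ t < τ (n + 1) ω}, F (jumpTuple τ n ω) ∂μ
      = ∫⁻ ω, F₁ (jumpTuple τ (n + 1) ω) ∂μ := by
    rw [← lintegral_indicator hS]
    refine lintegral_congr fun ω => ?_
    have h1 : (fun i : Fin n => jumpTuple τ (n + 1) ω i.castSucc) = jumpTuple τ n ω := rfl
    have h2 : jumpTuple τ (n + 1) ω (Fin.last n) = τ (n + 1) ω := rfl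
    simp only [hF₁, Set.indicator_apply, Set.mem_ofPred_eq, h1, h2, hτ.pathEnd_jumpTuple]
  have hF₁s : ∀ (s : Fin n → ℝ) (u : ℝ), F₁ (Fin.snoc s u) = if pathEnd 0 s ≤ t then
      (Set.Ioi t).indicator (fun _ => F s) u else 0 := fun s u => by
    simp only [hF₁, Set.indicator_apply, Set.mem_ofPred_eq, Fin.snoc_castSucc, Fin.snoc_last,
      Set.mem_Ioi]
    split_ifs <;> tauto
  have hm3 : Measurable fun q : ℝ × (Fin n → ℝ) =>
        chainWeight (fun a b => exponentialPDF 1 (b - a)) 0 q.2 *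
          exponentialPDF 1 (q.1 - pathEnd 0 q.2) * F₁ (Fin.snoc q.2 q.1 : Fin (n + 1) → ℝ) :=
      ((hW.comp measurable_snd).mul (by have := hE n; fun_prop)).mul (hF₁m.comp measurable_snoc)
  rw [e1, hτ.lintegral_jumpTuple (n + 1) hF₁m,
    lintegral_snoc (F := fun s => chainWeight (fun a b => exponentialPDF 1 (b - a)) 0 s * F₁ s)
      ((measurable_exp_weight (n + 1)).mul hF₁m)]
  simp_rw [chainWeight_snoc]
  rw [lintegral_lintegral_swap hm3.aemeasurable, ← lintegral_const_mul' _ _ ENNReal.ofReal_ne_top,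
    ← lintegral_indicator hB]
  refine lintegral_congr fun s => ?_
  simp_rw [hF₁s, Set.indicator_apply, Set.mem_ofPred_eq]
  split_ifs with hs
  -- The next jump falls after t with probability e^(-(t-s_n)). Times e^(-s_n) from the first n
  -- jumps, this is the constant e^(-t).
  · calc _ = ∫⁻ u in Set.Ioi t, (chainWeight (fun a b => exponentialPDF 1 (b - a)) 0 s * F s) *
          exponentialPDF 1 (u - pathEnd 0 s) := by
          rw [← lintegral_indicator measurableSet_Ioi]
          refine lintegral_congr fun u => ?_
          simp only [Set.indicator_apply]
          split_ifs
          · ring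
          · simp
      _ = (chainWeight (fun a b => exponentialPDF 1 (b - a)) 0 s * F s) *
          ENNReal.ofReal (Real.exp (-(t - pathEnd 0 s))) := by
          rw [lintegral_const_mul _ (by fun_prop), lintegral_exponentialPDF_Ioi hs]
      _ = _ := by
          rw [chainWeight_exponentialPDF]
          calc _ = (ENNReal.ofReal (Real.exp (-(pathEnd 0 s))) *
                ENNReal.ofReal (Real.exp (-(t - pathEnd 0 s)))) *
                (chainWeight (fun a b => if a ≤ b then 1 else 0) 0 s * F s) := by ring
            _ = _ := by
                rw [← ENNReal.ofReal_mul (Real.exp_pos _).le, ← Real.exp_add]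
                congr 3
                ring
  · simp

lemma measure_gap_le {t : ℝ} (ht : 0 ≤ t) (j : ℕ) :
    μ ((fun ω => τ (j + 1) ω - τ j ω) ⁻¹' Set.Iic t) = ENNReal.ofReal (1 - Real.exp (-t)) := by
  rw [← Measure.map_apply (f := fun ω => τ (j + 1) ω - τ j ω) ((hτ.meas _).sub (hτ.meas _))
    measurableSet_Iic, hτ.law j]
  change volume.withDensity (exponentialPDF 1) (Set.Iic t) = _
  rw [withDensity_apply _ measurableSet_Iic, lintegral_exponentialPDF_eq_antiDeriv one_pos,
    if_pos ht, one_mul]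

lemma ae_strictMono : ∀ᵐ ω ∂μ, StrictMono fun n => τ n ω := by
  have : ∀ j, ∀ᵐ ω ∂μ, τ j ω < τ (j + 1) ω := fun j => by
    have := hτ.measure_gap_le le_rfl j
    simp only [neg_zero, Real.exp_zero, sub_self, ENNReal.ofReal_zero] at this
    rw [ae_iff]
    convert this using 2
    ext ω
    simp
  filter_upwards [ae_all_iff.2 this] with ω hω
  exact strictMono_nat_of_lt_succ hω

/-- If all jump times were at most t, so would be all waiting times; by independence the first n of
them satisfy this with probability (1 - e^(-t))^n. -/
lemma ae_exists_lt (t : ℝ) : ∀ᵐ ω ∂μ, ∃ n, t < τ n ω := by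
  rcases lt_or_ge t 0 with ht | ht
  · exact .of_forall fun ω => ⟨0, by rwa [hτ.zero]⟩
  have key : ∀ n : ℕ, μ {ω | (StrictMono fun n => τ n ω) ∧ ∀ n, τ n ω ≤ t}
      ≤ ENNReal.ofReal (1 - Real.exp (-t)) ^ n := fun n => by
    have h1 := hτ.indep.measure_inter_preimage_eq_mul (Finset.range n)
      (sets := fun _ => Set.Iic t) (fun _ _ => measurableSet_Iic)
    simp only [hτ.measure_gap_le ht, Finset.prod_const, Finset.card_range] at h1
    rw [← h1]
    refine measure_mono fun ω hω => ?_
    simp only [Set.mem_iInter, Set.mem_preimage, Set.mem_Iic]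
    intro i _
    have h2 := hω.2 (i + 1)
    have h3 : τ 0 ω ≤ τ i ω := hω.1.monotone (Nat.zero_le i)
    rw [hτ.zero] at h3
    linarith
  have hlim : Tendsto (fun n : ℕ => ENNReal.ofReal (1 - Real.exp (-t)) ^ n) atTop (𝓝 0) :=
    ENNReal.tendsto_pow_atTop_nhds_zero_of_lt_one (by
      rw [ENNReal.ofReal_lt_one]
      have := Real.exp_pos (-t)
      linarith)
  have h0 : μ {ω | (StrictMono fun n => τ n ω) ∧ ∀ n, τ n ω ≤ t} = 0 :=
    le_antisymm (ge_of_tendsto' hlim key) zero_le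
  filter_upwards [hτ.ae_strictMono, measure_eq_zero_iff_ae_notMem.1 h0] with ω h1 h2
  by_contra h3
  push Not at h3
  exact h2 ⟨h1, h3⟩

/-- Almost surely, the number of jumps before `t` is finite, and is given by `jumpCount`. -/
lemma ae_exists_jumpCount {t : ℝ} (ht : 0 ≤ t) :
    ∀ᵐ ω ∂μ, ∃ n, τ n ω ≤ t ∧ t < τ (n + 1) ω := by
  classical
  filter_upwards [hτ.ae_exists_lt t] with ω hω
  have h1 := Nat.find_spec hω
  have h2 : Nat.find hω ≠ 0 := fun h => by
    rw [h, hτ.zero] at h1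
    linarith
  obtain ⟨m, hm⟩ := Nat.exists_eq_succ_of_ne_zero h2
  refine ⟨m, ?_, by rwa [hm] at h1⟩
  have := Nat.find_min hω (m := m) (by omega)
  exact not_lt.1 this

end IsPoissonJumpTimes

lemma jumpCount_eq {ω : Ω} (h : StrictMono fun n => τ n ω) {t : ℝ} {n : ℕ} (h1 : τ n ω ≤ t)
    (h2 : t < τ (n + 1) ω) : jumpCount τ t ω = n := by
  have : {j : ℕ | τ (j + 1) ω ≤ t} = (Finset.range n : Set ℕ) := by
    ext j
    simp only [Set.mem_ofPred_eq, Finset.coe_range, Set.mem_Iio]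
    constructor
    · intro hj
      have : τ (j + 1) ω < τ (n + 1) ω := hj.trans_lt h2
      have := h.lt_iff_lt.1 this
      omega
    · intro hj
      exact (h.monotone (show j + 1 ≤ n by omega)).trans h1
  unfold jumpCount
  rw [this, Set.ncard_coe_finset, Finset.card_range]

end Poisson

end

section

/-! ### The law of the backward scheme -/

variable {d : ℕ} {T : ℝ} {P : ℝ → Kernel (Sp d) (Sp d)} {p : Sp d → ℝ → Sp d → Sp d → ℝ}

/-- The frozen density as an extended nonnegative function, extended by zero outside `(0, T]`. -/
def phiE (T : ℝ) (p : Sp d → ℝ → Sp d → Sp d → ℝ) (u : ℝ) (x w : Sp d) : ℝ≥0∞ :=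
  ENNReal.ofReal (trunc T (phi p) u x w)

/-- The total mass of `phiE`. -/
def massE (T : ℝ) (p : Sp d → ℝ → Sp d → Sp d → ℝ) (u : ℝ) (x : Sp d) : ℝ≥0∞ :=
  ∫⁻ w, phiE T p u x w

lemma phiE_of_notMem {u : ℝ} (hu : u ∉ Set.Ioc 0 T) (x w : Sp d) : phiE T p u x w = 0 := by
  simp [phiE, trunc_of_notMem hu]

lemma massE_of_notMem {u : ℝ} (hu : u ∉ Set.Ioc 0 T) (x : Sp d) : massE T p u x = 0 := by
  simp [massE, phiE_of_notMem hu]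

lemma IsFrozenFamily.measurable_phiE (hp : IsFrozenFamily T p) :
    Measurable fun q : ℝ × Sp d × Sp d => phiE T p q.1 q.2.1 q.2.2 :=
  (measurable_trunc hp.measurable_phi).ennreal_ofReal

lemma IsFrozenFamily.measurable_massE (hp : IsFrozenFamily T p) :
    Measurable fun q : ℝ × Sp d => massE T p q.1 q.2 :=
  Measurable.lintegral_prod_right' (f := fun q : (ℝ × Sp d) × Sp d => phiE T p q.1.1 q.1.2 q.2)
    (hp.measurable_phiE.comp (f := fun q : (ℝ × Sp d) × Sp d => (q.1.1, q.1.2, q.2))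
      (by fun_prop))

lemma BackwardRegularity.massE_ne_top (hreg : BackwardRegularity T P p) (u : ℝ) (x : Sp d) :
    massE T p u x ≠ ∞ := by
  by_cases hu : u ∈ Set.Ioc 0 T
  · obtain ⟨C, hC⟩ := hreg.bdd_integral
    unfold massE phiE
    simp only [trunc_of_mem hu]
    exact (((hC u hu).2 x).trans_lt ENNReal.coe_lt_top).ne
  · simp [massE_of_notMem hu]

lemma setIntegral_phi_eq (hp : IsFrozenFamily T p) {u : ℝ} (hu : u ∈ Set.Ioc 0 T) (x : Sp d)
    (B : Set (Sp d)) : ∫ w in B, phi p u x w = (∫⁻ w in B, phiE T p u x w).toReal := by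
  rw [integral_eq_lintegral_of_nonneg_ae (.of_forall fun w => hp.phi_nonneg hu.1 x w)
    (hp.measurable_phi.comp (f := fun w => (u, x, w)) (by fun_prop)).aestronglyMeasurable]
  unfold phiE
  simp only [trunc_of_mem hu]

lemma phiMass_eq (hp : IsFrozenFamily T p) {u : ℝ} (hu : u ∈ Set.Ioc 0 T) (x : Sp d) :
    phiMass p u x = (massE T p u x).toReal := by
  have := setIntegral_phi_eq hp hu x Set.univ
  rwa [Measure.restrict_univ] at this

/-- When the mass vanishes, both sides are zero: on the left because 0⁻¹ = 0 in ℝ, on the right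
because ∞ * 0 = 0. -/
lemma ofReal_inv_phiMass_mul (hp : IsFrozenFamily T p) (hreg : BackwardRegularity T P p) {u : ℝ}
    (hu : u ∈ Set.Ioc 0 T) (x : Sp d) (B : Set (Sp d)) :
    ENNReal.ofReal ((phiMass p u x)⁻¹ * ∫ w in B, phi p u x w)
      = (massE T p u x)⁻¹ * ∫⁻ w in B, phiE T p u x w := by
  have hfin := hreg.massE_ne_top u x
  have hle : ∫⁻ w in B, phiE T p u x w ≤ massE T p u x := setLIntegral_le_lintegral _ _
  have hB := ne_top_of_le_ne_top hfin hle
  rw [phiMass_eq hp hu, setIntegral_phi_eq hp hu]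
  by_cases h0 : massE T p u x = 0
  · have : ∫⁻ w in B, phiE T p u x w = 0 := le_antisymm (hle.trans h0.le) zero_le
    simp [h0, this]
  · rw [← ENNReal.toReal_inv, ← ENNReal.toReal_mul, ENNReal.ofReal_toReal]
    exact ENNReal.mul_ne_top (ENNReal.inv_ne_top.2 h0) hB

/-- Positivity of the mass is not assumed: where it vanishes, so does the density almost everywhere,
and the cancellation persists. -/
lemma massE_mul_inv_mul_phiE (hp : IsFrozenFamily T p) (hreg : BackwardRegularity T P p) (u : ℝ)
    (x : Sp d) : ∀ᵐ w, massE T p u x * ((massE T p u x)⁻¹ * phiE T p u x w) = phiE T p u x w := by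
  by_cases h0 : massE T p u x = 0
  · have hm : Measurable fun w => phiE T p u x w :=
      hp.measurable_phiE.comp (f := fun w => (u, x, w)) (by fun_prop)
    filter_upwards [(lintegral_eq_zero_iff hm).1 h0] with w hw
    have hw' : phiE T p u x w = 0 := hw
    simp [hw']
  · refine .of_forall fun w => ?_
    rw [← mul_assoc, ENNReal.mul_inv_cancel h0 (hreg.massE_ne_top u x), one_mul]

/-! ### One step of the scheme and its iteration. -/

section Scheme

variable {Ω : Type*} [MeasurableSpace Ω] {μ : Measure Ω} [IsProbabilityMeasure μ]
  {τ : ℕ → Ω → ℝ} {X : ℕ → Ω → Sp d} {y : Sp d}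

/-- The jump times and the first `j + 1` positions. -/
def histMap (τ : ℕ → Ω → ℝ) (X : ℕ → Ω → Sp d) (j : ℕ) (ω : Ω) :
    (ℕ → ℝ) × (Fin (j + 1) → Sp d) := (fun k => τ k ω, fun i => X i ω)

/-- The mass of the step following a history. -/
def stepMass (T : ℝ) (p : Sp d → ℝ → Sp d → Sp d → ℝ) (j : ℕ)
    (h : (ℕ → ℝ) × (Fin (j + 1) → Sp d)) : ℝ≥0∞ :=
  massE T p (h.1 (j + 1) - h.1 j) (h.2 (Fin.last j))

/-- The unnormalized density of the step following a history. -/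
def stepDensity (T : ℝ) (p : Sp d → ℝ → Sp d → Sp d → ℝ) (j : ℕ)
    (h : (ℕ → ℝ) × (Fin (j + 1) → Sp d)) (w : Sp d) : ℝ≥0∞ :=
  phiE T p (h.1 (j + 1) - h.1 j) (h.2 (Fin.last j)) w

lemma IsFrozenFamily.measurable_stepMass (hp : IsFrozenFamily T p) (j : ℕ) :
    Measurable (stepMass T p j) :=
  hp.measurable_massE.comp (f := fun h : (ℕ → ℝ) × (Fin (j + 1) → Sp d) =>
    (h.1 (j + 1) - h.1 j, h.2 (Fin.last j))) (by fun_prop)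

lemma IsFrozenFamily.measurable_stepDensity (hp : IsFrozenFamily T p) (j : ℕ) :
    Measurable fun q : ((ℕ → ℝ) × (Fin (j + 1) → Sp d)) × Sp d => stepDensity T p j q.1 q.2 :=
  hp.measurable_phiE.comp (f := fun q : ((ℕ → ℝ) × (Fin (j + 1) → Sp d)) × Sp d =>
    (q.1.1 (j + 1) - q.1.1 j, q.1.2 (Fin.last j), q.2)) (by fun_prop)

namespace IsBackwardScheme

variable (hX : IsBackwardScheme μ T p y τ X) (hτ : ∀ j, Measurable (τ j))
  (hp : IsFrozenFamily T p) (hreg : BackwardRegularity T P p)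
include hX hτ

omit [IsProbabilityMeasure μ] in
lemma measurable_histMap (j : ℕ) : Measurable (histMap τ X j) :=
  (measurable_pi_lambda _ fun k => hτ k).prodMk (measurable_pi_lambda _ fun i => hX.meas _)

include hp hreg

/-- The probability of a history and a position after the next step. -/
lemma measure_step (j : ℕ) {D : Set ((ℕ → ℝ) × (Fin (j + 1) → Sp d))} (hD : MeasurableSet D)
    (hDT : ∀ h ∈ D, h.1 (j + 1) ≤ T ∧ h.1 (j + 1) - h.1 j ∈ Set.Ioc 0 T) {B : Set (Sp d)}
    (hB : MeasurableSet B) :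
    μ (histMap τ X j ⁻¹' D ∩ X (j + 1) ⁻¹' B)
      = ∫⁻ ω in histMap τ X j ⁻¹' D, ((stepMass T p j (histMap τ X j ω))⁻¹ *
          ∫⁻ w in B, stepDensity T p j (histMap τ X j ω) w) ∂μ := by
  have hΦ := hX.measurable_histMap hτ j
  have hle : history τ X j ≤ ‹MeasurableSpace Ω› := hΦ.comap_le
  have hS' : MeasurableSet[history τ X j] (histMap τ X j ⁻¹' D) := ⟨D, hD, rfl⟩
  have hS : MeasurableSet (histMap τ X j ⁻¹' D) := hle _ hS'
  have hXB : MeasurableSet (X (j + 1) ⁻¹' B) := hX.meas _ hB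
  set R : Ω → ℝ := fun ω => (phiMass p (τ (j + 1) ω - τ j ω) (X j ω))⁻¹ *
        ∫ w in B, phi p (τ (j + 1) ω - τ j ω) (X j ω) w with hR
  have hstep : μ⟦X (j + 1) ⁻¹' B | history τ X j⟧ =ᵐ[μ.restrict (histMap τ X j ⁻¹' D)] R := by
    -- The conditional law is prescribed only up to the horizon T, and D lies within it.
    refine ae_restrict_of_ae_restrict_of_subset (fun ω hω => ?_) (hX.step j B hB)
    exact (hDT _ hω).1
  have h1 : ∫ ω in histMap τ X j ⁻¹' D, R ω ∂μ
      = μ.real (histMap τ X j ⁻¹' D ∩ X (j + 1) ⁻¹' B) := by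
    rw [← integral_congr_ae hstep, setIntegral_condExp hle
      ((integrable_const (1 : ℝ)).indicator hXB) hS', integral_indicator hXB,
      Measure.restrict_restrict hXB, Set.inter_comm]
    simp
  have hRe : ∀ ω ∈ histMap τ X j ⁻¹' D, ENNReal.ofReal (R ω)
      = (stepMass T p j (histMap τ X j ω))⁻¹ *
          ∫⁻ w in B, stepDensity T p j (histMap τ X j ω) w := fun ω hω =>
    ofReal_inv_phiMass_mul hp hreg (hDT _ hω).2 _ B
  have hR0 : 0 ≤ᵐ[μ.restrict (histMap τ X j ⁻¹' D)] R := by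
    rw [Filter.EventuallyLE, ae_restrict_iff' hS]
    refine .of_forall fun ω hω => ?_
    have hu := (hDT _ hω).2
    have e1 := phiMass_eq hp hu (X j ω)
    have e2 := setIntegral_phi_eq hp hu (X j ω) B
    simp only [histMap] at e1 e2
    simp only [hR, Pi.zero_apply]
    rw [e1, e2]
    positivity
  have hRi : IntegrableOn R (histMap τ X j ⁻¹' D) μ :=
    (integrable_condExp.integrableOn (s := histMap τ X j ⁻¹' D)).congr hstep
  rw [← setLIntegral_congr_fun hS hRe, ← ofReal_integral_eq_lintegral_ofReal hRi hR0, h1,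
    ofReal_measureReal]

/-- One step of the scheme, under the integral sign. -/
lemma lintegral_step (j : ℕ) {g : ((ℕ → ℝ) × (Fin (j + 1) → Sp d)) × Sp d → ℝ≥0∞}
    (hg : Measurable g) (hg0 : ∀ h w, T < h.1 (j + 1) → g (h, w) = 0) :
    ∫⁻ ω, stepMass T p j (histMap τ X j ω) * g (histMap τ X j ω, X (j + 1) ω) ∂μ
      = ∫⁻ ω, (∫⁻ w, stepDensity T p j (histMap τ X j ω) w * g (histMap τ X j ω, w)) ∂μ := by
  have hΦ := hX.measurable_histMap hτ j
  have hM := hp.measurable_stepMass j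
  have hK := hp.measurable_stepDensity j
  set A : Set ((ℕ → ℝ) × (Fin (j + 1) → Sp d)) :=
    {h | h.1 (j + 1) ≤ T ∧ h.1 (j + 1) - h.1 j ∈ Set.Ioc 0 T} with hA_def
  have hA : MeasurableSet A :=
    (measurableSet_le (f := fun h : (ℕ → ℝ) × (Fin (j + 1) → Sp d) => h.1 (j + 1)) (by fun_prop)
      measurable_const).inter
      (measurableSet_Ioc.preimage
        (f := fun h : (ℕ → ℝ) × (Fin (j + 1) → Sp d) => h.1 (j + 1) - h.1 j) (by fun_prop))
  have hA' : MeasurableSet (histMap τ X j ⁻¹' A) := hΦ hA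
  set ν := (μ.restrict (histMap τ X j ⁻¹' A)).map (histMap τ X j) with hν
  set m₁ := (μ.restrict (histMap τ X j ⁻¹' A)).map fun ω => (histMap τ X j ω, X (j + 1) ω) with hm₁
  set k : ((ℕ → ℝ) × (Fin (j + 1) → Sp d)) × Sp d → ℝ≥0∞ := fun q =>
    (stepMass T p j q.1)⁻¹ * stepDensity T p j q.1 q.2 with hk
  have hkm : Measurable k := (hM.comp measurable_fst).inv.mul hK
  have hpair : Measurable fun ω => (histMap τ X j ω, X (j + 1) ω) := hΦ.prodMk (hX.meas _)
  have : IsFiniteMeasure m₁ := by rw [hm₁]; infer_instance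
  have : IsFiniteMeasure ν := by rw [hν]; infer_instance
  -- Agreement on rectangles determines the measure and carries the step from events over to
  -- functions.
  have key : m₁ = (ν.prod volume).withDensity k := by
    refine Measure.ext_prod fun {D B} hD hB => ?_
    have e1 : m₁ (D ×ˢ B) = μ (histMap τ X j ⁻¹' (A ∩ D) ∩ X (j + 1) ⁻¹' B) := by
      rw [hm₁, Measure.map_apply hpair (hD.prod hB),
        Measure.restrict_apply (hpair (hD.prod hB))]
      congr 1
      ext ω
      simp only [Set.mem_inter_iff, Set.mem_preimage, Set.mem_prod]
      tauto
    have hinner : Measurable fun h => (stepMass T p j h)⁻¹ * ∫⁻ w in B, stepDensity T p j h w :=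
      hM.inv.mul (Measurable.lintegral_prod_right' (ν := volume.restrict B) hK)
    rw [e1, hX.measure_step hτ hp hreg j (hA.inter hD) (fun h hh => hh.1) hB,
      withDensity_apply _ (hD.prod hB), ← Measure.prod_restrict,
      lintegral_prod _ hkm.aemeasurable, hν, Measure.restrict_map hΦ hD,
      Measure.restrict_restrict (hΦ hD)]
    have e2 : ∀ h, ∫⁻ w in B, k (h, w)
        = (stepMass T p j h)⁻¹ * ∫⁻ w in B, stepDensity T p j h w := fun h =>
      lintegral_const_mul (stepMass T p j h)⁻¹
        (f := fun w => stepDensity T p j h w) (hK.comp (f := fun w => (h, w)) (by fun_prop))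
    simp_rw [e2]
    rw [lintegral_map hinner hΦ, Set.preimage_inter, Set.inter_comm]
  set g' : ((ℕ → ℝ) × (Fin (j + 1) → Sp d)) × Sp d → ℝ≥0∞ := fun q =>
    stepMass T p j q.1 * g q with hg'
  have hg'm : Measurable g' := (hM.comp measurable_fst).mul hg
  have h1 : ∫⁻ q, g' q ∂m₁ = ∫⁻ ω, stepMass T p j (histMap τ X j ω) *
      g (histMap τ X j ω, X (j + 1) ω) ∂μ := by
    rw [hm₁, lintegral_map hg'm hpair, ← lintegral_indicator hA']
    refine lintegral_congr fun ω => ?_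
    by_cases hω : ω ∈ histMap τ X j ⁻¹' A
    · rw [Set.indicator_of_mem hω]
    · rw [Set.indicator_of_notMem hω]
      simp only [hA_def, Set.mem_preimage, Set.mem_ofPred_eq, not_and_or, not_le] at hω
      rcases hω with hω | hω
      · rw [hg0 _ _ hω, mul_zero]
      · rw [stepMass, massE_of_notMem hω, zero_mul]
  have hinner : Measurable fun h => ∫⁻ w, stepDensity T p j h w * g (h, w) :=
    Measurable.lintegral_prod_right' (hK.mul hg)
  have h2 : ∫⁻ q, g' q ∂((ν.prod volume).withDensity k) = ∫⁻ ω,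
      (∫⁻ w, stepDensity T p j (histMap τ X j ω) w * g (histMap τ X j ω, w)) ∂μ := by
    rw [lintegral_withDensity_eq_lintegral_mul _ hkm hg'm,
      lintegral_prod _ (hkm.mul hg'm).aemeasurable]
    have e2 : ∀ h, ∫⁻ w, (k * g') (h, w) = ∫⁻ w, stepDensity T p j h w * g (h, w) := fun h => by
      refine lintegral_congr_ae ?_
      filter_upwards [massE_mul_inv_mul_phiE hp hreg (h.1 (j + 1) - h.1 j) (h.2 (Fin.last j))]
        with w hw
      have hw' : stepMass T p j h * ((stepMass T p j h)⁻¹ * stepDensity T p j h w)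
        = stepDensity T p j h w := hw
      calc _ = (stepMass T p j h * ((stepMass T p j h)⁻¹ * stepDensity T p j h w)) * g (h, w) := by
            simp only [hk, hg', Pi.mul_apply]; ring
        _ = _ := by rw [hw']
    simp_rw [e2]
    rw [hν, lintegral_map hinner hΦ, ← lintegral_indicator hA']
    refine lintegral_congr fun ω => ?_
    by_cases hω : ω ∈ histMap τ X j ⁻¹' A
    · rw [Set.indicator_of_mem hω]
    · rw [Set.indicator_of_notMem hω]
      simp only [hA_def, Set.mem_preimage, Set.mem_ofPred_eq, not_and_or, not_le] at hω
      rcases hω with hω | hω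
      · simp [hg0 _ _ hω]
      · simp [stepDensity, phiE_of_notMem hω]
  rw [← h1, ← h2, key]

/-- The law of the first positions of the scheme, given the jump times, weighted by the masses of
the steps. -/
lemma lintegral_prod_massE (n : ℕ) {H : (ℕ → ℝ) × (Fin (n + 1) → Sp d) → ℝ≥0∞}
    (hH : Measurable H) (hH0 : ∀ h, (∃ k ≤ n, T < h.1 k) → H h = 0) :
    ∫⁻ ω, (∏ i : Fin n, massE T p (τ (i + 1) ω - τ i ω) (X i ω)) * H (histMap τ X n ω) ∂μ
      = ∫⁻ ω, (∫⁻ v : Fin n → Sp d, (∏ i : Fin n, phiE T p (τ (i + 1) ω - τ i ω)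
          (path y v i.castSucc) (path y v i.succ)) * H (fun k => τ k ω, path y v)) ∂μ := by
  induction n with
  | zero =>
    simp only [Finset.univ_eq_empty, Finset.prod_empty, one_mul]
    simp_rw [lintegral_fin_zero]
    refine lintegral_congr fun ω => ?_
    congr 1
    refine Prod.ext rfl ?_
    funext i
    have hi : i = 0 := Fin.ext (by omega)
    subst hi
    simp [histMap, path, hX.init]
  | succ n ih =>
    have hK := hp.measurable_stepDensity n
    have hsn : Measurable fun q : ((ℕ → ℝ) × (Fin (n + 1) → Sp d)) × Sp d =>
        H (q.1.1, (Fin.snoc q.1.2 q.2 : Fin (n + 2) → Sp d)) :=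
      hH.comp ((measurable_fst.fst).prodMk (measurable_snoc.comp
        (f := fun q : ((ℕ → ℝ) × (Fin (n + 1) → Sp d)) × Sp d => (q.2, q.1.2)) (by fun_prop)))
    have hMm : ∀ i : Fin n, Measurable fun q : ((ℕ → ℝ) × (Fin (n + 1) → Sp d)) × Sp d =>
        massE T p (q.1.1 (i + 1) - q.1.1 i) (q.1.2 i.castSucc) := fun i =>
      hp.measurable_massE.comp (f := fun q : ((ℕ → ℝ) × (Fin (n + 1) → Sp d)) × Sp d =>
        (q.1.1 (i + 1) - q.1.1 i, q.1.2 i.castSucc)) (by fun_prop)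
    set g : ((ℕ → ℝ) × (Fin (n + 1) → Sp d)) × Sp d → ℝ≥0∞ := fun q =>
      (∏ i : Fin n, massE T p (q.1.1 (i + 1) - q.1.1 i) (q.1.2 i.castSucc)) *
        H (q.1.1, (Fin.snoc q.1.2 q.2 : Fin (n + 2) → Sp d)) with hg
    have hgm : Measurable g := (Finset.measurable_prod _ fun i _ => hMm i).mul hsn
    have hstep := hX.lintegral_step hτ hp hreg n hgm fun h w hT => by
      simp only [hg]
      rw [hH0 _ ⟨n + 1, le_rfl, hT⟩, mul_zero]
    -- The newest position is integrated out first, which leaves a function of the shorter history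
    -- to which induction applies.
    set H' : (ℕ → ℝ) × (Fin (n + 1) → Sp d) → ℝ≥0∞ := fun h =>
      ∫⁻ w, stepDensity T p n h w * H (h.1, (Fin.snoc h.2 w : Fin (n + 2) → Sp d)) with hH'
    have hH'm : Measurable H' := Measurable.lintegral_prod_right' (hK.mul hsn)
    have hih := ih hH'm fun h ⟨k, hk, hkT⟩ => by
      simp only [hH']
      simp [hH0 (h.1, _) ⟨k, by omega, hkT⟩]
    have hsnocX : ∀ ω, (histMap τ X (n + 1) ω)
        = (fun k => τ k ω, (Fin.snoc (fun i : Fin (n + 1) => X i ω) (X (n + 1) ω) :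
            Fin (n + 2) → Sp d)) := fun ω => by
      refine Prod.ext rfl ?_
      funext i
      refine Fin.lastCases ?_ (fun j => ?_) i <;> simp [histMap]
    calc _ = ∫⁻ ω, stepMass T p n (histMap τ X n ω) * g (histMap τ X n ω, X (n + 1) ω) ∂μ := by
          refine lintegral_congr fun ω => ?_
          rw [Fin.prod_univ_castSucc, hsnocX]
          simp only [hg, stepMass, histMap, Fin.val_castSucc, Fin.val_last]
          ring
      _ = ∫⁻ ω, (∏ i : Fin n, massE T p (τ (i + 1) ω - τ i ω) (X i ω)) *
            H' (histMap τ X n ω) ∂μ := by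
          rw [hstep]
          refine lintegral_congr fun ω => ?_
          have hKω : Measurable fun w => stepDensity T p n (histMap τ X n ω) w *
              H ((histMap τ X n ω).1, (Fin.snoc (histMap τ X n ω).2 w : Fin (n + 2) → Sp d)) :=
            (hK.mul hsn).comp (f := fun w => (histMap τ X n ω, w)) (by fun_prop)
          simp only [hH']
          rw [← lintegral_const_mul _ hKω]
          refine lintegral_congr fun w => ?_
          simp only [hg, histMap, Fin.val_castSucc]
          ring
      _ = _ := by
          rw [hih]
          refine lintegral_congr fun ω => ?_
          have hpe : Measurable fun v : Fin (n + 1) → Sp d => path y v :=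
            measurable_pi_lambda _ fun i => (measurable_path i).comp
              (measurable_const.prodMk measurable_id)
          have hpe' : Measurable fun v : Fin n → Sp d => path y v :=
            measurable_pi_lambda _ fun i => (measurable_path i).comp
              (measurable_const.prodMk measurable_id)
          have hφm : ∀ {m : ℕ} (i : Fin m) (u : ℝ), Measurable fun v : Fin m → Sp d =>
              phiE T p u (path y v i.castSucc) (path y v i.succ) := fun i u =>
            hp.measurable_phiE.comp (f := fun v => (u, path y v i.castSucc, path y v i.succ))
              (measurable_const.prodMk
                (((measurable_path i.castSucc).comp (measurable_const.prodMk measurable_id)).prodMk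
                  ((measurable_path i.succ).comp (measurable_const.prodMk measurable_id))))
          have hτω : Measurable fun v : Fin (n + 1) → Sp d =>
              H ((fun k => τ k ω), path y v) := hH.comp (measurable_const.prodMk hpe)
          rw [lintegral_snoc (F := fun v => (∏ i : Fin (n + 1), phiE T p (τ (i + 1) ω - τ i ω)
            (path y v i.castSucc) (path y v i.succ)) * H (fun k => τ k ω, path y v))
            ((Finset.measurable_prod _ fun i _ => hφm i (τ (i + 1) ω - τ i ω)).mul hτω)]
          have hm2 : Measurable fun q : Sp d × (Fin n → Sp d) =>
              (∏ i : Fin n, phiE T p (τ (i + 1) ω - τ i ω) (path y q.2 i.castSucc)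
                (path y q.2 i.succ)) * (stepDensity T p n ((fun k => τ k ω), path y q.2) q.1 *
                  H ((fun k => τ k ω), (Fin.snoc (path y q.2) q.1 : Fin (n + 2) → Sp d))) :=
            (Finset.measurable_prod _ fun i _ => (hφm i _).comp measurable_snd).mul
              ((hK.mul hsn).comp (f := fun q : Sp d × (Fin n → Sp d) =>
                (((fun k => τ k ω), path y q.2), q.1))
                ((measurable_const.prodMk (hpe'.comp measurable_snd)).prodMk measurable_fst))
          have e1 : ∀ v : Fin n → Sp d, (∏ i : Fin n, phiE T p (τ (i + 1) ω - τ i ω)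
              (path y v i.castSucc) (path y v i.succ)) * H' (fun k => τ k ω, path y v)
              = ∫⁻ w, (∏ i : Fin n, phiE T p (τ (i + 1) ω - τ i ω) (path y v i.castSucc)
                (path y v i.succ)) * (stepDensity T p n ((fun k => τ k ω), path y v) w *
                  H ((fun k => τ k ω), (Fin.snoc (path y v) w : Fin (n + 2) → Sp d))) := fun v => by
            simp only [hH']
            rw [lintegral_const_mul _ (f := fun w => stepDensity T p n ((fun k => τ k ω), path y v) w *
              H ((fun k => τ k ω), (Fin.snoc (path y v) w : Fin (n + 2) → Sp d)))
              ((hK.mul hsn).comp (f := fun w => (((fun k => τ k ω), path y v), w)) (by fun_prop))]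
          simp_rw [e1]
          rw [← lintegral_lintegral_swap hm2.aemeasurable]
          refine lintegral_congr fun w => lintegral_congr fun v => ?_
          have e2 : path y (Fin.snoc v w : Fin (n + 1) → Sp d)
              = (Fin.snoc (path y v) w : Fin (n + 2) → Sp d) := by
            unfold path
            rw [Fin.cons_snoc_eq_snoc_cons]
          rw [Fin.prod_univ_castSucc, e2]
          simp only [Fin.snoc_castSucc, Fin.succ_castSucc, Fin.succ_last, Fin.snoc_last,
            stepDensity, Fin.val_castSucc, Fin.val_last]
          ring

end IsBackwardScheme

end Scheme

end

section

/-! ### The probabilistic representation of chain integrals -/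

variable {d : ℕ} {T : ℝ} {P : ℝ → Kernel (Sp d) (Sp d)} {p : Sp d → ℝ → Sp d → Sp d → ℝ}
  {θ : ℝ → Sp d → Sp d → ℝ}
  {Ω : Type*} [MeasurableSpace Ω] {μ : Measure Ω} [IsProbabilityMeasure μ]
  {τ : ℕ → Ω → ℝ} {X : ℕ → Ω → Sp d} {y : Sp d}

/-- The event that there are exactly `n` jumps up to time `t`. -/
def jumpEvent (τ : ℕ → Ω → ℝ) (n : ℕ) (t : ℝ) : Set Ω := {ω | τ n ω ≤ t ∧ t < τ (n + 1) ω}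

/-- The first `n` jump times together with the positions at these times. -/
def schemeTuple (τ : ℕ → Ω → ℝ) (X : ℕ → Ω → Sp d) (n : ℕ) (ω : Ω) (i : Fin n) : ℝ × Sp d :=
  (τ (i + 1) ω, X (i + 1) ω)

/-- The product of the masses of the first `n` steps. -/
def massProd (T : ℝ) (p : Sp d → ℝ → Sp d → Sp d → ℝ) (τ : ℕ → Ω → ℝ) (X : ℕ → Ω → Sp d) (n : ℕ)
    (ω : Ω) : ℝ≥0∞ := ∏ i : Fin n, massE T p (τ (i + 1) ω - τ i ω) (X i ω)

omit [IsProbabilityMeasure μ] in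
lemma measurableSet_jumpEvent (hτ : IsPoissonJumpTimes μ τ) (n : ℕ) (t : ℝ) :
    MeasurableSet (jumpEvent τ n t) :=
  (measurableSet_le (hτ.meas n) measurable_const).inter
    (measurableSet_lt measurable_const (hτ.meas (n + 1)))

omit [IsProbabilityMeasure μ] in
lemma measurable_schemeTuple (hτ : IsPoissonJumpTimes μ τ) (hX : IsBackwardScheme μ T p y τ X)
    (n : ℕ) : Measurable (schemeTuple τ X n) :=
  measurable_pi_lambda _ fun _ => (hτ.meas _).prodMk (hX.meas _)

omit [IsProbabilityMeasure μ] in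
lemma measurable_massProd (hp : IsFrozenFamily T p) (hτ : IsPoissonJumpTimes μ τ)
    (hX : IsBackwardScheme μ T p y τ X) (n : ℕ) : Measurable (massProd T p τ X n) :=
  Finset.measurable_prod _ fun _ _ => hp.measurable_massE.comp
    (((hτ.meas _).sub (hτ.meas _)).prodMk (hX.meas _))

lemma massProd_ne_top (hreg : BackwardRegularity T P p) (n : ℕ) (ω : Ω) :
    massProd T p τ X n ω ≠ ∞ :=
  ENNReal.prod_ne_top fun _ _ => hreg.massE_ne_top _ _

omit [MeasurableSpace Ω] in
lemma path_schemeTuple (hτ0 : ∀ ω, τ 0 ω = 0) (hX0 : ∀ ω, X 0 ω = y) (n : ℕ) (ω : Ω)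
    (i : Fin (n + 1)) : path (0, y) (schemeTuple τ X n ω) i = (τ i ω, X i ω) := by
  refine Fin.cases ?_ (fun j => ?_) i
  · simp [path, hτ0, hX0]
  · rw [path_succ]; simp [schemeTuple]

lemma measurable_chainWeight_phiE (hp : IsFrozenFamily T p) (n : ℕ) :
    Measurable fun v : Fin n → ℝ × Sp d => chainWeight (link (phiE T p)) (0, y) v := by
  have := measurable_chainWeight (n := n) (ℓ := link (phiE T p))
    (measurable_link hp.measurable_phiE)
  exact this.comp (f := fun v => (((0 : ℝ), y), v)) (by fun_prop)

/-- The densities are zero at nonpositive durations, so the ordering of the times need not be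
imposed separately. -/
lemma chainWeight_le_mul_chainWeight_phiE {n : ℕ} (s : Fin n → ℝ) (v : Fin n → Sp d) :
    chainWeight (fun a b : ℝ => if a ≤ b then (1 : ℝ≥0∞) else 0) 0 s *
        chainWeight (link (phiE T p)) (0, y) (fun i => (s i, v i))
      = chainWeight (link (phiE T p)) (0, y) (fun i => (s i, v i)) := by
  rw [← chainWeight_comp Prod.fst (fun a b : ℝ => if a ≤ b then (1 : ℝ≥0∞) else 0)
    ((0 : ℝ), y) (fun i => (s i, v i)), ← chainWeight_mul]
  congr 1
  funext a b
  by_cases h : a.1 ≤ b.1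
  · simp [h]
  · have : phiE T p (b.1 - a.1) a.2 b.2 = 0 :=
      phiE_of_notMem (fun h' => h (by linarith [h'.1])) _ _
    simp [link, this]

/-- The law of the scheme on the event of exactly `n` jumps, weighted by the masses. -/
lemma setLIntegral_massProd (hp : IsFrozenFamily T p) (hreg : BackwardRegularity T P p)
    (hτ : IsPoissonJumpTimes μ τ) (hX : IsBackwardScheme μ T p y τ X) (n : ℕ) {t : ℝ} (ht : t ≤ T)
    {F : (Fin n → ℝ × Sp d) → ℝ≥0∞} (hF : Measurable F) :
    ∫⁻ ω in jumpEvent τ n t, massProd T p τ X n ω * F (schemeTuple τ X n ω) ∂μ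
      = ENNReal.ofReal (Real.exp (-t)) * ∫⁻ v in {v | (pathEnd (0, y) v).1 ≤ t},
          chainWeight (link (phiE T p)) (0, y) v * F v := by
  -- Bounding all of the first n times, and not just the last, makes H vanish beyond the horizon for
  -- every sequence of times. Almost surely the times increase, and the event is the same.
  set D : Set (ℕ → ℝ) := {s | (∀ k ≤ n, s k ≤ t) ∧ t < s (n + 1)} with hD_def
  have hD : MeasurableSet D := by
    have h1 : MeasurableSet {s : ℕ → ℝ | ∀ k ≤ n, s k ≤ t} := by
      have : {s : ℕ → ℝ | ∀ k ≤ n, s k ≤ t} = ⋂ k, ⋂ _ : k ≤ n, {s | s k ≤ t} := by ext; simp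
      rw [this]
      exact MeasurableSet.iInter fun k => MeasurableSet.iInter fun _ =>
        measurableSet_le (measurable_pi_apply k) measurable_const
    exact h1.inter (measurableSet_lt measurable_const (measurable_pi_apply _))
  have hae : ∀ᵐ ω ∂μ, (fun k => τ k ω) ∈ D ↔ ω ∈ jumpEvent τ n t := by
    filter_upwards [hτ.ae_strictMono] with ω hω
    constructor
    · exact fun h => ⟨h.1 n le_rfl, h.2⟩
    · exact fun h => ⟨fun k hk => (hω.monotone hk).trans h.1, h.2⟩
  set H : (ℕ → ℝ) × (Fin (n + 1) → Sp d) → ℝ≥0∞ := fun h =>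
    D.indicator (fun _ => F fun i => (h.1 (i + 1), h.2 i.succ)) h.1 with hH_def
  have hHm : Measurable H := by
    have h1 : Measurable fun h : (ℕ → ℝ) × (Fin (n + 1) → Sp d) =>
        F fun i : Fin n => (h.1 (i + 1), h.2 i.succ) :=
      hF.comp (measurable_pi_lambda _ fun i => by fun_prop)
    exact h1.indicator (hD.preimage measurable_fst)
  have key := hX.lintegral_prod_massE hτ.meas hp hreg n hHm fun h ⟨k, hk, hkT⟩ => by
    simp only [hH_def]
    rw [Set.indicator_of_notMem]
    intro h'
    have := h'.1 k hk
    linarith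
  set K : (Fin n → ℝ) → ℝ≥0∞ := fun s => ∫⁻ v : Fin n → Sp d,
    chainWeight (link (phiE T p)) (0, y) (fun i => (s i, v i)) * F fun i => (s i, v i) with hK_def
  have hWm := measurable_chainWeight_phiE (y := y) hp n
  have hzip : Measurable fun q : (Fin n → ℝ) × (Fin n → Sp d) =>
      (fun i => (q.1 i, q.2 i) : Fin n → ℝ × Sp d) := by fun_prop
  have hKm : Measurable K := Measurable.lintegral_prod_right'
    (f := fun q : (Fin n → ℝ) × (Fin n → Sp d) =>
      chainWeight (link (phiE T p)) (0, y) (fun i => (q.1 i, q.2 i)) * F fun i => (q.1 i, q.2 i))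
    ((hWm.mul hF).comp hzip)
  have hE := measurableSet_jumpEvent hτ n t
  have e1 : ∫⁻ ω in jumpEvent τ n t, massProd T p τ X n ω * F (schemeTuple τ X n ω) ∂μ
      = ∫⁻ ω, (∏ i : Fin n, massE T p (τ (i + 1) ω - τ i ω) (X i ω)) * H (histMap τ X n ω) ∂μ := by
    rw [← lintegral_indicator hE]
    refine lintegral_congr_ae ?_
    filter_upwards [hae] with ω hω
    by_cases h : ω ∈ jumpEvent τ n t
    · rw [Set.indicator_of_mem h]
      simp only [hH_def, histMap]
      rw [Set.indicator_of_mem (hω.2 h)]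
      simp only [Fin.val_succ]
      rfl
    · rw [Set.indicator_of_notMem h]
      simp only [hH_def, histMap]
      rw [Set.indicator_of_notMem fun h' => h (hω.1 h'), mul_zero]
  have e2 : ∫⁻ ω, (∫⁻ v : Fin n → Sp d, (∏ i : Fin n, phiE T p (τ (i + 1) ω - τ i ω)
          (path y v i.castSucc) (path y v i.succ)) * H (fun k => τ k ω, path y v)) ∂μ
      = ∫⁻ ω in jumpEvent τ n t, K (jumpTuple τ n ω) ∂μ := by
    rw [← lintegral_indicator hE]
    refine lintegral_congr_ae ?_
    filter_upwards [hae] with ω hω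
    by_cases h : ω ∈ jumpEvent τ n t
    · rw [Set.indicator_of_mem h]
      refine lintegral_congr fun v => ?_
      simp only [hH_def]
      rw [Set.indicator_of_mem (hω.2 h)]
      congr 1
      · unfold chainWeight
        refine Finset.prod_congr rfl fun i _ => ?_
        have h1 : ∀ k, (path ((0 : ℝ), y) (fun j => (jumpTuple τ n ω j, v j)) k)
            = (τ k ω, path y v k) := fun k => by
          refine Prod.ext ?_ ?_
          · rw [← path_map Prod.fst]
            exact hτ.path_jumpTuple ω k
          · rw [← path_map Prod.snd]
        rw [h1, h1]
        simp [link]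
    · rw [Set.indicator_of_notMem h]
      refine (lintegral_congr fun v => ?_).trans lintegral_zero
      simp only [hH_def]
      rw [Set.indicator_of_notMem fun h' => h (hω.1 h'), mul_zero]
  have hB : MeasurableSet {v : Fin n → ℝ × Sp d | (pathEnd (0, y) v).1 ≤ t} :=
    measurableSet_le (measurable_pathEnd.comp (measurable_const.prodMk measurable_id)).fst
      measurable_const
  have hB' : MeasurableSet {s : Fin n → ℝ | pathEnd 0 s ≤ t} :=
    measurableSet_le (measurable_pathEnd.comp (measurable_const.prodMk measurable_id))
      measurable_const
  rw [e1, key, e2]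
  unfold jumpEvent
  rw [hτ.setLIntegral_jumpTuple n hKm t]
  congr 1
  rw [← lintegral_indicator hB, ← lintegral_indicator hB',
    lintegral_fin_prod (F := {v : Fin n → ℝ × Sp d | (pathEnd (0, y) v).1 ≤ t}.indicator
      fun v => chainWeight (link (phiE T p)) (0, y) v * F v) ((hWm.mul hF).indicator hB)]
  refine lintegral_congr fun s => ?_
  have h1 : ∀ v : Fin n → Sp d, (pathEnd ((0 : ℝ), y) fun i => (s i, v i)).1 = pathEnd 0 s :=
    fun v => (path_map Prod.fst _ _ _).symm
  simp only [Set.indicator_apply, Set.mem_ofPred_eq, h1]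
  split_ifs with hs
  · rw [hK_def, ← lintegral_const_mul _ (by
      exact (hWm.mul hF).comp (hzip.comp (f := fun v => (s, v)) (by fun_prop)))]
    refine lintegral_congr fun v => ?_
    rw [← mul_assoc, chainWeight_le_mul_chainWeight_phiE]
  · simp

/-- The weighted law of the scheme, as an identity of measures. -/
lemma map_schemeTuple (hp : IsFrozenFamily T p) (hreg : BackwardRegularity T P p)
    (hτ : IsPoissonJumpTimes μ τ) (hX : IsBackwardScheme μ T p y τ X) (n : ℕ) {t : ℝ}
    (ht : t ≤ T) :
    ((μ.restrict (jumpEvent τ n t)).withDensity (massProd T p τ X n)).map (schemeTuple τ X n)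
      = ENNReal.ofReal (Real.exp (-t)) • (volume.restrict
          {v : Fin n → ℝ × Sp d | (pathEnd (0, y) v).1 ≤ t}).withDensity
            (chainWeight (link (phiE T p)) (0, y)) := by
  have hV := measurable_schemeTuple hτ hX n
  have hM := measurable_massProd hp hτ hX n
  have hW := measurable_chainWeight_phiE (y := y) hp n
  refine Measure.ext fun S hS => ?_
  have h1 : Measurable (S.indicator (1 : (Fin n → ℝ × Sp d) → ℝ≥0∞)) :=
    measurable_one.indicator hS
  rw [← lintegral_indicator_one hS, lintegral_map h1 hV, Measure.smul_apply,
    ← lintegral_indicator_one hS]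
  rw [lintegral_withDensity_eq_lintegral_mul _ hM
      (g := fun ω => S.indicator 1 (schemeTuple τ X n ω)) (h1.comp hV),
    lintegral_withDensity_eq_lintegral_mul _ hW h1]
  exact setLIntegral_massProd hp hreg hτ hX n ht h1

/-- For n ≥ 1 the jump time has a density. A jump exactly at t would give age zero, where the
truncated kernel is zero but G is arbitrary. -/
lemma ae_jumpTime_ne (hτ : IsPoissonJumpTimes μ τ) (n : ℕ) {t : ℝ} (ht : 0 < t) :
    ∀ᵐ ω ∂μ, τ n ω ≠ t := by
  rcases n with _ | n
  · exact .of_forall fun ω => by rw [hτ.zero]; exact ht.ne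
  have hm : MeasurableSet {s : Fin (n + 1) → ℝ | s (Fin.last n) = t} :=
    measurableSet_eq_fun (measurable_pi_apply _) measurable_const
  have h := hτ.lintegral_jumpTuple (n + 1)
    (F := {s : Fin (n + 1) → ℝ | s (Fin.last n) = t}.indicator 1) (measurable_one.indicator hm)
  rw [lintegral_snoc (F := fun s => chainWeight (fun a b => exponentialPDF 1 (b - a)) 0 s *
      {s : Fin (n + 1) → ℝ | s (Fin.last n) = t}.indicator 1 s)
    ((IsPoissonJumpTimes.measurable_exp_weight (n + 1)).mul (measurable_one.indicator hm))] at h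
  have h0 : ∫⁻ w : ℝ, ∫⁻ v : Fin n → ℝ,
      chainWeight (fun a b => exponentialPDF 1 (b - a)) 0 (Fin.snoc v w : Fin (n + 1) → ℝ) *
      {s : Fin (n + 1) → ℝ | s (Fin.last n) = t}.indicator 1 (Fin.snoc v w : Fin (n + 1) → ℝ)
      = 0 := by
    rw [← lintegral_zero (μ := (volume : Measure ℝ))]
    refine lintegral_congr_ae ?_
    filter_upwards [Measure.ae_ne volume t] with w hw
    simp [hw]
  rw [h0] at h
  have hi : Measurable fun ω => {s : Fin (n + 1) → ℝ | s (Fin.last n) = t}.indicator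
      (1 : (Fin (n + 1) → ℝ) → ℝ≥0∞) (jumpTuple τ (n + 1) ω) :=
    (measurable_one.indicator hm).comp (hτ.measurable_jumpTuple (n + 1))
  filter_upwards [(lintegral_eq_zero_iff hi).1 h] with ω hω heq
  have h2 : jumpTuple τ (n + 1) ω ∈ {s : Fin (n + 1) → ℝ | s (Fin.last n) = t} := by
    simpa [jumpTuple] using heq
  rw [Set.indicator_of_mem h2] at hω
  simp at hω

end

section

/-! ### The probabilistic representation of the series -/

variable {d : ℕ} {T : ℝ} {P : ℝ → Kernel (Sp d) (Sp d)} {p : Sp d → ℝ → Sp d → Sp d → ℝ}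
  {θ : ℝ → Sp d → Sp d → ℝ}
  {Ω : Type*} [MeasurableSpace Ω] {μ : Measure Ω} [IsProbabilityMeasure μ]
  {τ : ℕ → Ω → ℝ} {X : ℕ → Ω → Sp d} {y : Sp d}
  {F : Type*} [NormedAddCommGroup F] [NormedSpace ℝ F]

/-- The weight `θ` as a kernel with the departure point first, extended by zero outside
`(0, T]`. -/
def swapWeight (T : ℝ) (θ : ℝ → Sp d → Sp d → ℝ) : ℝ → Sp d → Sp d → ℝ :=
  trunc T fun u z w => θ u w z

lemma IsBackwardWeight.measurable_swapWeight (hθ : IsBackwardWeight T P p θ) :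
    Measurable fun q : ℝ × Sp d × Sp d => swapWeight T θ q.1 q.2.1 q.2.2 :=
  measurable_trunc_of_continuousOn (hθ.cont.comp
    (f := fun q : ℝ × Sp d × Sp d => (q.1, q.2.2, q.2.1)) (by fun_prop)
    fun q hq => ⟨hq.1, Set.mem_univ _⟩)

lemma trunc_aHat_eq (hp : IsFrozenFamily T p) (u : ℝ) (z w : Sp d) :
    trunc T (aHat p θ) u z w = (phiE T p u z w).toReal * swapWeight T θ u z w := by
  unfold phiE swapWeight
  by_cases hu : u ∈ Set.Ioc 0 T
  · simp only [trunc_of_mem hu]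
    rw [ENNReal.toReal_ofReal (hp.phi_nonneg hu.1 z w), mul_comm]
    rfl
  · simp [trunc_of_notMem hu]

/-- Each â splits into φ, which becomes the law of a step, and θ, which becomes its weight. -/
lemma chainTerm_aHat_eq (hp : IsFrozenFamily T p) (G : ℝ → Sp d → Sp d → F) (n : ℕ) (t : ℝ)
    (y x : Sp d) (v : Fin n → ℝ × Sp d) :
    chainTerm (trunc T (aHat p θ)) G n t y x v
      = (chainWeight (link (phiE T p)) (0, y) v).toReal •
        chainTerm (swapWeight T θ) G n t y x v := by
  unfold chainTerm
  rw [smul_smul]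
  congr 1
  unfold chainWeight
  rw [ENNReal.toReal_prod, ← Finset.prod_mul_distrib]
  refine Finset.prod_congr rfl fun i _ => ?_
  exact trunc_aHat_eq hp _ _ _

lemma chainWeight_phiE_ne_top {n : ℕ} (v : Fin n → ℝ × Sp d) :
    chainWeight (link (phiE T p)) (0, y) v ≠ ∞ :=
  ENNReal.prod_ne_top fun _ _ => ENNReal.ofReal_ne_top

/-- The integrand of the representation, written in terms of the first `n` jumps. -/
def jumpTerm (T : ℝ) (p : Sp d → ℝ → Sp d → Sp d → ℝ) (θ : ℝ → Sp d → Sp d → ℝ)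
    (τ : ℕ → Ω → ℝ) (X : ℕ → Ω → Sp d) (G : ℝ → Sp d → Sp d → F) (n : ℕ) (t : ℝ) (y x : Sp d)
    (ω : Ω) : F :=
  (massProd T p τ X n ω).toReal •
    chainTerm (swapWeight T θ) (trunc T G) n t y x (schemeTuple τ X n ω)

omit [MeasurableSpace Ω] in
-- On this event every gap up to the n-th jump and the final age lie in (0, T], so the truncations
-- are invisible and the functional depends on the first n jumps only.
lemma pathWeight_smul_eq [MeasurableSpace Ω] (hp : IsFrozenFamily T p) (hτ0 : ∀ ω, τ 0 ω = 0)
    (hX0 : ∀ ω, X 0 ω = y) (G : ℝ → Sp d → Sp d → F) {n : ℕ} {t : ℝ} (ht : t ≤ T) (x : Sp d) {ω : Ω}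
    (hmono : StrictMono fun k => τ k ω) (hω : ω ∈ jumpEvent τ n t) (hne : τ n ω ≠ t) :
    pathWeight p θ τ X t ω • G (lastAge τ t ω) (lastPos τ X t ω) x
      = jumpTerm T p θ τ X G n t y x ω := by
  have hJ : jumpCount τ t ω = n := jumpCount_eq hmono hω.1 hω.2
  have hpos : ∀ k, 0 ≤ τ k ω := fun k => by
    rw [← hτ0 ω]; exact hmono.monotone (Nat.zero_le k)
  have hgap : ∀ i : Fin n, τ (i + 1) ω - τ i ω ∈ Set.Ioc 0 T := fun i => by
    have h1 : τ i ω < τ (i + 1) ω := hmono (Nat.lt_succ_self _)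
    have h2 : τ (i + 1) ω ≤ τ n ω := hmono.monotone (by have := i.2; omega)
    have h3 := hpos i
    have h4 := hω.1
    exact ⟨by linarith, by linarith⟩
  have hage : t - τ n ω ∈ Set.Ioc 0 T := by
    have h1 := hpos n
    have h2 := lt_of_le_of_ne hω.1 hne
    exact ⟨by linarith, by linarith⟩
  unfold jumpTerm chainTerm pathWeight lastAge lastPos massProd chainWeight
  rw [hJ, smul_smul, ENNReal.toReal_prod, ← Finset.prod_mul_distrib, Finset.prod_range]
  simp only [pathEnd, path_schemeTuple hτ0 hX0, Fin.val_last]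
  rw [trunc_of_mem hage]
  congr 1
  refine Finset.prod_congr rfl fun i _ => ?_
  rw [phiMass_eq hp (hgap i)]
  simp only [link, swapWeight, Fin.val_castSucc, Fin.val_succ]
  rw [trunc_of_mem (hgap i)]

/-! ### Expectations as sums over the number of jumps. -/

section Main

variable [MeasurableSpace F] [BorelSpace F] [SecondCountableTopology F]
  {G : ℝ → Sp d → Sp d → F}
  (hp : IsFrozenFamily T p) (hreg : BackwardRegularity T P p) (hθ : IsBackwardWeight T P p θ)
  (hτ : IsPoissonJumpTimes μ τ) (hX : IsBackwardScheme μ T p y τ X)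
  (hG : Measurable fun q : ℝ × Sp d × Sp d => trunc T G q.1 q.2.1 q.2.2)
include hp hθ hτ hX hG

omit [IsProbabilityMeasure μ] in
lemma measurable_jumpTerm (n : ℕ) (t : ℝ) (x : Sp d) :
    Measurable (jumpTerm T p θ τ X G n t y x) :=
  (measurable_massProd hp hτ hX n).ennreal_toReal.smul
    ((measurable_chainTerm_apply hθ.measurable_swapWeight hG n t y x).comp
      (measurable_schemeTuple hτ hX n))

include hreg

lemma setLIntegral_jumpTerm_le (n : ℕ) {t : ℝ} (ht : t ≤ T) (x : Sp d) :
    ∫⁻ ω in jumpEvent τ n t, ‖jumpTerm T p θ τ X G n t y x ω‖ₑ ∂μ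
      ≤ ENNReal.ofReal (Real.exp (-t)) *
        ∫⁻ v, ‖chainTerm (trunc T (aHat p θ)) (trunc T G) n t y x v‖ₑ := by
  have hg := measurable_chainTerm_apply hθ.measurable_swapWeight hG n t y x
  have h := setLIntegral_massProd hp hreg hτ hX n ht hg.enorm
  have e1 : ∀ ω, ‖jumpTerm T p θ τ X G n t y x ω‖ₑ = massProd T p τ X n ω *
      ‖chainTerm (swapWeight T θ) (trunc T G) n t y x (schemeTuple τ X n ω)‖ₑ := fun ω => by
    unfold jumpTerm
    rw [enorm_smul, Real.enorm_of_nonneg ENNReal.toReal_nonneg,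
      ENNReal.ofReal_toReal (massProd_ne_top hreg n ω)]
  simp_rw [e1]
  rw [h]
  refine mul_le_mul' le_rfl ?_
  refine (setLIntegral_le_lintegral _ _).trans (lintegral_mono fun v => ?_)
  rw [chainTerm_aHat_eq hp, enorm_smul, Real.enorm_of_nonneg ENNReal.toReal_nonneg,
    ENNReal.ofReal_toReal (chainWeight_phiE_ne_top v)]

/-- Using the masses as a density turns the law of the scheme into e^(-t) times Lebesgue measure
weighted by the φ's, which recombine with the θ's to â. Chains whose last time exceeds t contribute
nothing. -/
lemma setIntegral_jumpTerm [CompleteSpace F] (n : ℕ) {t : ℝ} (ht : t ≤ T) (x : Sp d) :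
    ∫ ω in jumpEvent τ n t, jumpTerm T p θ τ X G n t y x ω ∂μ
      = Real.exp (-t) • chainInt (trunc T (aHat p θ)) (trunc T G) n t y x := by
  have hg := measurable_chainTerm_apply hθ.measurable_swapWeight hG n t y x
  have hV := measurable_schemeTuple hτ hX n
  have hM := measurable_massProd hp hτ hX n
  have hW := measurable_chainWeight_phiE (y := y) hp n
  have h1 := integral_withDensity_eq_integral_toReal_smul (μ := μ.restrict (jumpEvent τ n t)) hM
    (.of_forall fun ω => (massProd_ne_top hreg n ω).lt_top)
    (fun ω => chainTerm (swapWeight T θ) (trunc T G) n t y x (schemeTuple τ X n ω))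
  unfold jumpTerm
  rw [← h1, ← integral_map hV.aemeasurable (f := chainTerm (swapWeight T θ) (trunc T G) n t y x)
    hg.aestronglyMeasurable, map_schemeTuple hp hreg hτ hX n ht, integral_smul_measure,
    ENNReal.toReal_ofReal (Real.exp_pos _).le,
    integral_withDensity_eq_integral_toReal_smul hW
      (.of_forall fun v => (chainWeight_phiE_ne_top v).lt_top)]
  congr 1
  simp_rw [← chainTerm_aHat_eq hp]
  refine setIntegral_eq_integral_of_forall_compl_eq_zero fun v hv => ?_
  simp only [Set.mem_ofPred_eq, not_le] at hv
  unfold chainTerm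
  rw [trunc_of_nonpos (by linarith), smul_zero]

/-- The probabilistic representation of the sum of the chain integrals. -/
theorem integrable_and_tsum_chainInt_eq [CompleteSpace F] {t : ℝ} (ht : t ∈ Set.Ioc 0 T) (x : Sp d)
    (hsum : ∑' n, ∫⁻ v, ‖chainTerm (trunc T (aHat p θ)) (trunc T G) n t y x v‖ₑ ≠ ∞) :
    Integrable (fun ω => pathWeight p θ τ X t ω • G (lastAge τ t ω) (lastPos τ X t ω) x) μ ∧
      ∑' n, chainInt (trunc T (aHat p θ)) (trunc T G) n t y x = Real.exp t •
        ∫ ω, pathWeight p θ τ X t ω • G (lastAge τ t ω) (lastPos τ X t ω) x ∂μ := by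
  set Z : Ω → F := fun ω => pathWeight p θ τ X t ω • G (lastAge τ t ω) (lastPos τ X t ω) x with hZ
  have hE := fun n => measurableSet_jumpEvent hτ n t
  have hae : ∀ n, Z =ᵐ[μ.restrict (jumpEvent τ n t)] jumpTerm T p θ τ X G n t y x := fun n => by
    rw [Filter.EventuallyEq, ae_restrict_iff' (hE n)]
    filter_upwards [hτ.ae_strictMono, ae_jumpTime_ne hτ n ht.1] with ω h1 h2 h3
    exact pathWeight_smul_eq hp hτ.zero hX.init G ht.2 x h1 h3 h2
  have hU : μ.restrict (⋃ n, jumpEvent τ n t) = μ := by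
    refine Measure.restrict_eq_self_of_ae_mem ?_
    filter_upwards [hτ.ae_exists_jumpCount ht.1.le] with ω ⟨n, hn⟩
    exact Set.mem_iUnion.2 ⟨n, hn⟩
  have hdisj : Pairwise (Function.onFun (AEDisjoint μ) fun n => jumpEvent τ n t) := by
    intro m n hmn
    refine measure_mono_null ?_ (ae_iff.1 hτ.ae_strictMono)
    intro ω hω hmono
    exact hmn ((jumpCount_eq hmono hω.1.1 hω.1.2).symm.trans (jumpCount_eq hmono hω.2.1 hω.2.2))
  -- The absolute chain integrals are summable, which gives integrability before any expectation is
  -- computed.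
  have hint : IntegrableOn Z (⋃ n, jumpEvent τ n t) μ := by
    refine ⟨aestronglyMeasurable_iUnion_iff.2 fun n => ?_, ?_⟩
    · exact (measurable_jumpTerm hp hθ hτ hX hG n t x).aestronglyMeasurable.congr (hae n).symm
    · refine (lintegral_iUnion_le _ _).trans_lt ?_
      refine (ENNReal.tsum_le_tsum fun n => ?_).trans_lt (b := ∑' n, ENNReal.ofReal (Real.exp (-t)) *
        ∫⁻ v, ‖chainTerm (trunc T (aHat p θ)) (trunc T G) n t y x v‖ₑ) ?_
      · rw [lintegral_congr_ae ((hae n).mono fun ω hω => by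
          show ‖Z ω‖ₑ = ‖jumpTerm T p θ τ X G n t y x ω‖ₑ; rw [hω])]
        exact setLIntegral_jumpTerm_le hp hreg hθ hτ hX hG n ht.2 x
      · rw [ENNReal.tsum_mul_left]
        exact ENNReal.mul_lt_top ENNReal.ofReal_lt_top hsum.lt_top
  refine ⟨by rwa [IntegrableOn, hU] at hint, ?_⟩
  have h1 := hasSum_integral_iUnion_ae (fun n => (hE n).nullMeasurableSet) hdisj hint
  rw [hU] at h1
  have h2 : ∀ n, ∫ ω in jumpEvent τ n t, Z ω ∂μ
      = Real.exp (-t) • chainInt (trunc T (aHat p θ)) (trunc T G) n t y x := fun n => by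
    rw [integral_congr_ae (hae n)]
    exact setIntegral_jumpTerm hp hreg hθ hτ hX hG n ht.2 x
  simp_rw [h2] at h1
  have h3 := (h1.const_smul (Real.exp t)).tsum_eq
  simp_rw [smul_smul, ← Real.exp_add] at h3
  simpa using h3

end Main

end

section

/-! ### Differentiation under the integral sign -/

variable {d : ℕ}

/-- Jensen's inequality, from Hölder's inequality against the constant 1. -/
lemma lintegral_rpow_le_lintegral_rpow {α : Type*} [MeasurableSpace α] {μ : Measure α}
    [IsProbabilityMeasure μ] {z : ℝ} (hz : 1 < z) {f : α → ℝ≥0∞} (hf : Measurable f) :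
    (∫⁻ a, f a ∂μ) ^ z ≤ ∫⁻ a, f a ^ z ∂μ := by
  have h := ENNReal.lintegral_mul_le_Lp_mul_Lq μ (Real.HolderConjugate.conjExponent hz)
    hf.aemeasurable (g := 1) aemeasurable_const
  simp only [mul_one, Pi.one_apply, ENNReal.one_rpow, lintegral_const, measure_univ] at h
  calc (∫⁻ a, f a ∂μ) ^ z ≤ ((∫⁻ a, f a ^ z ∂μ) ^ (1 / z)) ^ z := by gcongr
    _ = _ := by
      rw [← ENNReal.rpow_mul, one_div, inv_mul_cancel₀ (by linarith), ENNReal.rpow_one]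

/-- The fundamental theorem of calculus along the segment. An infinite integral makes the bound
trivial, so the gradient need not be assumed integrable. -/
lemma enorm_sub_le_lintegral_of_hasGradientAt {h : Sp d → ℝ} {H : Sp d → Sp d} (hH : Measurable H)
    (hd : ∀ x, HasGradientAt h (H x) x) (x x' : Sp d) :
    ‖h x' - h x‖ₑ ≤ (∫⁻ s in Set.Ioc (0 : ℝ) 1, ‖H (x + s • (x' - x))‖ₑ) * ‖x' - x‖ₑ := by
  have hm : Measurable fun s : ℝ => H (x + s • (x' - x)) := hH.comp (by fun_prop)
  rcases eq_or_ne x' x with rfl | hne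
  · simp
  rcases eq_or_ne (∫⁻ s in Set.Ioc (0 : ℝ) 1, ‖H (x + s • (x' - x))‖ₑ) ∞ with htop | hfin
  · rw [htop, ENNReal.top_mul (by simpa [sub_eq_zero] using hne)]
    exact le_top
  have hpath : ∀ s : ℝ, HasDerivAt (fun s : ℝ => h (x + s • (x' - x)))
      (inner ℝ (H (x + s • (x' - x))) (x' - x)) s := fun s => by
    have h1 : HasDerivAt (fun s : ℝ => x + s • (x' - x)) (x' - x) s := by
      simpa using ((hasDerivAt_id s).smul_const (x' - x)).const_add x
    have h2 := (hd (x + s • (x' - x))).hasFDerivAt.comp_hasDerivAt s h1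
    rwa [InnerProductSpace.toDual_apply_apply] at h2
  have hle : ∀ s : ℝ, ‖inner ℝ (H (x + s • (x' - x))) (x' - x)‖ₑ
      ≤ ‖H (x + s • (x' - x))‖ₑ * ‖x' - x‖ₑ := fun s => by
    rw [← ofReal_norm, ← ofReal_norm, ← ofReal_norm, ← ENNReal.ofReal_mul (norm_nonneg _)]
    exact ENNReal.ofReal_le_ofReal (norm_inner_le_norm _ _)
  have hbound : ∫⁻ s in Set.Ioc (0 : ℝ) 1, ‖inner ℝ (H (x + s • (x' - x))) (x' - x)‖ₑ
      ≤ (∫⁻ s in Set.Ioc (0 : ℝ) 1, ‖H (x + s • (x' - x))‖ₑ) * ‖x' - x‖ₑ := by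
    rw [← lintegral_mul_const _ hm.enorm]
    exact lintegral_mono hle
  have hI : IntervalIntegrable (fun s : ℝ => inner ℝ (H (x + s • (x' - x))) (x' - x))
      volume 0 1 := by
    rw [intervalIntegrable_iff_integrableOn_Ioc_of_le zero_le_one]
    exact ⟨(hm.inner measurable_const).aestronglyMeasurable,
      hbound.trans_lt (ENNReal.mul_lt_top hfin.lt_top enorm_lt_top)⟩
  have hF := intervalIntegral.integral_eq_sub_of_hasDerivAt (fun s _ => hpath s) hI
  rw [intervalIntegral.integral_of_le zero_le_one] at hF
  simp only [one_smul, add_sub_cancel, zero_smul, add_zero] at hF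
  rw [← hF]
  exact (enorm_integral_le_lintegral_enorm _).trans hbound

/-- Each coordinate of the gradient is a limit of difference quotients with increments 1/n. -/
lemma measurable_of_hasGradientAt {α : Type*} [MeasurableSpace α] {f : α → Sp d → ℝ}
    {g : α → Sp d → Sp d} (hf : Measurable fun q : α × Sp d => f q.1 q.2)
    (hd : ∀ a x, HasGradientAt (f a) (g a x) x) :
    Measurable fun q : α × Sp d => g q.1 q.2 := by
  set b := EuclideanSpace.basisFun (Fin d) ℝ
  have h : (fun q : α × Sp d => g q.1 q.2) = fun q => ∑ i, (inner ℝ (b i) (g q.1 q.2)) • b i := by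
    funext q
    exact (b.sum_repr' _).symm
  rw [h]
  refine Finset.measurable_sum _ fun i _ => Measurable.smul_const ?_ _
  have hlim : ∀ q : α × Sp d, Tendsto (fun n : ℕ => (n : ℝ) •
      (f q.1 (q.2 + (n : ℝ)⁻¹ • b i) - f q.1 q.2)) atTop (𝓝 (inner ℝ (b i) (g q.1 q.2))) :=
    fun q => by
    have := (hd q.1 q.2).hasFDerivAt.lim (b i) (c := fun n : ℕ => (n : ℝ)) (l := atTop)
      (by simpa using tendsto_natCast_atTop_atTop)
    rwa [InnerProductSpace.toDual_apply_apply, real_inner_comm] at this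
  refine measurable_of_tendsto_metrizable (fun n => ?_) (tendsto_pi_nhds.2 hlim)
  have h1 : Measurable fun q : α × Sp d => f q.1 (q.2 + (n : ℝ)⁻¹ • b i) :=
    hf.comp (f := fun q : α × Sp d => (q.1, q.2 + (n : ℝ)⁻¹ • b i)) (by fun_prop)
  exact (h1.sub hf).const_smul (n : ℝ)

/-- For every v the normalized first-order remainder tends to zero, and it is at most the norm of H
at x₀ plus the average of that of H over the segment. By Fubini's theorem and Jensen's inequality
these averages inherit the tightness and the L^z bound that hold uniformly on the ball, so the
convergence theorem applies without a dominating function. -/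
theorem hasGradientAt_integral {α : Type*} [MeasurableSpace α] {μ : Measure α} [SFinite μ]
    {h : α → Sp d → ℝ} {H : α → Sp d → Sp d} (hHm : Measurable fun q : α × Sp d => H q.1 q.2)
    (hd : ∀ v x, HasGradientAt (h v) (H v x) x) {x₀ : Sp d} {r : ℝ} (hr : 0 < r)
    (hhm : ∀ x, Measurable fun v => h v x)
    (hint : ∀ x ∈ Metric.ball x₀ r, Integrable (fun v => h v x) μ)
    (hHint : Integrable (fun v => H v x₀) μ) {z : ℝ} (hz : 1 < z)
    (hUI : ∀ ε : ℝ≥0∞, ε ≠ 0 → ∃ S, MeasurableSet S ∧ μ S ≠ ∞ ∧ ∃ M : ℝ≥0∞, M ≠ ∞ ∧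
      ∀ x ∈ Metric.ball x₀ r, ∫⁻ v in Sᶜ, ‖H v x‖ₑ ∂μ ≤ ε ∧ ∫⁻ v in S, ‖H v x‖ₑ ^ z ∂μ ≤ M) :
    HasGradientAt (fun x => ∫ v, h v x ∂μ) (∫ v, H v x₀ ∂μ) x₀ := by
  set g : Sp d → α → ℝ≥0∞ := fun x' v =>
    ‖‖x' - x₀‖⁻¹ * (h v x' - h v x₀ - inner ℝ (H v x₀) (x' - x₀))‖ₑ with hg
  set D : Sp d → α → ℝ≥0∞ := fun x' v =>
    ∫⁻ s in Set.Ioc (0 : ℝ) 1, ‖H v (x₀ + s • (x' - x₀))‖ₑ with hD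
  have hHx : ∀ x, Measurable fun v => H v x := fun x =>
    hHm.comp (f := fun v : α => (v, x)) (by fun_prop)
  have hDm2 : ∀ x', Measurable fun q : α × ℝ => ‖H q.1 (x₀ + q.2 • (x' - x₀))‖ₑ := fun x' =>
    (hHm.comp (f := fun q : α × ℝ => (q.1, x₀ + q.2 • (x' - x₀))) (by fun_prop)).enorm
  have hDm : ∀ x', Measurable (D x') := fun x' => (hDm2 x').lintegral_prod_right'
  have hgm : ∀ x', Measurable (g x') := fun x' =>
    (measurable_const.mul (((hhm x').sub (hhm x₀)).sub ((hHx x₀).inner measurable_const))).enorm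
  have hball : ∀ x' ∈ Metric.ball x₀ r, ∀ s ∈ Set.Ioc (0 : ℝ) 1,
      x₀ + s • (x' - x₀) ∈ Metric.ball x₀ r := fun x' hx' s hs =>
    (convex_ball x₀ r).add_smul_sub_mem (Metric.mem_ball_self hr) hx' ⟨hs.1.le, hs.2⟩
  have hgle : ∀ x' v, g x' v ≤ D x' v + ‖H v x₀‖ₑ := fun x' v => by
    rcases eq_or_ne x' x₀ with rfl | hne
    · simp [hg]
    have hpos : 0 < ‖x' - x₀‖ := norm_pos_iff.2 (sub_ne_zero.2 hne)
    have h1 := enorm_sub_le_lintegral_of_hasGradientAt ((hHm.comp (f := fun x : Sp d => (v, x))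
      (by fun_prop))) (hd v) x₀ x'
    have h2 : ‖inner ℝ (H v x₀) (x' - x₀)‖ₑ ≤ ‖H v x₀‖ₑ * ‖x' - x₀‖ₑ := by
      rw [← ofReal_norm, ← ofReal_norm, ← ofReal_norm, ← ENNReal.ofReal_mul (norm_nonneg _)]
      exact ENNReal.ofReal_le_ofReal (norm_inner_le_norm _ _)
    have h3 : ‖‖x' - x₀‖⁻¹‖ₑ = ‖x' - x₀‖ₑ⁻¹ := by
      rw [enorm_inv hpos.ne', enorm_norm]
    have h0 : ‖x' - x₀‖ₑ ≠ 0 := by simpa [sub_eq_zero] using hne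
    calc g x' v = ‖x' - x₀‖ₑ⁻¹ * ‖h v x' - h v x₀ - inner ℝ (H v x₀) (x' - x₀)‖ₑ := by
          rw [hg, ← h3, ← enorm_mul]
      _ ≤ ‖x' - x₀‖ₑ⁻¹ * ((D x' v + ‖H v x₀‖ₑ) * ‖x' - x₀‖ₑ) := by
          rw [add_mul]
          exact mul_le_mul' le_rfl ((enorm_sub_le).trans (add_le_add h1 h2))
      _ = D x' v + ‖H v x₀‖ₑ := by
          rw [mul_comm (D x' v + _), ← mul_assoc, ENNReal.inv_mul_cancel h0 enorm_ne_top, one_mul]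
  -- Integrating over v before averaging reduces everything to bounds at single points of the ball,
  -- which contains the segment.
  have hswap : ∀ (S : Set α) (x' : Sp d), ∫⁻ v in S, D x' v ∂μ
      = ∫⁻ s in Set.Ioc (0 : ℝ) 1, (∫⁻ v in S, ‖H v (x₀ + s • (x' - x₀))‖ₑ ∂μ) := fun S x' =>
    lintegral_lintegral_swap (hDm2 x').aemeasurable
  have hprob : IsProbabilityMeasure ((volume : Measure ℝ).restrict (Set.Ioc (0 : ℝ) 1)) :=
    ⟨by simp⟩
  have hone : ∀ c : ℝ≥0∞, ∀ φ : ℝ → ℝ≥0∞, (∀ s ∈ Set.Ioc (0 : ℝ) 1, φ s ≤ c) →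
      ∫⁻ s in Set.Ioc (0 : ℝ) 1, φ s ≤ c := fun c φ hφ => by
    calc _ ≤ ∫⁻ _ in Set.Ioc (0 : ℝ) 1, c := setLIntegral_mono' measurableSet_Ioc hφ
      _ = c := by simp
  have hnear : ∀ᶠ x' in 𝓝 x₀, x' ∈ Metric.ball x₀ r := Metric.ball_mem_nhds _ hr
  have hlim : Tendsto (fun x' => ∫⁻ v, g x' v ∂μ) (𝓝 x₀) (𝓝 0) := by
    refine tendsto_lintegral_zero_of_tight_of_rpow_bounded hz (.of_forall hgm)
      (.of_forall fun v => ?_) fun ε hε => ?_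
    · have h1 := hasFDerivAt_iff_tendsto.1 (hd v x₀).hasFDerivAt
      simp only [InnerProductSpace.toDual_apply_apply] at h1
      have h2 := (ENNReal.continuous_ofReal.tendsto 0).comp h1
      rw [ENNReal.ofReal_zero] at h2
      refine h2.congr fun x' => ?_
      change ENNReal.ofReal _ = ‖‖x' - x₀‖⁻¹ * (h v x' - h v x₀ - inner ℝ (H v x₀) (x' - x₀))‖ₑ
      rw [← ofReal_norm, norm_mul, norm_inv, norm_norm]
    · obtain ⟨S, hS, hSfin, M, hM, hall⟩ := hUI (ε / 2) (ENNReal.half_pos hε).ne'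
      refine ⟨S, hS, hSfin, hnear.mono fun x' hx' => ?_, 2 ^ (z - 1) * (M + M), by finiteness,
        hnear.mono fun x' hx' => ?_⟩
      · calc ∫⁻ v in Sᶜ, g x' v ∂μ ≤ ∫⁻ v in Sᶜ, (D x' v + ‖H v x₀‖ₑ) ∂μ := lintegral_mono (hgle x')
          _ = ∫⁻ v in Sᶜ, D x' v ∂μ + ∫⁻ v in Sᶜ, ‖H v x₀‖ₑ ∂μ := lintegral_add_left (hDm x') _
          _ ≤ ε / 2 + ε / 2 := by
            refine add_le_add ?_ (hall x₀ (Metric.mem_ball_self hr)).1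
            rw [hswap]
            exact hone _ _ fun s hs => (hall _ (hball x' hx' s hs)).1
          _ = ε := ENNReal.add_halves ε
      · calc ∫⁻ v in S, g x' v ^ z ∂μ
            ≤ ∫⁻ v in S, 2 ^ (z - 1) * ((∫⁻ s in Set.Ioc (0 : ℝ) 1,
                ‖H v (x₀ + s • (x' - x₀))‖ₑ ^ z) + ‖H v x₀‖ₑ ^ z) ∂μ := by
              refine lintegral_mono fun v => ?_
              refine (ENNReal.rpow_le_rpow (hgle x' v) (by linarith)).trans ?_
              refine (ENNReal.rpow_add_le_mul_rpow_add_rpow _ _ hz.le).trans ?_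
              refine mul_le_mul' le_rfl (add_le_add ?_ le_rfl)
              exact lintegral_rpow_le_lintegral_rpow hz
                ((hDm2 x').comp (f := fun s : ℝ => (v, s)) (by fun_prop))
          _ = 2 ^ (z - 1) * ((∫⁻ v in S, (∫⁻ s in Set.Ioc (0 : ℝ) 1,
                ‖H v (x₀ + s • (x' - x₀))‖ₑ ^ z) ∂μ) + ∫⁻ v in S, ‖H v x₀‖ₑ ^ z ∂μ) := by
              rw [lintegral_const_mul' _ _ (by finiteness),
                lintegral_add_right _ ((hHx x₀).enorm.pow_const z)]
          _ ≤ 2 ^ (z - 1) * (M + M) := by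
              refine mul_le_mul' le_rfl (add_le_add ?_ (hall x₀ (Metric.mem_ball_self hr)).2)
              rw [lintegral_lintegral_swap ((hDm2 x').pow_const z).aemeasurable]
              exact hone _ _ fun s hs => (hall _ (hball x' hx' s hs)).2
  rw [hasGradientAt_iff_hasFDerivAt, hasFDerivAt_iff_tendsto]
  have hreal : Tendsto (fun x' => (∫⁻ v, g x' v ∂μ).toReal) (𝓝 x₀) (𝓝 0) := by
    exact (ENNReal.tendsto_toReal ENNReal.zero_ne_top).comp hlim
  refine squeeze_zero' (.of_forall fun x' => by positivity) ?_ hreal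
  -- Any finite bound would do: finiteness is what permits the passage to real values.
  have hfin : ∀ᶠ x' in 𝓝 x₀, ∫⁻ v, g x' v ∂μ < 1 := hlim.eventually (gt_mem_nhds one_pos)
  filter_upwards [hnear, hfin] with x' hx' hlt
  have hx₀ := hint x₀ (Metric.mem_ball_self hr)
  rw [InnerProductSpace.toDual_apply_apply]
  have e1 : ‖x' - x₀‖⁻¹ * (∫ v, h v x' ∂μ - ∫ v, h v x₀ ∂μ - inner ℝ (∫ v, H v x₀ ∂μ) (x' - x₀))
      = ∫ v, ‖x' - x₀‖⁻¹ * (h v x' - h v x₀ - inner ℝ (H v x₀) (x' - x₀)) ∂μ := by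
    have e2 : ∫ v, inner ℝ (H v x₀) (x' - x₀) ∂μ = inner ℝ (∫ v, H v x₀ ∂μ) (x' - x₀) := by
      rw [real_inner_comm, ← integral_inner hHint]
      simp_rw [real_inner_comm]
    rw [integral_const_mul, ← e2, ← integral_sub (hint x' hx') hx₀]
    congr 1
    exact (integral_sub ((hint x' hx').sub hx₀) (hHint.inner_const _)).symm
  calc ‖x' - x₀‖⁻¹ * ‖∫ v, h v x' ∂μ - ∫ v, h v x₀ ∂μ - inner ℝ (∫ v, H v x₀ ∂μ) (x' - x₀)‖
      = ‖∫ v, ‖x' - x₀‖⁻¹ * (h v x' - h v x₀ - inner ℝ (H v x₀) (x' - x₀)) ∂μ‖ := by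
        rw [← e1, norm_mul, norm_inv, norm_norm]
    _ ≤ (∫⁻ v, g x' v ∂μ).toReal := by
        rw [← toReal_enorm]
        exact ENNReal.toReal_mono (hlt.trans ENNReal.one_lt_top).ne
          (enorm_integral_le_lintegral_enorm _)

end

section

/-! ### The gradient of the series -/

variable {d : ℕ} {T r ζ : ℝ} {Ξ : ℝ → ℝ≥0∞} {a : ℝ → Sp d → Sp d → ℝ}

lemma hasGradientAt_trunc {f : ℝ → Sp d → Sp d → ℝ}
    (hf : ∀ t ∈ Set.Ioc 0 T, ∀ y, Differentiable ℝ (f t y)) (t : ℝ) (z x : Sp d) :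
    HasGradientAt (trunc T f t z) (trunc T (fun t z x => gradient (f t z) x) t z x) x := by
  by_cases ht : t ∈ Set.Ioc 0 T
  · rw [trunc_of_mem ht, show trunc T f t z = f t z from funext fun x => trunc_of_mem ht _ _ _]
    exact (hf t ht z x).hasGradientAt
  · rw [trunc_of_notMem ht, show trunc T f t z = fun _ => 0 from
      funext fun x => trunc_of_notMem ht _ _ _]
    exact hasGradientAt_const _ _

lemma hasGradientAt_chainTerm {f : ℝ → Sp d → Sp d → ℝ} {g : ℝ → Sp d → Sp d → Sp d}
    (hg : ∀ t z x, HasGradientAt (f t z) (g t z x) x) (n : ℕ) (t : ℝ) (y x : Sp d)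
    (v : Fin n → ℝ × Sp d) :
    HasGradientAt (fun x => chainTerm a f n t y x v) (chainTerm a g n t y x v) x := by
  rw [hasGradientAt_iff_hasFDerivAt]
  unfold chainTerm
  rw [map_smulₛₗ]
  rw [conj_trivial]
  exact (hg _ _ x).hasFDerivAt.const_smul (chainWeight (link a) (0, y) v)

/-- Each term is differentiated under the integral by uniform integrability, and the sum termwise
because the gradients have a summable bound on a ball. Only g needs chain bounds; of f,
integrability and summability suffice. -/
theorem ChainBounds.hasGradientAt_tsum {f : ℝ → Sp d → Sp d → ℝ} {g : ℝ → Sp d → Sp d → Sp d}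
    (hb : ChainBounds T r ζ Ξ a g) (hr : 0 < r) (hζ : 1 < ζ)
    (hΞ : ∀ t₀ > (0 : ℝ), ∃ M : ℝ≥0∞, M ≠ ∞ ∧ ∀ t ∈ Set.Icc t₀ T, Ξ t ≤ M)
    (ham : Measurable fun q : ℝ × Sp d × Sp d => a q.1 q.2.1 q.2.2)
    (hfm : Measurable fun q : ℝ × Sp d × Sp d => f q.1 q.2.1 q.2.2)
    (hgm : Measurable fun q : ℝ × Sp d × Sp d => g q.1 q.2.1 q.2.2)
    (ha0 : ∀ t ≤ 0, ∀ x y, a t x y = 0) (hg0 : ∀ t ≤ 0, ∀ x y, g t x y = 0)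
    (hg : ∀ t z x, HasGradientAt (f t z) (g t z x) x) {t : ℝ} (ht : t ∈ Set.Ioc 0 T) (y : Sp d)
    (hint : ∀ n x, Integrable (chainTerm a f n t y x))
    (hsum : ∀ x, Summable fun n => chainInt a f n t y x) (x₀ : Sp d) :
    HasGradientAt (fun x => ∑' n, chainInt a f n t y x) (∑' n, chainInt a g n t y x₀) x₀ := by
  have hterm : ∀ n x, HasGradientAt (fun x => chainInt a f n t y x) (chainInt a g n t y x) x := by
    intro n x
    rcases Nat.eq_zero_or_pos n with rfl | hn
    · simpa only [chainInt_zero] using hg t y x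
    refine hasGradientAt_integral (μ := volume) (h := fun v x => chainTerm a f n t y x v)
      (H := fun v x => chainTerm a g n t y x v) (r := r) (z := ζ) ?_
      (fun v x => hasGradientAt_chainTerm hg n t y x v) hr
      (fun x => measurable_chainTerm_apply ham hfm n t y x) (fun x _ => hint n x)
      (hb.integrable hr hΞ ham hgm n ht y x) hζ fun ε hε => ?_
    · exact (measurable_chainTerm ham hgm n).comp
        (f := fun q : (Fin n → ℝ × Sp d) × Sp d => ((t, y, q.2), q.1)) (by fun_prop)
    · obtain ⟨S, hS, hSv, M, hM, hall⟩ := hb.exists_chainBox hΞ ha0 hg0 hn ht.1 y x hε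
      exact ⟨S, hS, hSv, M, hM, fun x' hx' =>
        hall t ⟨le_rfl, ht.2⟩ y (Metric.mem_ball_self hr) x' hx'⟩
  obtain ⟨M, hM⟩ := hb.exists_geometric hΞ ht.1 y x₀
  have hbd : ∀ n : ℕ, ∀ x ∈ Metric.ball x₀ r,
      ‖chainInt a g (n + 1) t y x‖ ≤ ((M * 2⁻¹ ^ (n + 1) : ℝ≥0) : ℝ) := fun n x hx =>
    norm_chainInt_le (hM (n + 1) (by omega) t ⟨le_rfl, ht.2⟩ y (Metric.mem_ball_self hr) x hx)
  have hmem : x₀ ∈ Metric.ball x₀ r := Metric.mem_ball_self hr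
  -- The geometric bound starts at n = 1, so the zeroth term is differentiated separately.
  have htail := hasFDerivAt_tsum_of_isPreconnected
    (f := fun n x => chainInt a f (n + 1) t y x)
    (f' := fun n x => InnerProductSpace.toDual ℝ (Sp d) (chainInt a g (n + 1) t y x))
    ((summable_nat_add_iff 1).2 (summable_mul_two_inv_pow M)) Metric.isOpen_ball
    (convex_ball x₀ r).isPreconnected (fun n x _ => (hterm (n + 1) x).hasFDerivAt)
    (fun n x hx => by simpa using hbd n x hx) hmem ((summable_nat_add_iff 1).2 (hsum x₀)) hmem
  have hfun : (fun x => ∑' n, chainInt a f n t y x)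
      = fun x => chainInt a f 0 t y x + ∑' n, chainInt a f (n + 1) t y x :=
    funext fun x => (hsum x).tsum_eq_zero_add
  rw [hasGradientAt_iff_hasFDerivAt, hfun, (hb.summable hr hΞ ht y x₀).tsum_eq_zero_add, map_add]
  refine (hterm 0 x₀).hasFDerivAt.add ?_
  have hmap := (InnerProductSpace.toDual ℝ (Sp d)).toContinuousLinearEquiv.map_tsum
    (L := .unconditional ℕ) (f := fun n => chainInt a g (n + 1) t y x₀)
  exact htail.congr_fderiv hmap.symm

lemma ChainBounds.tsum_lintegral_ne_top {F : Type*} [NormedAddCommGroup F] [NormedSpace ℝ F]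
    [MeasurableSpace F] [BorelSpace F] [SecondCountableTopology F]
    {G : ℝ → Sp d → Sp d → F}
    (hb : ChainBounds T r ζ Ξ a G) (hr : 0 < r)
    (hΞ : ∀ t₀ > (0 : ℝ), ∃ M : ℝ≥0∞, M ≠ ∞ ∧ ∀ t ∈ Set.Icc t₀ T, Ξ t ≤ M)
    {t : ℝ} (ht : t ∈ Set.Ioc 0 T) (y x : Sp d) :
    ∑' n, ∫⁻ v, ‖chainTerm a G n t y x v‖ₑ ≠ ∞ := by
  obtain ⟨M, hM⟩ := hb.exists_geometric hΞ ht.1 y x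
  have hle : ∀ n, ∫⁻ v, ‖chainTerm a G (n + 1) t y x v‖ₑ
      ≤ ((M * 2⁻¹ ^ (n + 1) : ℝ≥0) : ℝ≥0∞) := fun n => hM (n + 1) (by omega) t
    ⟨le_rfl, ht.2⟩ y (Metric.mem_ball_self hr) x (Metric.mem_ball_self hr)
  have hgeom : Summable fun n : ℕ => M * 2⁻¹ ^ (n + 1) := by
    have h := (summable_nat_add_iff 1).2 (summable_mul_two_inv_pow M)
    exact NNReal.summable_coe.1 h
  have hfin : ∑' n : ℕ, ((M * 2⁻¹ ^ (n + 1) : ℝ≥0) : ℝ≥0∞) ≠ ∞ :=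
    ENNReal.tsum_coe_ne_top_iff_summable.2 hgeom
  have hzero : ∫⁻ v, ‖chainTerm a G 0 t y x v‖ₑ ≠ ∞ := by
    rw [lintegral_fin_zero]
    exact enorm_ne_top
  rw [tsum_eq_zero_add' ENNReal.summable]
  exact ENNReal.add_ne_top.2 ⟨hzero, ne_top_of_le_ne_top hfin (ENNReal.tsum_le_tsum hle)⟩

/-- Continuity of the gradient is not assumed; its measurability comes from the difference quotients
of φ. -/
lemma measurable_trunc_gradPhi {p : Sp d → ℝ → Sp d → Sp d → ℝ} (hp : IsFrozenFamily T p)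
    (hdiff : ∀ t ∈ Set.Ioc 0 T, ∀ y, Differentiable ℝ (phi p t y)) :
    Measurable fun q : ℝ × Sp d × Sp d => trunc T (gradPhi p) q.1 q.2.1 q.2.2 := by
  have h := measurable_of_hasGradientAt (α := ℝ × Sp d) (f := fun a x => trunc T (phi p) a.1 a.2 x)
    (g := fun a x => trunc T (gradPhi p) a.1 a.2 x)
    ((measurable_trunc hp.measurable_phi).comp
      (f := fun q : (ℝ × Sp d) × Sp d => (q.1.1, q.1.2, q.2)) (by fun_prop))
    fun a x => hasGradientAt_trunc hdiff a.1 a.2 x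
  exact h.comp (f := fun q : ℝ × Sp d × Sp d => ((q.1, q.2.1), q.2.2)) (by fun_prop)

end

end

end Parametrix

/-! ### Assembly of the theorem. -/

open Parametrix in
theorem mainTheorem9 {d : ℕ} (T : ℝ) (hT : 0 < T)
    (P : ℝ → Kernel (Sp d) (Sp d)) (p : Sp d → ℝ → Sp d → Sp d → ℝ)
    (θ : ℝ → Sp d → Sp d → ℝ) (γ β : ℝ → Sp d → Sp d → ℝ≥0) (ρ : ℝ)
    (hP : IsMainSemigroup T P) (hp : IsFrozenFamily T p) (hL : GeneratorsAgree T P p)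
    (hreg : BackwardRegularity T P p) (hθ : IsBackwardWeight T P p θ)
    (hdom : BackwardDomination T p θ γ β ρ)
    (hUI : UniformIntegrability T γ ρ (fun t x y => phi p t x y))
    (hcont : ContinuousOn
      (fun q : ℝ × Sp d × Sp d => (p q.2.2 q.1 q.2.1 q.2.2, aHat p θ q.1 q.2.1 q.2.2))
      (Set.Ioc 0 T ×ˢ Set.univ)) :
    ((∀ t ∈ Set.Ioc 0 T, ∀ x y, Summable (fun n => seriesTerm p θ n t x y)) ∧
      (∀ t ∈ Set.Ioc 0 T, ∀ x, ∀ f, IsTest f →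
        kernelOp P t f x = ∫ y, f y * transDensity p θ t x y) ∧
      ContinuousOn (fun q : ℝ × Sp d × Sp d => transDensity p θ q.1 q.2.1 q.2.2)
        (Set.Ioc 0 T ×ˢ Set.univ) ∧
      (∀ (Ω : Type*) [MeasurableSpace Ω] (μ : Measure Ω) [IsProbabilityMeasure μ]
        (τ : ℕ → Ω → ℝ) (y : Sp d) (X : ℕ → Ω → Sp d),
        IsPoissonJumpTimes μ τ → IsBackwardScheme μ T p y τ X →
        ∀ t ∈ Set.Ioc 0 T, ∀ x,
          Integrable (fun ω => phi p (lastAge τ t ω) (lastPos τ X t ω) x *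
            pathWeight p θ τ X t ω) μ ∧
          transDensity p θ t x y = Real.exp t *
            ∫ ω, phi p (lastAge τ t ω) (lastPos τ X t ω) x * pathWeight p θ τ X t ω ∂μ)) ∧
    ((∀ t ∈ Set.Ioc 0 T, ∀ y, Differentiable ℝ (fun x => p y t x y)) →
      UniformIntegrability T γ ρ (fun t z x => gradPhi p t z x) →
      (∀ t ∈ Set.Ioc 0 T, ∀ y, Differentiable ℝ (fun x => transDensity p θ t x y)) ∧
      (∀ (Ω : Type*) [MeasurableSpace Ω] (μ : Measure Ω) [IsProbabilityMeasure μ]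
        (τ : ℕ → Ω → ℝ) (y : Sp d) (X : ℕ → Ω → Sp d),
        IsPoissonJumpTimes μ τ → IsBackwardScheme μ T p y τ X →
        ∀ t ∈ Set.Ioc 0 T, ∀ x,
          Integrable (fun ω => pathWeight p θ τ X t ω •
            gradPhi p (lastAge τ t ω) (lastPos τ X t ω) x) μ ∧
          gradient (fun x' => transDensity p θ t x' y) x = Real.exp t •
            ∫ ω, pathWeight p θ τ X t ω •
              gradPhi p (lastAge τ t ω) (lastPos τ X t ω) x ∂μ)) := by
  -- Backward chains run from the arrival point to the departure point, so the two space variables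
  -- are interchanged.
  have hphi : ContinuousOn (fun q : ℝ × Sp d × Sp d => phi p q.1 q.2.1 q.2.2)
      (Set.Ioc 0 T ×ˢ Set.univ) :=
    hcont.fst.comp (t := Set.Ioc 0 T ×ˢ Set.univ)
      (f := fun q : ℝ × Sp d × Sp d => (q.1, q.2.2, q.2.1)) (by fun_prop)
      fun q hq => ⟨hq.1, Set.mem_univ _⟩
  have haHat : ContinuousOn (fun q : ℝ × Sp d × Sp d => aHat p θ q.1 q.2.1 q.2.2)
      (Set.Ioc 0 T ×ˢ Set.univ) := hcont.snd
  obtain ⟨A, ha⟩ := hdom.exists_dominatedKernel haHat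
  have hphim := measurable_trunc (T := T) hp.measurable_phi
  obtain ⟨r, hr, ζ, hζ, Ξ, hΞ, hb⟩ := hUI.exists_chainBounds hdom.rho_nonneg hphim ha.meas
    ha.ne_top ha.bound ha.zero
  have hint := fun t (ht : t ∈ Set.Ioc 0 T) n z x => hb.integrable hr hΞ ha.meas hphim n ht z x
  have hsum := fun t (ht : t ∈ Set.Ioc 0 T) z x => hb.summable hr hΞ ht z x
  have hdens := fun t (ht : t ∈ Set.Ioc 0 T) x y =>
    transDensity_eq_tsum hp hdom ha hb hr hΞ ht x y
  have hcts := hb.continuousOn_tsum hr hζ hΞ ha.meas hphim ha.zero (continuousOn_trunc haHat)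
    (fun t ht x y => trunc_of_nonpos ht _ x y) (continuousOn_trunc hphi)
  refine ⟨⟨fun t ht x y => summable_seriesTerm hp hdom ha hb hr hΞ ht x y,
    fun t ht x f hf => ?_, ?_, ?_⟩, fun hdiff hUIg => ?_⟩
  · rw [kernelOp_eq_integral_tsum hP hp hL hreg hθ hdom ha hphi haHat hint hsum hcts ht x hf]
    exact integral_congr_ae (.of_forall fun z => by simp only [hdens t ht x z])
  · refine ContinuousOn.congr (f := fun q : ℝ × Sp d × Sp d => ∑' n,
      chainInt (trunc T (aHat p θ)) (trunc T (phi p)) n q.1 q.2.2 q.2.1) ?_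
      fun q hq => hdens q.1 hq.1 q.2.1 q.2.2
    exact hcts.comp (t := Set.Ioc 0 T ×ˢ Set.univ)
      (f := fun q : ℝ × Sp d × Sp d => (q.1, q.2.2, q.2.1)) (by fun_prop)
      fun q hq => ⟨hq.1, Set.mem_univ _⟩
  · intro Ω _ μ _ τ y X hτ hX t ht x
    have h := integrable_and_tsum_chainInt_eq hp hreg hθ hτ hX hphim ht x
      (hb.tsum_lintegral_ne_top hr hΞ ht y x)
    simp only [smul_eq_mul, mul_comm (pathWeight p θ τ X t _)] at h
    exact ⟨h.1, (hdens t ht x y).trans h.2⟩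
  · have hgm := measurable_trunc_gradPhi hp hdiff
    -- The gradient kernel comes with its own radius, exponent and bound, while the domination of â
    -- is unchanged.
    obtain ⟨r', hr', ζ', hζ', Ξ', hΞ', hb'⟩ := hUIg.exists_chainBounds hdom.rho_nonneg hgm ha.meas
      ha.ne_top ha.bound ha.zero
    have hgrad : ∀ t ∈ Set.Ioc 0 T, ∀ y x, HasGradientAt (fun x' => transDensity p θ t x' y)
        (∑' n, chainInt (trunc T (aHat p θ)) (trunc T (gradPhi p)) n t y x) x := by
      intro t ht y x
      simp_rw [hdens t ht]
      exact hb'.hasGradientAt_tsum hr' hζ' hΞ' ha.meas hphim hgm ha.zero_of_nonpos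
        (fun t ht x y => trunc_of_nonpos ht _ x y) (hasGradientAt_trunc hdiff) ht y
        (fun n x => hint t ht n y x) (fun x => hsum t ht y x) x
    refine ⟨fun t ht y x => (hgrad t ht y x).differentiableAt, ?_⟩
    intro Ω _ μ _ τ y X hτ hX t ht x
    rw [(hgrad t ht y x).gradient]
    exact integrable_and_tsum_chainInt_eq hp hreg hθ hτ hX hgm ht x
      (hb'.tsum_lintegral_ne_top hr' hΞ' ht y x)
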